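/- **Setting.** Let $M$ be a connected smooth Riemannian manifold with a smooth isometric action of a compact Lie group $\mathsf G$ that has at least one orbit of codimension one, and suppose that the orbit space $M/\mathsf G$ is an interval, identified with $[-1,1]$; let $\pi\colon M\to M/\mathsf G=[-1,1]$ be the projection. Let $\gamma\colon\mathbb R\to M$ be a geodesic that is perpendicular to all orbits and lifts $M/\mathsf G$, that is, $\pi(\gamma(t))=t$ for $t\in[-1,1]$. Let $s\in\{-1,1\}$, let $\mathsf H=\mathsf G_{\gamma(0)}$ be the principal isotropy group, let $\mathsf K=\mathsf G_{\gamma(s)}$, and let $S=\mathsf G\cdot\gamma(s)\cong\mathsf G/\mathsf K$. Let $D(S)$ be the tubular neighborhood of $S$ given by $\pi^{-1}([-1,0])$ if $s=-1$ and by $\pi^{-1}([0,1])$ if $s=1$. **Lemma.** Suppose that $S$ is a singular orbit, i.e. $\dim S<\dim \mathsf G/\mathsf H$, and that $\mathsf H$ is a normal subgroup of $\mathsf K$. Then there is a smooth right action of $\mathsf K/\mathsf H$ on $D(S)$ such that: 1. it fixes every point of $S$; 2. its orbits in $D(S)\setminus S$ are exactly the fibers of the homogeneous fibration $q\colon \mathsf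 G/\mathsf H\to \mathsf G/\mathsf K$, $q(a\mathsf H)=a\mathsf K$, in the principal orbits contained in $D(S)$, i.e. the sets $\{a\cdot\gamma(t): a\mathsf H\in q^{-1}(g\mathsf K)\}=g\mathsf K\cdot\gamma(t)$ with $g\in\mathsf G$, $-1<t<1$ and $st\ge 0$; 3. on each of these principal orbits, identified with $\mathsf G/\mathsf H$ through $a\mathsf H\mapsto a\cdot\gamma(t)$, it is the right action $(g\mathsf H)\cdot(k\mathsf H)=gk\mathsf H$, i.e. $(g\cdot\gamma(t))\cdot(k\mathsf H)=gk\cdot\gamma(t)$ for all $g\in \mathsf G$ and $k\in\mathsf K$. Here smoothness means that the map $D(S)\times\mathsf K\to M$, $(x,k)\mapsto x\cdot(k\mathsf H)$, is smooth: near every point of $D(S)\times \mathsf K$ it extends to a smooth map on an open subset of $M\times\mathsf G$. -/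

import Mathlib

open Bundle
open scoped Manifold ContDiff

noncomputable section

/-- A (parametrized) geodesic `γ : ℝ → M` of a Riemannian manifold with Riemannian distance `dist`:
a smooth curve that is locally length minimizing with constant speed. -/
structure IsGeodesic {E : Type*} [NormedAddCommGroup E] [NormedSpace ℝ E]
    {M : Type*} [MetricSpace M] [ChartedSpace E M] (γ : ℝ → M) : Prop where
  smooth : ContMDiff 𝓘(ℝ, ℝ) 𝓘(ℝ, E) ∞ γ
  locally_minimizing : ∃ c : ℝ, 0 ≤ c ∧ ∀ t : ℝ, ∃ ε > 0,
    ∀ t₁ ∈ Set.Ioo (t - ε) (t + ε), ∀ t₂ ∈ Set.Ioo (t - ε) (t + ε),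
      dist (γ t₁) (γ t₂) = c * |t₁ - t₂|

/-- The differential at `1` of the orbit map `G → M`, `g ↦ g • x`. -/
def orbitDifferential {E E' : Type*} [NormedAddCommGroup E] [NormedSpace ℝ E]
    [NormedAddCommGroup E'] [NormedSpace ℝ E']
    (G : Type*) [Group G] [TopologicalSpace G] [ChartedSpace E' G]
    {M : Type*} [TopologicalSpace M] [ChartedSpace E M] [MulAction G M] (x : M) :
    TangentSpace 𝓘(ℝ, E') (1 : G) →L[ℝ] TangentSpace 𝓘(ℝ, E) x :=
  mfderiv 𝓘(ℝ, E') 𝓘(ℝ, E) (fun g : G => g • x) (1 : G)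

/-- The tangent space at `x` of the orbit `G • x`. -/
def orbitTangentSpace {E E' : Type*} [NormedAddCommGroup E] [NormedSpace ℝ E]
    [NormedAddCommGroup E'] [NormedSpace ℝ E']
    (G : Type*) [Group G] [TopologicalSpace G] [ChartedSpace E' G]
    {M : Type*} [TopologicalSpace M] [ChartedSpace E M] [MulAction G M] (x : M) :
    Submodule ℝ (TangentSpace 𝓘(ℝ, E) x) :=
  LinearMap.range (orbitDifferential (E := E) (E' := E') G x).toLinearMap

/-- The dimension of the orbit `G • x`. -/
def orbitDim {E E' : Type*} [NormedAddCommGroup E] [NormedSpace ℝ E]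
    [NormedAddCommGroup E'] [NormedSpace ℝ E']
    (G : Type*) [Group G] [TopologicalSpace G] [ChartedSpace E' G]
    {M : Type*} [TopologicalSpace M] [ChartedSpace E M] [MulAction G M] (x : M) : ℕ :=
  Module.finrank ℝ (orbitTangentSpace (E := E) (E' := E') G x)

/-- The action of `G` on the Riemannian manifold `M` is smooth, is by Riemannian isometries, and
has an orbit of codimension one. -/
structure IsCohomogeneityOneAction (E E' : Type*) [NormedAddCommGroup E] [NormedSpace ℝ E]
    [NormedAddCommGroup E'] [NormedSpace ℝ E']
    (G : Type*) [Group G] [TopologicalSpace G] [ChartedSpace E' G]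
    (M : Type*) [MetricSpace M] [ChartedSpace E M]
    [RiemannianBundle (fun x : M => TangentSpace 𝓘(ℝ, E) x)] [MulAction G M] : Prop where
  smooth : ContMDiffSMul 𝓘(ℝ, E') 𝓘(ℝ, E) ∞ G M
  isometric : ∀ (g : G) (x : M) (v w : TangentSpace 𝓘(ℝ, E) x),
    inner ℝ (mfderiv 𝓘(ℝ, E) 𝓘(ℝ, E) (fun y : M => g • y) x v)
      (mfderiv 𝓘(ℝ, E) 𝓘(ℝ, E) (fun y : M => g • y) x w) = inner ℝ v w
  exists_codim_one : ∃ x : M, orbitDim (E := E) (E' := E') G x + 1 = Module.finrank ℝ E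

/-- The projection `π : M → M / G = [-1, 1]`, regarded as a real function, for a given
identification `e` of the orbit space with the interval `[-1, 1]`. -/
def orbitProj {G M : Type*} [Group G] [TopologicalSpace M] [MulAction G M]
    (e : MulAction.orbitRel.Quotient G M ≃ₜ Set.Icc (-1 : ℝ) 1) (x : M) : ℝ :=
  (e (Quotient.mk (MulAction.orbitRel G M) x) : ℝ)

/-- `γ` is a geodesic of `M` that is perpendicular to all orbits of `G` and whose restriction to
`[-1, 1]` is a lift of `M / G = [-1, 1]`. -/
structure IsNormalGeodesic {E E' : Type*} [NormedAddCommGroup E] [NormedSpace ℝ E]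
    [NormedAddCommGroup E'] [NormedSpace ℝ E']
    {G : Type*} [Group G] [TopologicalSpace G] [ChartedSpace E' G]
    {M : Type*} [MetricSpace M] [ChartedSpace E M]
    [RiemannianBundle (fun x : M => TangentSpace 𝓘(ℝ, E) x)] [MulAction G M]
    (e : MulAction.orbitRel.Quotient G M ≃ₜ Set.Icc (-1 : ℝ) 1) (γ : ℝ → M) : Prop where
  geodesic : IsGeodesic (E := E) γ
  perpendicular : ∀ t : ℝ, ∀ v ∈ orbitTangentSpace (E := E) (E' := E') G (γ t),
    inner ℝ (mfderiv 𝓘(ℝ, ℝ) 𝓘(ℝ, E) γ t (1 : ℝ)) v = 0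
  lift : ∀ t ∈ Set.Icc (-1 : ℝ) 1, orbitProj e (γ t) = t

/-- The tubular neighborhood `D(S)` of the orbit `S = π⁻¹(s)` over the endpoint `s = ±1` of
`M / G = [-1, 1]`: it is `π⁻¹([-1, 0])` for `s = -1` and `π⁻¹([0, 1])` for `s = 1`. -/
def tubularNhd {G M : Type*} [Group G] [TopologicalSpace M] [MulAction G M]
    (e : MulAction.orbitRel.Quotient G M ≃ₜ Set.Icc (-1 : ℝ) 1) (s : ℝ) : Set M :=
  {x | 0 ≤ s * orbitProj e x}

/-- A map `f : A → N` on a subset `A` of a manifold `P` is smooth if near every point of `A`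
it extends to a smooth map on an open subset of `P`. On an embedded submanifold of `P`, possibly
with boundary, this is smoothness with respect to the submanifold structure. -/
def IsSmoothOnSubset {E₁ E₂ H₁ : Type*} [NormedAddCommGroup E₁] [NormedSpace ℝ E₁]
    [TopologicalSpace H₁] (I : ModelWithCorners ℝ E₁ H₁)
    [NormedAddCommGroup E₂] [NormedSpace ℝ E₂]
    {P N : Type*} [TopologicalSpace P] [ChartedSpace H₁ P]
    [TopologicalSpace N] [ChartedSpace E₂ N] (A : Set P) (f : A → N) : Prop :=
  ∀ p : A, ∃ (U : Set P) (F : P → N), IsOpen U ∧ (p : P) ∈ U ∧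
    ContMDiffOn I 𝓘(ℝ, E₂) ∞ F U ∧ ∀ a : A, (a : P) ∈ U → F a = f a

/-- The fiber over `g K` of the homogeneous fibration `q : G / H → G / K`, `q (a H) = a K`, viewed
inside the orbit of `x` through `a H ↦ a • x`. -/
def homogeneousFiber {G M : Type*} [Group G] [MulAction G M] {H K : Subgroup G} (hHK : H ≤ K)
    (x : M) (g : G) : Set M :=
  {y | ∃ a : G, (a : G ⧸ H) ∈ Subgroup.quotientMapOfLE hHK ⁻¹' {(g : G ⧸ K)} ∧ y = a • x}

end

/-! The formula `(g • γ t) · k = (g k) • γ t` forces the action. It is consistent over interior `t`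
because the isotropy groups along the interior of a normal geodesic all equal H
(`smul_eq_of_smul_eq`) and H is normal in K, and over the endpoint because K fixes `γ s`. Away from
S it is smooth in a slice chart whose slice is the geodesic itself. The content is smoothness across
S.

At `γ s` take as slice the image of the normal space N under the exponential map (`exists_exp`,
`exists_isPolarSlice`). The K-translates of the geodesic become rays, and K acts on N by linear
isometries ρ. Since the orbit space is an interval, ρ(K) is transitive on spheres. The stabilizer of
the direction ν of the geodesic is H, and normality of H makes it the stabilizer of every direction,
so ρ(K) is simply transitive on spheres (`isSimplyTransitive`).

In the slice the right action of k sends `t ρ(l)ν` to `t ρ(l)ρ(k)ν`. This is visibly smooth only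
away from 0. The decisive point is that it is linear: the real multiples of a compact group simply
transitive on spheres are closed under addition (in effect N is the reals, the complex numbers or
the quaternions). Hence there is a linear T from N to End N with `T(ρ(l)ν) = ρ(l)`
(`exists_linear_extension`), and the right action is `n ↦ T(n)(ρ(k)ν)`, smooth through 0
(`exists_extension_zero`).

Two ingredients need work. A geodesic is given metrically, so its geodesic equation has to be
derived: on the regular part the orbit projection solves an eikonal equation whose gradient curves
are the translates of the geodesic (`gradient`, `riem_velocity`, `hasDerivAt_momentum`). The
exponential map rests on smooth dependence of flows on initial values (`exists_smooth_flow`),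
obtained from the inverse function theorem in a space of continuous curves. -/

set_option linter.unusedSectionVars false

/-! ### One-parameter subgroups of a group simply transitive on spheres. -/

section FreeTransitive

open Filter Topology NormedSpace

variable {N : Type*} [NormedAddCommGroup N] [InnerProductSpace ℝ N]

/-- `L` is a compact group of linear isometries of `N` that acts simply transitively on the
spheres of `N`. -/
structure IsSimplyTransitive (L : Set (N →L[ℝ] N)) : Prop where
  one_mem : (1 : N →L[ℝ] N) ∈ L
  mul_mem : ∀ g ∈ L, ∀ h ∈ L, g * h ∈ L
  inv_mem : ∀ g ∈ L, ∃ h ∈ L, h * g = 1 ∧ g * h = 1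
  isCompact : IsCompact L
  norm_map : ∀ g ∈ L, ∀ v, ‖g v‖ = ‖v‖
  free : ∀ g ∈ L, ∀ v, v ≠ 0 → g v = v → g = 1
  transitive : ∀ u v : N, ‖u‖ = ‖v‖ → ∃ g ∈ L, g u = v

namespace IsSimplyTransitive

variable {L : Set (N →L[ℝ] N)}

lemma ext (hL : IsSimplyTransitive L) {g h : N →L[ℝ] N} (hg : g ∈ L) (hh : h ∈ L) {v : N}
    (hv : v ≠ 0) (hgh : g v = h v) : g = h := by
  obtain ⟨k, hk, hk1, hk2⟩ := hL.inv_mem g hg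
  have h1 : (k * h) v = v := by
    have : (k * g) v = v := by rw [hk1]; rfl
    change k (h v) = v
    rw [← hgh]; exact this
  have h2 := hL.free _ (hL.mul_mem k hk h hh) v hv h1
  calc g = g * (k * h) := by rw [h2, mul_one]
    _ = h := by rw [← mul_assoc, hk2, one_mul]

lemma pow_mem (hL : IsSimplyTransitive L) {g : N →L[ℝ] N} (hg : g ∈ L) (n : ℕ) : g ^ n ∈ L := by
  induction n with
  | zero => simpa using hL.one_mem
  | succ n ih => rw [pow_succ]; exact hL.mul_mem _ ih _ hg

lemma norm_le_one (hL : IsSimplyTransitive L) {g : N →L[ℝ] N} (hg : g ∈ L) : ‖g‖ ≤ 1 :=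
  g.opNorm_le_bound zero_le_one fun v => by rw [hL.norm_map g hg, one_mul]

end IsSimplyTransitive

lemma norm_pow_sub_pow_le {A : Type*} [NormedRing A] [NormOneClass A] {g h : A} {C : ℝ} (hC : 1 ≤ C)
    (hg : ‖g‖ ≤ 1) (hh : ‖h‖ ≤ C) (m : ℕ) : ‖g ^ m - h ^ m‖ ≤ m * ‖g - h‖ * C ^ m := by
  induction m with
  | zero => simp
  | succ m ih =>
    have hC0 : 0 ≤ C := by linarith
    have h1 : g ^ (m + 1) - h ^ (m + 1) = g * (g ^ m - h ^ m) + (g - h) * h ^ m := by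
      rw [pow_succ', pow_succ']; noncomm_ring
    have h2 : ‖h ^ m‖ ≤ C ^ m := (norm_pow_le h m).trans (pow_le_pow_left₀ (norm_nonneg _) hh m)
    have h3 : C ^ m ≤ C ^ (m + 1) := pow_le_pow_right₀ hC (Nat.le_succ m)
    rw [h1]
    calc _ ≤ ‖g‖ * ‖g ^ m - h ^ m‖ + ‖g - h‖ * ‖h ^ m‖ :=
          (norm_add_le _ _).trans (add_le_add (norm_mul_le _ _) (norm_mul_le _ _))
      _ ≤ 1 * (m * ‖g - h‖ * C ^ m) + ‖g - h‖ * C ^ m := by gcongr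
      _ = (m + 1) * ‖g - h‖ * C ^ m := by ring
      _ ≤ (m + 1) * ‖g - h‖ * C ^ (m + 1) := by gcongr
      _ = _ := by push_cast; ring

lemma norm_exp_le_exp_norm {A : Type*} [NormedRing A] [NormOneClass A] [NormedAlgebra ℝ A]
    [CompleteSpace A] (x : A) : ‖exp x‖ ≤ Real.exp ‖x‖ := by
  rw [exp_eq_tsum ℝ, Real.exp_eq_exp_ℝ]
  refine tsum_of_norm_bounded (expSeries_div_hasSum_exp ‖x‖) fun n => ?_
  rw [norm_smul, norm_inv, Real.norm_natCast, div_eq_inv_mul]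
  exact mul_le_mul_of_nonneg_left (norm_pow_le x n) (by positivity)

/-- Since `g n` and `exp (ε n • X)` differ by o(ε), their powers with about t/ε factors differ by
o(1). A closed group containing the `g n` therefore contains the half-line `exp (t • X)`. -/
lemma tendsto_pow_floor_exp {A : Type*} [NormedRing A] [NormOneClass A] [NormedAlgebra ℝ A]
    [CompleteSpace A] {g : ℕ → A} {ε : ℕ → ℝ} {X : A} (hε : ∀ n, 0 < ε n)
    (hε0 : Tendsto ε atTop (𝓝 0)) (hg : ∀ n, ‖g n‖ ≤ 1)
    (hX : Tendsto (fun n => (ε n)⁻¹ • (g n - 1)) atTop (𝓝 X)) {t : ℝ} (ht : 0 ≤ t) :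
    Tendsto (fun n => g n ^ ⌊t / ε n⌋₊) atTop (𝓝 (exp (t • X))) := by
  let _ : NormedAlgebra ℚ A := NormedAlgebra.restrictScalars ℚ ℝ A
  have hm : Tendsto (fun n => (⌊t / ε n⌋₊ : ℝ) * ε n) atTop (𝓝 t) := by
    have h1 : Tendsto (fun n => t - ε n) atTop (𝓝 t) := by simpa using hε0.const_sub t
    refine tendsto_of_tendsto_of_tendsto_of_le_of_le h1 tendsto_const_nhds (fun n => ?_)
      (fun n => ?_)
    · have := (Nat.lt_floor_add_one (t / ε n)).le
      rw [div_le_iff₀ (hε n)] at this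
      dsimp only; nlinarith
    · have := Nat.floor_le (div_nonneg ht (hε n).le)
      rwa [le_div_iff₀ (hε n)] at this
  have hexp : Tendsto (fun n => exp (((⌊t / ε n⌋₊ : ℝ) * ε n) • X)) atTop (𝓝 (exp (t • X))) :=
    ((exp_continuous (𝔸 := A)).tendsto _).comp (hm.smul_const X)
  have hd : Tendsto (fun n => (ε n)⁻¹ • (exp (ε n • X) - 1)) atTop (𝓝 X) := by
    have h1 : HasDerivAt (fun u : ℝ => exp (u • X)) X 0 := by
      simpa using hasDerivAt_exp_smul_const X (0 : ℝ)
    have h2 := h1.tendsto_slope_zero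
    have h3 : Tendsto ε atTop (𝓝[≠] 0) :=
      tendsto_nhdsWithin_iff.2 ⟨hε0, Eventually.of_forall fun n => (hε n).ne'⟩
    simpa [Function.comp_def] using h2.comp h3
  have hdiff : Tendsto (fun n => (ε n)⁻¹ * ‖g n - exp (ε n • X)‖) atTop (𝓝 0) := by
    have h1 := (hX.sub hd).norm
    simp only [sub_self, norm_zero] at h1
    refine h1.congr fun n => ?_
    rw [← smul_sub, norm_smul, Real.norm_of_nonneg (inv_nonneg.2 (hε n).le)]
    congr 2; abel
  have hbound : ∀ n, ‖g n ^ ⌊t / ε n⌋₊ - exp (((⌊t / ε n⌋₊ : ℝ) * ε n) • X)‖ ≤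
      t * Real.exp (t * ‖X‖) * ((ε n)⁻¹ * ‖g n - exp (ε n • X)‖) := by
    intro n
    set m := ⌊t / ε n⌋₊
    have hmle : (m : ℝ) ≤ t / ε n := Nat.floor_le (div_nonneg ht (hε n).le)
    have hmle' : (m : ℝ) * ε n ≤ t := by rwa [le_div_iff₀ (hε n)] at hmle
    have h1 : exp (((m : ℝ) * ε n) • X) = exp (ε n • X) ^ m := by
      rw [mul_smul, ← exp_nsmul, Nat.cast_smul_eq_nsmul]
    have h2 : ‖exp (ε n • X)‖ ≤ Real.exp (ε n * ‖X‖) := by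
      refine (norm_exp_le_exp_norm _).trans ?_
      rw [norm_smul, Real.norm_of_nonneg (hε n).le]
    have h3 : 1 ≤ Real.exp (ε n * ‖X‖) :=
      Real.one_le_exp (mul_nonneg (hε n).le (norm_nonneg _))
    have h4 : Real.exp (ε n * ‖X‖) ^ m ≤ Real.exp (t * ‖X‖) := by
      rw [← Real.exp_nat_mul, ← mul_assoc]
      exact Real.exp_le_exp.2 (mul_le_mul_of_nonneg_right hmle' (norm_nonneg _))
    rw [h1]
    refine (norm_pow_sub_pow_le h3 (hg n) h2 m).trans ?_
    calc (m : ℝ) * ‖g n - exp (ε n • X)‖ * Real.exp (ε n * ‖X‖) ^ m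
        ≤ (t / ε n) * ‖g n - exp (ε n • X)‖ * Real.exp (t * ‖X‖) := by
          have h5 : 0 ≤ t / ε n := div_nonneg ht (hε n).le
          gcongr
      _ = _ := by rw [div_eq_mul_inv]; ring
  have hz : Tendsto (fun n => g n ^ ⌊t / ε n⌋₊ - exp (((⌊t / ε n⌋₊ : ℝ) * ε n) • X)) atTop
      (𝓝 0) := by
    refine squeeze_zero_norm hbound ?_
    simpa using hdiff.const_mul (t * Real.exp (t * ‖X‖))
  simpa using hz.add hexp

namespace IsSimplyTransitive

variable [FiniteDimensional ℝ N] {L : Set (N →L[ℝ] N)}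

/-- Elements of L rotating u slightly towards u' accumulate only at 1, by freeness and compactness.
X is a limit of their normalised differences from 1, so it is tangent to L. -/
lemma exists_generator (hL : IsSimplyTransitive L) {u u' : N} (hu : ‖u‖ = 1) (hu' : ‖u'‖ = 1)
    (huu' : inner ℝ u u' = 0) :
    ∃ X : N →L[ℝ] N, (∀ t : ℝ, 0 ≤ t → exp (t • X) ∈ L) ∧ (∀ v, inner ℝ (X v) v = 0) ∧
      ∃ c : ℝ, 0 < c ∧ X u = c • u' := by
  have hu0 : u ≠ 0 := by intro h; simp [h] at hu
  have hnt : Nontrivial N := ⟨u, 0, hu0⟩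
  let θ : ℕ → ℝ := fun n => 1 / ((n : ℝ) + 1)
  have hθpos : ∀ n, 0 < θ n := fun n => by positivity
  have hθ1 : ∀ n, θ n ≤ 1 := fun n => by
    rw [div_le_one (by positivity)]; linarith [(Nat.cast_nonneg n : (0 : ℝ) ≤ n)]
  have hθ0 : Tendsto θ atTop (𝓝 0) := tendsto_one_div_add_atTop_nhds_zero_nat
  have hsin : ∀ n, 0 < Real.sin (θ n) := fun n =>
    Real.sin_pos_of_pos_of_lt_pi (hθpos n) (by linarith [hθ1 n, Real.pi_gt_three])
  have hnorm : ∀ a b : ℝ, a ^ 2 + b ^ 2 = 1 → ‖a • u + b • u'‖ = 1 := by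
    intro a b hab
    have : ‖a • u + b • u'‖ ^ 2 = 1 := by
      rw [norm_add_sq_real, norm_smul, norm_smul, inner_smul_left, inner_smul_right, huu', hu, hu']
      simp [hab]
    nlinarith [norm_nonneg (a • u + b • u')]
  have hex : ∀ n, ∃ g ∈ L, g u = Real.cos (θ n) • u + Real.sin (θ n) • u' := fun n =>
    hL.transitive _ _ (by rw [hu, hnorm _ _ (Real.cos_sq_add_sin_sq _)])
  choose g hgL hgu using hex
  obtain ⟨g0, hg0, φ, hφ, hgφ⟩ := hL.isCompact.tendsto_subseq hgL
  have hg01 : g0 = 1 := by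
    apply hL.free g0 hg0 u hu0
    have h1 : Tendsto (fun n => g (φ n) u) atTop (𝓝 (g0 u)) :=
      ((ContinuousLinearMap.apply ℝ N u).continuous.tendsto g0).comp hgφ
    have h2 : Tendsto (fun n => g (φ n) u) atTop (𝓝 (Real.cos 0 • u + Real.sin 0 • u')) := by
      have h3 := hθ0.comp hφ.tendsto_atTop
      simp only [hgu]
      exact (((Real.continuous_cos.tendsto 0).comp h3).smul_const u).add
        (((Real.continuous_sin.tendsto 0).comp h3).smul_const u')
    simpa using tendsto_nhds_unique h1 h2
  subst hg01
  have hne : ∀ n, 0 < ‖g n - 1‖ := by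
    intro n
    rw [norm_pos_iff, sub_ne_zero]
    intro h
    have h1 := hgu n
    rw [h] at h1
    have h2 : inner ℝ (u : N) u' = inner ℝ (Real.cos (θ n) • u + Real.sin (θ n) • u') u' := by
      rw [← h1]; rfl
    rw [inner_add_left, inner_smul_left, inner_smul_left, huu', real_inner_self_eq_norm_sq, hu'] at h2
    simp at h2
    exact (hsin n).ne' h2.symm
  have hsph : ∀ n, ‖g (φ n) - 1‖⁻¹ • (g (φ n) - 1) ∈ Metric.sphere (0 : N →L[ℝ] N) 1 := by
    intro n
    rw [mem_sphere_zero_iff_norm, norm_smul, norm_inv, norm_norm, inv_mul_cancel₀ (hne _).ne']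
  obtain ⟨X, hX, ψ, hψ, hXψ⟩ := (isCompact_sphere (0 : N →L[ℝ] N) 1).tendsto_subseq hsph
  have hgχ : Tendsto (fun n => g (φ (ψ n))) atTop (𝓝 1) := hgφ.comp hψ.tendsto_atTop
  have hε0 : Tendsto (fun n => ‖g (φ (ψ n)) - 1‖) atTop (𝓝 0) := by
    simpa using (hgχ.sub_const 1).norm
  have hexp : ∀ t : ℝ, 0 ≤ t → exp (t • X) ∈ L := fun t ht =>
    hL.isCompact.isClosed.mem_of_tendsto
      (tendsto_pow_floor_exp (fun n => hne (φ (ψ n))) hε0 (fun n => hL.norm_le_one (hgL _)) hXψ ht)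
      (Eventually.of_forall fun n => hL.pow_mem (hgL _) _)
  have hap : ∀ v, Tendsto (fun n => ‖g (φ (ψ n)) - 1‖⁻¹ • (g (φ (ψ n)) v - v)) atTop (𝓝 (X v)) :=
    fun v => ((ContinuousLinearMap.apply ℝ N v).continuous.tendsto X).comp hXψ
  have hskew : ∀ v, inner ℝ (X v) v = 0 := by
    intro v
    have h1 : Tendsto (fun n => inner ℝ (‖g (φ (ψ n)) - 1‖⁻¹ • (g (φ (ψ n)) v - v)) v) atTop
        (𝓝 (inner ℝ (X v) v)) := (hap v).inner tendsto_const_nhds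
    have h2 : Tendsto (fun n => inner ℝ (‖g (φ (ψ n)) - 1‖⁻¹ • (g (φ (ψ n)) v - v))
        (g (φ (ψ n)) v - v)) atTop (𝓝 (inner ℝ (X v) ((1 : N →L[ℝ] N) v - v))) :=
      (hap v).inner ((((ContinuousLinearMap.apply ℝ N v).continuous.tendsto 1).comp hgχ).sub_const v)
    -- Norm preservation gives ⟨gv - v, v⟩ = -½‖gv - v‖², which is of second order in g - 1 and
    -- disappears in the limit.
    have h3 : ∀ n, inner ℝ (‖g (φ (ψ n)) - 1‖⁻¹ • (g (φ (ψ n)) v - v)) v =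
        -(1 / 2) * inner ℝ (‖g (φ (ψ n)) - 1‖⁻¹ • (g (φ (ψ n)) v - v)) (g (φ (ψ n)) v - v) := by
      intro n
      have h4 := hL.norm_map _ (hgL (φ (ψ n))) v
      have h5 : inner ℝ (g (φ (ψ n)) v) (g (φ (ψ n)) v) = inner ℝ v v := by
        rw [real_inner_self_eq_norm_sq, real_inner_self_eq_norm_sq, h4]
      simp only [inner_smul_left, inner_sub_left, inner_sub_right, h5]
      rw [real_inner_comm v]
      simp; ring
    simp only [h3] at h1
    have h6 := tendsto_nhds_unique h1 (h2.const_mul (-(1 / 2)))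
    simpa using h6
  refine ⟨X, hexp, hskew, ?_⟩
  have hX0 : X ≠ 0 := by
    intro h; simp [h] at hX
  have hperp : ∀ w, inner ℝ u w = 0 → inner ℝ u' w = 0 → inner ℝ (X u) w = 0 := by
    intro w hw hw'
    have h1 : Tendsto (fun n => inner ℝ (‖g (φ (ψ n)) - 1‖⁻¹ • (g (φ (ψ n)) u - u)) w) atTop
        (𝓝 (inner ℝ (X u) w)) := (hap u).inner tendsto_const_nhds
    refine tendsto_nhds_unique h1 (tendsto_const_nhds.congr fun n => ?_)
    simp [hgu, inner_smul_left, inner_sub_left, inner_add_left, hw, hw']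
  have hnn : 0 ≤ inner ℝ (X u) u' := by
    have h1 : Tendsto (fun n => inner ℝ (‖g (φ (ψ n)) - 1‖⁻¹ • (g (φ (ψ n)) u - u)) u') atTop
        (𝓝 (inner ℝ (X u) u')) := (hap u).inner tendsto_const_nhds
    refine ge_of_tendsto h1 (Eventually.of_forall fun n => ?_)
    simp [hgu, inner_smul_left, inner_sub_left, inner_add_left, huu', hu']
    exact mul_nonneg (inv_nonneg.2 (norm_nonneg _)) (hsin _).le
  have hXu : X u = (inner ℝ (X u) u') • u' := by
    have h1 : inner ℝ (X u) (X u - (inner ℝ (X u) u') • u') = 0 := by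
      apply hperp
      · rw [inner_sub_right, inner_smul_right, huu', real_inner_comm, hskew]; simp
      · rw [inner_sub_right, inner_smul_right, real_inner_self_eq_norm_sq, hu', real_inner_comm]
        simp
    have h2 : inner ℝ (X u - (inner ℝ (X u) u') • u') (X u - (inner ℝ (X u) u') • u') = 0 := by
      rw [inner_sub_left, h1, inner_smul_left, inner_sub_right, inner_smul_right,
        real_inner_self_eq_norm_sq u', hu', real_inner_comm u']
      simp
    exact sub_eq_zero.1 (inner_self_eq_zero.1 h2)
  -- If c were 0, `exp (t • X)` would fix u, hence be 1 by freeness, and X would vanish although ‖X‖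
  -- = 1. The derivative is taken one-sided because membership in L is known only for t ≥ 0.
  refine ⟨_, lt_of_le_of_ne hnn fun h => hX0 ?_, hXu⟩
  rw [← h, zero_smul] at hXu
  have h1 : ∀ t : ℝ, 0 ≤ t → exp (t • X) = 1 := by
    intro t ht
    apply hL.free _ (hexp t ht) u hu0
    have h2 : ∀ r : ℝ, HasDerivAt (fun r : ℝ => exp (r • X) u) 0 r := by
      intro r
      have h3 := (hasDerivAt_exp_smul_const X r).clm_apply (hasDerivAt_const r u)
      simpa [hXu] using h3
    have h4 := is_const_of_deriv_eq_zero (fun r => (h2 r).differentiableAt)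
      (fun r => (h2 r).deriv) t 0
    simpa using h4
  have h5 : HasDerivWithinAt (fun r : ℝ => exp (r • X)) X (Set.Ici 0) 0 := by
    simpa using (hasDerivAt_exp_smul_const X (0 : ℝ)).hasDerivWithinAt
  have h6 : HasDerivWithinAt (fun r : ℝ => exp (r • X)) 0 (Set.Ici 0) 0 :=
    (hasDerivWithinAt_const (0 : ℝ) (Set.Ici 0) (1 : N →L[ℝ] N)).congr (fun r hr => h1 r hr)
      (h1 0 le_rfl)
  exact (uniqueDiffOn_Ici (0 : ℝ) 0 (by simp)).eq_deriv _ h5 h6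

end IsSimplyTransitive

end FreeTransitive

/-! ### The cone over a simply transitive group is a linear subspace. -/

section Clifford

open Filter Topology NormedSpace

variable {N : Type*} [NormedAddCommGroup N] [InnerProductSpace ℝ N] [FiniteDimensional ℝ N]

/-- The right-hand side solves f' = X f, so `exp (-t • X) (f t)` is constant. -/
lemma exp_smul_apply_of_sq {X : N →L[ℝ] N} {v : N} {μ : ℝ} (hμ : μ ≠ 0)
    (hv : X (X v) = -(μ ^ 2) • v) (t : ℝ) :
    exp (t • X) v = Real.cos (μ * t) • v + (Real.sin (μ * t) / μ) • X v := by
  let _ : NormedAlgebra ℚ (N →L[ℝ] N) := NormedAlgebra.restrictScalars ℚ ℝ _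
  let f : ℝ → N := fun t => Real.cos (μ * t) • v + (Real.sin (μ * t) / μ) • X v
  have hf : ∀ t, HasDerivAt f (X (f t)) t := by
    intro t
    have h1 : HasDerivAt (fun t : ℝ => μ * t) μ t := by
      simpa using (hasDerivAt_id t).const_mul μ
    have h2 := ((h1.cos.smul_const v).add ((h1.sin.div_const μ).smul_const (X v)))
    refine h2.congr_deriv ?_
    simp only [f, map_add, map_smul, hv, smul_smul]
    rw [add_comm, mul_div_cancel_right₀ _ hμ]
    congr 2
    field_simp
  have h1 : ∀ r : ℝ, HasDerivAt (fun r : ℝ => exp ((-r) • X) (f r)) 0 r := by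
    intro r
    have h2 : HasDerivAt (fun r : ℝ => exp ((-r) • X)) (-(exp ((-r) • X) * X)) r := by
      have := (hasDerivAt_exp_smul_const X (-r)).scomp r (hasDerivAt_neg r)
      simpa [Function.comp_def] using this
    have h3 := h2.clm_apply (hf r)
    simpa using h3
  have h4 := is_const_of_deriv_eq_zero (fun r => (h1 r).differentiableAt)
    (fun r => (h1 r).deriv) t 0
  simp only [f, neg_zero, zero_smul, exp_zero, mul_zero, Real.cos_zero, Real.sin_zero, one_smul,
    zero_div, add_zero] at h4
  change exp ((-t) • X) (f t) = v at h4
  have h5 : exp (t • X) * exp ((-t) • X) = 1 := by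
    rw [← exp_add_of_commute (((Commute.refl X).smul_left t).smul_right (-t)), ← add_smul]
    simp
  calc exp (t • X) v = (exp (t • X) * exp ((-t) • X)) (f t) := by rw [← h4]; rfl
    _ = f t := by rw [h5]; rfl

namespace IsSimplyTransitive

variable {L : Set (N →L[ℝ] N)}

/-- X² is symmetric, with eigenvalues -μᵢ². Freeness excludes μᵢ = 0 and forces all the rotation
speeds μᵢ to agree, since `exp (t • X)` returns to 1 as soon as it fixes one vector. -/
lemma sq_eq_neg (hL : IsSimplyTransitive L) {X : N →L[ℝ] N}
    (hexp : ∀ t : ℝ, 0 ≤ t → exp (t • X) ∈ L) (hskew : ∀ v, inner ℝ (X v) v = 0) (hX : X ≠ 0) :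
    ∃ μ : ℝ, 0 < μ ∧ ∀ v, X (X v) = -(μ ^ 2) • v := by
  have hskew2 : ∀ v w, inner ℝ (X v) w = -inner ℝ v (X w) := by
    intro v w
    have h := hskew (v + w)
    rw [map_add, inner_add_left, inner_add_right, inner_add_right, hskew, hskew,
      real_inner_comm v (X w)] at h
    linarith
  let T : N →ₗ[ℝ] N := (X * X : N →L[ℝ] N)
  have hT : T.IsSymmetric := by
    intro v w
    change inner ℝ (X (X v)) w = inner ℝ v (X (X w))
    rw [hskew2, hskew2, neg_neg]
  let b := hT.eigenvectorBasis rfl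
  let μ : Fin (Module.finrank ℝ N) → ℝ := fun i => ‖X (b i)‖
  have hb : ∀ i, X (X (b i)) = -(μ i ^ 2) • b i := by
    intro i
    have h1 : X (X (b i)) = (hT.eigenvalues rfl i : ℝ) • b i := hT.apply_eigenvectorBasis rfl i
    have h2 : inner ℝ (X (X (b i))) (b i) = -(μ i ^ 2) := by
      rw [hskew2, real_inner_self_eq_norm_sq]
    have h3 : inner ℝ (b i) (b i) = (1 : ℝ) := by
      rw [real_inner_self_eq_norm_sq, b.norm_eq_one]; norm_num
    rw [h1, inner_smul_left, h3] at h2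
    rw [h1]; congr 1; simpa using h2
  have hb0 : ∀ i, b i ≠ 0 := fun i h => by
    have := b.norm_eq_one i
    rw [h, norm_zero] at this; norm_num at this
  have hμ : ∀ i, 0 < μ i := by
    intro i
    rw [norm_pos_iff]
    intro h
    apply hX
    have h1 : ∀ t : ℝ, 0 ≤ t → exp (t • X) = 1 := by
      intro t ht
      apply hL.free _ (hexp t ht) _ (hb0 i)
      have h2 : ∀ r : ℝ, HasDerivAt (fun r : ℝ => exp (r • X) (b i)) 0 r := by
        intro r
        have h3 := (hasDerivAt_exp_smul_const X r).clm_apply (hasDerivAt_const r (b i))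
        simpa [h] using h3
      have h4 := is_const_of_deriv_eq_zero (fun r => (h2 r).differentiableAt)
        (fun r => (h2 r).deriv) t 0
      simpa using h4
    have h5 : HasDerivWithinAt (fun r : ℝ => exp (r • X)) X (Set.Ici 0) 0 := by
      simpa using (hasDerivAt_exp_smul_const X (0 : ℝ)).hasDerivWithinAt
    have h6 : HasDerivWithinAt (fun r : ℝ => exp (r • X)) 0 (Set.Ici 0) 0 :=
      (hasDerivWithinAt_const (0 : ℝ) (Set.Ici 0) (1 : N →L[ℝ] N)).congr (fun r hr => h1 r hr)
        (h1 0 le_rfl)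
    exact (uniqueDiffOn_Ici (0 : ℝ) 0 (by simp)).eq_deriv _ h5 h6
  -- At time 2π/μⱼ the exponential fixes `b j`, so it is 1; read on `b i`, this says cos(2π μᵢ/μⱼ) =
  -- 1.
  have hint : ∀ i j, ∃ n : ℤ, (n : ℝ) * μ j = μ i := by
    intro i j
    have h1 : exp ((2 * Real.pi / μ j) • X) = 1 := by
      apply hL.free _ (hexp _ (div_nonneg Real.two_pi_pos.le (hμ j).le)) _ (hb0 j)
      rw [exp_smul_apply_of_sq (hμ j).ne' (hb j), mul_div_cancel₀ _ (hμ j).ne']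
      simp
    have h2 := exp_smul_apply_of_sq (hμ i).ne' (hb i) (2 * Real.pi / μ j)
    rw [h1] at h2
    have h3 : inner ℝ ((1 : N →L[ℝ] N) (b i)) (b i) = (1 : ℝ) := by
      change inner ℝ (b i) (b i) = (1 : ℝ)
      rw [real_inner_self_eq_norm_sq, b.norm_eq_one]; norm_num
    rw [h2, inner_add_left, inner_smul_left, inner_smul_left, hskew, real_inner_self_eq_norm_sq,
      b.norm_eq_one] at h3
    simp only [conj_trivial, one_pow, mul_one, mul_zero, add_zero] at h3
    obtain ⟨n, hn⟩ := (Real.cos_eq_one_iff _).1 h3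
    refine ⟨n, ?_⟩
    have := hμ j
    field_simp at hn
    nlinarith [Real.pi_pos]
  have heq : ∀ i j, μ i = μ j := by
    have hle : ∀ i j, μ j ≤ μ i := by
      intro i j
      obtain ⟨n, hn⟩ := hint i j
      have h1 : (0 : ℝ) < n := pos_of_mul_pos_left (hn ▸ hμ i) (hμ j).le
      have h2 : (1 : ℝ) ≤ n := by exact_mod_cast (by exact_mod_cast h1 : (0 : ℤ) < n)
      nlinarith [hμ j]
    exact fun i j => le_antisymm (hle j i) (hle i j)
  have hne : Nonempty (Fin (Module.finrank ℝ N)) := by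
    by_contra h
    rw [not_nonempty_iff] at h
    apply hX
    ext v
    have : v = 0 := by rw [← b.sum_repr v]; simp
    simp [this]
  obtain ⟨i0⟩ := hne
  refine ⟨μ i0, hμ i0, fun v => ?_⟩
  have h : T = (-(μ i0 ^ 2)) • LinearMap.id := by
    apply b.toBasis.ext
    intro i
    rw [b.coe_toBasis]
    change X (X (b i)) = _
    rw [hb i, heq i i0]; rfl
  exact LinearMap.congr_fun h v

/-- The one-parameter group that starts from u towards `h u` is cos t + (sin t) J with J² = -1. At t
= π/2 it gives J ∈ L, and J agrees with h on u, so J = h by freeness. -/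
lemma add_smul_mem (hL : IsSimplyTransitive L) {h : N →L[ℝ] N} (hh : h ∈ L) {u : N} (hu : ‖u‖ = 1)
    (hhu : inner ℝ u (h u) = 0) {a b : ℝ} (hab : a ^ 2 + b ^ 2 = 1) :
    a • (1 : N →L[ℝ] N) + b • h ∈ L := by
  have hhu1 : ‖h u‖ = 1 := by rw [hL.norm_map h hh, hu]
  have hu0 : u ≠ 0 := by intro h; simp [h] at hu
  obtain ⟨X, hexp, hskew, c, hc, hXu⟩ := hL.exists_generator hu hhu1 hhu
  have hX : X ≠ 0 := by
    intro h0
    rw [h0] at hXu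
    have := congrArg norm hXu
    rw [norm_smul, hhu1] at this
    simp at this
    exact hc.ne' (abs_eq_zero.1 this.symm)
  obtain ⟨μ, hμ, hsq⟩ := hL.sq_eq_neg hexp hskew hX
  have hform : ∀ t : ℝ, 0 ≤ t → Real.cos t • (1 : N →L[ℝ] N) + Real.sin t • (μ⁻¹ • X) ∈ L := by
    intro t ht
    have h1 := hexp (t / μ) (div_nonneg ht hμ.le)
    convert h1 using 1
    ext v
    rw [exp_smul_apply_of_sq hμ.ne' (hsq v), mul_div_cancel₀ _ hμ.ne']
    simp [div_eq_mul_inv, smul_smul]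
  have hXL : μ⁻¹ • X ∈ L := by
    have := hform (Real.pi / 2) (by positivity)
    simpa using this
  have hXh : μ⁻¹ • X = h := by
    apply hL.ext hXL hh hu0
    have h1 : (μ⁻¹ • X) u = (μ⁻¹ * c) • h u := by
      rw [smul_apply, hXu, smul_smul]
    have h2 := hL.norm_map _ hXL u
    rw [h1, norm_smul, hhu1, hu, mul_one, Real.norm_of_nonneg (by positivity)] at h2
    rw [h1, h2, one_smul]
  rw [hXh] at hform
  obtain ⟨t, ht, hta, htb⟩ : ∃ t : ℝ, 0 ≤ t ∧ Real.cos t = a ∧ Real.sin t = b := by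
    let z : ℂ := ⟨a, b⟩
    have hz : ‖z‖ = 1 := by
      rw [Complex.norm_def, Complex.normSq_mk, ← sq, ← sq, hab, Real.sqrt_one]
    have hz0 : z ≠ 0 := by intro h; simp [h] at hz
    -- The shift by 2π makes the angle nonnegative, as `hform` requires.
    refine ⟨Complex.arg z + 2 * Real.pi, by linarith [Complex.neg_pi_lt_arg z, Real.pi_pos], ?_, ?_⟩
    · rw [Real.cos_add_two_pi, Complex.cos_arg hz0, hz, div_one]
    · rw [Real.sin_add_two_pi, Complex.sin_arg, hz, div_one]
  rw [← hta, ← htb]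
  exact hform t ht

/-- An element h with h v = -v is an involution by freeness. It fixes every w + h w, so these all
vanish and h = -1. -/
lemma neg_mem [Nontrivial N] (hL : IsSimplyTransitive L) {g : N →L[ℝ] N} (hg : g ∈ L) :
    -g ∈ L := by
  obtain ⟨v, hv⟩ := exists_ne (0 : N)
  obtain ⟨h, hh, hhv⟩ := hL.transitive v (-v) (by rw [norm_neg])
  have h1 : h * h = 1 := hL.free _ (hL.mul_mem h hh h hh) v hv (by
    change h (h v) = v
    rw [hhv, map_neg, hhv, neg_neg])
  have h2 : h = -1 := by
    ext w
    by_contra hw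
    have h3 : w + h w ≠ 0 := fun h4 => hw (by
      rw [neg_apply]; exact (neg_eq_of_add_eq_zero_right h4).symm)
    have h5 : h = 1 := hL.free h hh _ h3 (by
      have h6 : h (h w) = w := by
        change (h * h) w = w
        rw [h1]; rfl
      rw [map_add, h6, add_comm])
    rw [h5] at hhv
    have h7 : (2 : ℝ) • v = 0 := by
      rw [two_smul]; nth_rewrite 1 [show v = -v from hhv]; simp
    exact hv ((smul_eq_zero.1 h7).resolve_left two_ne_zero)
  have := hL.mul_mem h hh g hg
  rwa [h2, neg_one_mul] at this

/-- The cone over `L`. -/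
def cone (L : Set (N →L[ℝ] N)) : Set (N →L[ℝ] N) := {A | ∃ (r : ℝ), ∃ g ∈ L, A = r • g}

/-- Write k u = p u + w with w orthogonal to u. If w = 0 then k = ±1. Otherwise the h in L carrying
u to w/‖w‖ gives k = p + ‖w‖ h, and the unit circle in the plane of 1 and h lies in L by
`add_smul_mem`. -/
lemma one_add_smul_mem_cone [Nontrivial N] (hL : IsSimplyTransitive L) {k : N →L[ℝ] N} (hk : k ∈ L)
    (a b : ℝ) : a • (1 : N →L[ℝ] N) + b • k ∈ cone L := by
  obtain ⟨u, hu⟩ := exists_norm_eq N zero_le_one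
  have hu0 : u ≠ 0 := by intro h; simp [h] at hu
  have hku := hL.norm_map k hk u
  let p : ℝ := inner ℝ u (k u)
  let w : N := k u - p • u
  have huw : inner ℝ u w = 0 := by
    simp only [w, inner_sub_right, inner_smul_right, real_inner_self_eq_norm_sq, hu, p]
    simp
  have hkw : k u = p • u + w := by simp [w]
  have hpw : p ^ 2 + ‖w‖ ^ 2 = 1 := by
    have h1 : ‖p • u + w‖ ^ 2 = 1 := by rw [← hkw, hku, hu]; norm_num
    rw [norm_add_sq_real, inner_smul_left, huw, norm_smul, hu] at h1
    simpa using h1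
  rcases eq_or_ne w 0 with hw | hw
  · rw [hw] at hpw hkw
    have hk' : k = 1 ∨ k = -1 := by
      have : p = 1 ∨ p = -1 := by
        exact mul_self_eq_one_iff.1 (by simpa [← sq] using hpw)
      rcases this with hp | hp
      · left; exact hL.ext hk hL.one_mem hu0 (by rw [hkw, hp]; simp)
      · right; exact hL.ext hk (hL.neg_mem hL.one_mem) hu0 (by rw [hkw, hp]; simp)
    rcases hk' with rfl | rfl
    · exact ⟨a + b, 1, hL.one_mem, by rw [add_smul]⟩
    · exact ⟨a - b, 1, hL.one_mem, by rw [sub_smul, smul_neg, sub_eq_add_neg]⟩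
  · have hw' : ‖w‖ ≠ 0 := norm_ne_zero_iff.2 hw
    obtain ⟨h, hh, hhu⟩ := hL.transitive u (‖w‖⁻¹ • w) (by
      rw [norm_smul, norm_inv, norm_norm, inv_mul_cancel₀ hw', hu])
    have hperp : inner ℝ u (h u) = 0 := by rw [hhu, inner_smul_right, huw, mul_zero]
    have hkh : p • (1 : N →L[ℝ] N) + ‖w‖ • h = k := by
      apply hL.ext (hL.add_smul_mem hh hu hperp hpw) hk hu0
      simp [hhu, smul_smul, hw', hkw]
    have hsum : a • (1 : N →L[ℝ] N) + b • k = (a + b * p) • 1 + (b * ‖w‖) • h := by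
      rw [← hkh]; module
    rw [hsum]
    set x := a + b * p
    set y := b * ‖w‖
    rcases eq_or_ne (x ^ 2 + y ^ 2) 0 with h0 | h0
    · have hx : x = 0 := by nlinarith [sq_nonneg x, sq_nonneg y]
      have hy : y = 0 := by nlinarith [sq_nonneg x, sq_nonneg y]
      exact ⟨0, 1, hL.one_mem, by rw [hx, hy]; simp⟩
    · have hr : 0 < Real.sqrt (x ^ 2 + y ^ 2) :=
        Real.sqrt_pos.2 (lt_of_le_of_ne (by positivity) h0.symm)
      set r := Real.sqrt (x ^ 2 + y ^ 2)
      have hr2 : r ^ 2 = x ^ 2 + y ^ 2 := Real.sq_sqrt (by positivity)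
      refine ⟨r, _, hL.add_smul_mem hh hu hperp (a := x / r) (b := y / r) ?_, ?_⟩
      · rw [div_pow, div_pow, ← add_div, hr2, div_self h0]
      · rw [smul_add, smul_smul, smul_smul, mul_div_cancel₀ _ hr.ne', mul_div_cancel₀ _ hr.ne']

/-- Left multiplication by an element of L preserves the cone, which reduces the claim to sums in
which one of the two group elements is 1. -/
lemma add_mem_cone [Nontrivial N] (hL : IsSimplyTransitive L) {A B : N →L[ℝ] N}
    (hA : A ∈ cone L) (hB : B ∈ cone L) : A + B ∈ cone L := by
  obtain ⟨a, g, hg, rfl⟩ := hA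
  obtain ⟨b, h, hh, rfl⟩ := hB
  obtain ⟨g', hg', h1, h2⟩ := hL.inv_mem g hg
  obtain ⟨r, k, hk, hr⟩ := hL.one_add_smul_mem_cone (hL.mul_mem g' hg' h hh) a b
  refine ⟨r, g * k, hL.mul_mem g hg k hk, ?_⟩
  have h3 : g * (a • (1 : N →L[ℝ] N) + b • (g' * h)) = g * (r • k) := by rw [hr]
  rw [mul_add, mul_smul_comm, mul_smul_comm, mul_smul_comm, mul_one, ← mul_assoc, h2, one_mul] at h3
  exact h3

/-- A group of isometries that is simply transitive on the unit sphere is the unit sphere of a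
linear subspace of the algebra of endomorphisms. -/
theorem exists_linear_extension [Nontrivial N] (hL : IsSimplyTransitive L) {v₀ : N}
    (hv₀ : v₀ ≠ 0) : ∃ T : N →ₗ[ℝ] (N →L[ℝ] N), ∀ g ∈ L, T (g v₀) = g := by
  let C : Submodule ℝ (N →L[ℝ] N) :=
    { carrier := cone L
      add_mem' := fun hA hB => hL.add_mem_cone hA hB
      zero_mem' := ⟨0, 1, hL.one_mem, by simp⟩
      smul_mem' := by
        rintro c _ ⟨a, g, hg, rfl⟩
        exact ⟨c * a, g, hg, by rw [smul_smul]⟩ }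
  -- T is the inverse of evaluation at v₀ on the cone. Evaluation is injective because a nonzero
  -- multiple of an isometry does not kill v₀, and surjective by transitivity.
  let ev : C →ₗ[ℝ] N := (ContinuousLinearMap.apply ℝ N v₀).toLinearMap.comp C.subtype
  have hinj : Function.Injective ev := by
    rw [injective_iff_map_eq_zero]
    rintro ⟨_, r, g, hg, rfl⟩ h
    have h1 : r • g v₀ = 0 := h
    have h2 : g v₀ ≠ 0 := by
      rw [← norm_ne_zero_iff, hL.norm_map g hg, norm_ne_zero_iff]; exact hv₀
    have h3 : r = 0 := (smul_eq_zero.1 h1).resolve_right h2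
    ext1
    simp [h3]
  have hsurj : Function.Surjective ev := by
    intro u
    have hv₀' : ‖v₀‖ ≠ 0 := norm_ne_zero_iff.2 hv₀
    rcases eq_or_ne u 0 with rfl | hu
    · exact ⟨0, map_zero _⟩
    have hu' : ‖u‖ ≠ 0 := norm_ne_zero_iff.2 hu
    obtain ⟨g, hg, hgu⟩ := hL.transitive v₀ ((‖v₀‖ / ‖u‖) • u) (by
      rw [norm_smul, norm_div, norm_norm, norm_norm, div_mul_cancel₀ _ hu'])
    refine ⟨⟨(‖u‖ / ‖v₀‖) • g, _, g, hg, rfl⟩, ?_⟩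
    change (‖u‖ / ‖v₀‖) • g v₀ = u
    rw [hgu, smul_smul]
    field_simp
    simp
  let e := LinearEquiv.ofBijective ev ⟨hinj, hsurj⟩
  refine ⟨C.subtype.comp e.symm.toLinearMap, fun g hg => ?_⟩
  have : e ⟨g, 1, g, hg, by simp⟩ = g v₀ := rfl
  change ((e.symm (g v₀) : C) : N →L[ℝ] N) = g
  rw [← this, e.symm_apply_apply]

end IsSimplyTransitive

end Clifford

/-! ### Smooth dependence for integral equations in spaces of continuous curves. -/

section SmoothFlow

open Filter Topology Set

universe u

/-- Invertible operators form an open set, so the derivative stays invertible near x₀ and the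
inverse is smooth at all points near `f x₀`, not only there. -/
lemma exists_smooth_local_inverse {X Y : Type*} [NormedAddCommGroup X] [NormedSpace ℝ X]
    [CompleteSpace X] [NormedAddCommGroup Y] [NormedSpace ℝ Y] {f : X → Y} {x₀ : X}
    (hf : ∀ᶠ x in 𝓝 x₀, ContDiffAt ℝ ∞ f x) (f' : X ≃L[ℝ] Y)
    (hf' : HasFDerivAt f (f' : X →L[ℝ] Y) x₀) :
    ∃ g : Y → X, g (f x₀) = x₀ ∧ (∀ᶠ y in 𝓝 (f x₀), ContDiffAt ℝ ∞ g y ∧ f (g y) = y) ∧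
      ∀ᶠ x in 𝓝 x₀, g (f x) = x := by
  have hn : (∞ : WithTop ℕ∞) ≠ 0 := by simp
  have h0 := hf.self_of_nhds
  let e := h0.toOpenPartialHomeomorph f hf' hn
  have hx₀ : x₀ ∈ e.source := h0.mem_toOpenPartialHomeomorph_source hf' hn
  have hy₀ : f x₀ ∈ e.target := h0.image_mem_toOpenPartialHomeomorph_target hf' hn
  have hsymm : e.symm (f x₀) = x₀ := e.left_inv hx₀
  refine ⟨e.symm, hsymm, ?_, ?_⟩
  · have hinv : ∀ᶠ x in 𝓝 x₀, ∃ L : X ≃L[ℝ] Y, HasFDerivAt f (L : X →L[ℝ] Y) x := by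
      have hc : ContinuousAt (fderiv ℝ f) x₀ := h0.continuousAt_fderiv hn
      have h1 : range ((↑) : (X ≃L[ℝ] Y) → X →L[ℝ] Y) ∈ 𝓝 (fderiv ℝ f x₀) := by
        rw [hf'.fderiv]; exact ContinuousLinearEquiv.nhds f'
      filter_upwards [hc.preimage_mem_nhds h1, hf] with x hx hx2
      obtain ⟨L, hL⟩ := hx
      exact ⟨L, by rw [hL]; exact (hx2.differentiableAt hn).hasFDerivAt⟩
    have hc : Tendsto e.symm (𝓝 (f x₀)) (𝓝 x₀) := by
      have := e.continuousAt_symm hy₀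
      rwa [ContinuousAt, hsymm] at this
    filter_upwards [hc.eventually hinv, hc.eventually hf, e.open_target.mem_nhds hy₀]
      with y ⟨L, hL⟩ hy2 hy3
    exact ⟨e.contDiffAt_symm hy3 hL hy2, e.right_inv hy3⟩
  · filter_upwards [e.open_source.mem_nhds hx₀] with x hx
    exact e.left_inv hx

section Nemytskii

variable {I : Type*} [TopologicalSpace I] [CompactSpace I]

/-- Pointwise application of a continuous bilinear map to continuous functions. -/
noncomputable def pointwiseBilin (I : Type*) [TopologicalSpace I] [CompactSpace I]
    {A Z W : Type*} [NormedAddCommGroup A] [NormedSpace ℝ A] [NormedAddCommGroup Z]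
    [NormedSpace ℝ Z] [NormedAddCommGroup W] [NormedSpace ℝ W] (B : A →L[ℝ] Z →L[ℝ] W) :
    C(I, A) →L[ℝ] C(I, Z) →L[ℝ] C(I, W) :=
  LinearMap.mkContinuous₂
    (LinearMap.mk₂ ℝ (fun α η => (⟨fun t => B (α t) (η t),
        (B.continuous.comp α.continuous).clm_apply η.continuous⟩ : C(I, W)))
      (fun α α' η => by ext t; simp) (fun r α η => by ext t; simp)
      (fun α η η' => by ext t; simp) (fun r α η => by ext t; simp)) ‖B‖ (by
    intro α η
    rw [ContinuousMap.norm_le _ (by positivity)]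
    intro t
    refine (B.le_opNorm₂ (α t) (η t)).trans ?_
    have := α.norm_coe_le_norm t
    have := η.norm_coe_le_norm t
    change ‖B‖ * ‖α t‖ * ‖η t‖ ≤ _
    gcongr)

lemma exists_forall_dist_comp_lt {Z A : Type*} [PseudoMetricSpace Z] [PseudoMetricSpace A]
    (f : C(Z, A)) (y : C(I, Z)) {c : ℝ} (hc : 0 < c) :
    ∃ δ > 0, ∀ y' : C(I, Z), dist y' y < δ → ∀ t, dist (f (y' t)) (f (y t)) < c := by
  obtain ⟨δ, hδ, h⟩ := Metric.continuousAt_iff.1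
    ((ContinuousMap.continuous_postcomp (X := I) f).continuousAt (x := y)) c hc
  exact ⟨δ, hδ, fun y' hy' t => (ContinuousMap.dist_apply_le_dist t).trans_lt (h hy')⟩

/-- V' is uniformly close to its values along the compact image of y, so the mean value inequality
on the segments from `y t` to `y t + η t` gives a remainder that is o(‖η‖) uniformly in t. -/
lemma hasFDerivAt_postcomp {A Z W : Type*} [NormedAddCommGroup A] [NormedSpace ℝ A]
    [NormedAddCommGroup Z] [NormedSpace ℝ Z] [NormedAddCommGroup W] [NormedSpace ℝ W]
    (B : A →L[ℝ] Z →L[ℝ] W) {V : Z → W} {V' : Z → A} (hV : ∀ z, HasFDerivAt V (B (V' z)) z)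
    (hVc : Continuous V) (hV' : Continuous V') (y : C(I, Z)) :
    HasFDerivAt (fun y : C(I, Z) => (⟨V, hVc⟩ : C(Z, W)).comp y)
      (pointwiseBilin I B ((⟨V', hV'⟩ : C(Z, A)).comp y)) y := by
  rw [hasFDerivAt_iff_isLittleO_nhds_zero, Asymptotics.isLittleO_iff]
  intro c hc
  have hB : 0 < ‖B‖ + 1 := by positivity
  obtain ⟨δ, hδ, h2⟩ := exists_forall_dist_comp_lt (⟨V', hV'⟩ : C(Z, A)) y (div_pos hc hB)
  filter_upwards [Metric.ball_mem_nhds (0 : C(I, Z)) hδ] with η hη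
  rw [mem_ball_zero_iff] at hη
  rw [ContinuousMap.norm_le _ (by positivity)]
  intro t
  change ‖V (y t + η t) - V (y t) - B (V' (y t)) (η t)‖ ≤ c * ‖η‖
  have h3 : ∀ z ∈ segment ℝ (y t) (y t + η t), ‖B (V' z) - B (V' (y t))‖ ≤ c := by
    intro z hz
    rw [segment_eq_image'] at hz
    obtain ⟨r, hr, rfl⟩ := hz
    have h4 : dist (y + r • η) y < δ := by
      rw [dist_eq_norm, add_sub_cancel_left, norm_smul, Real.norm_of_nonneg hr.1]
      exact (mul_le_of_le_one_left (norm_nonneg _) hr.2).trans_lt hη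
    have h5 : ‖V' (y t + r • η t) - V' (y t)‖ ≤ c / (‖B‖ + 1) := by
      rw [← dist_eq_norm]; exact (h2 _ h4 t).le
    rw [add_sub_cancel_left, ← map_sub]
    refine (B.le_opNorm _).trans ((mul_le_mul (le_add_of_nonneg_right zero_le_one) h5
      (norm_nonneg _) hB.le).trans_eq ?_)
    field_simp
  have h6 := (convex_segment (𝕜 := ℝ) (y t) (y t + η t)).norm_image_sub_le_of_norm_hasFDerivWithin_le'
    (f := V) (f' := fun z => B (V' z)) (fun z _ => (hV z).hasFDerivWithinAt) h3
    (left_mem_segment ℝ _ _) (right_mem_segment ℝ _ _)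
  rw [add_sub_cancel_left] at h6
  exact h6.trans (mul_le_mul_of_nonneg_left (η.norm_coe_le_norm t) hc.le)

lemma contDiff_postcomp_succ {A Z W : Type*} [NormedAddCommGroup A] [NormedSpace ℝ A]
    [NormedAddCommGroup Z] [NormedSpace ℝ Z] [NormedAddCommGroup W] [NormedSpace ℝ W]
    (B : A →L[ℝ] Z →L[ℝ] W) {V : Z → W} {V' : Z → A} (hV : ∀ z, HasFDerivAt V (B (V' z)) z)
    (hVc : Continuous V) (hV' : Continuous V') {n : ℕ}
    (hn : ContDiff ℝ n (fun y : C(I, Z) => (⟨V', hV'⟩ : C(Z, A)).comp y)) :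
    ContDiff ℝ (n + 1) (fun y : C(I, Z) => (⟨V, hVc⟩ : C(Z, W)).comp y) := by
  rw [contDiff_succ_iff_hasFDerivAt]
  exact ⟨_, (pointwiseBilin I B).contDiff.comp hn, hasFDerivAt_postcomp B hV hVc hV'⟩

/-- The derivative of postcomposition with V is postcomposition with `fderiv ℝ V`, followed by a
fixed bilinear map. The induction changes the target to `Z →L[ℝ] W`, hence the quantification over W
and the common universe. -/
lemma contDiff_postcomp_nat {Z : Type u} [NormedAddCommGroup Z] [NormedSpace ℝ Z] (n : ℕ) :
    ∀ {W : Type u} [NormedAddCommGroup W] [NormedSpace ℝ W] {V : Z → W} (hV : ContDiff ℝ ∞ V),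
    ContDiff ℝ n (fun y : C(I, Z) => (⟨V, hV.continuous⟩ : C(Z, W)).comp y) := by
  induction n with
  | zero =>
    intro W _ _ V hV
    rw [Nat.cast_zero, contDiff_zero]
    exact ContinuousMap.continuous_postcomp _
  | succ n ih =>
    intro W _ _ V hV
    have hV' : ContDiff ℝ ∞ (fderiv ℝ V) := (contDiff_infty_iff_fderiv.1 hV).2
    push_cast
    exact contDiff_postcomp_succ (ContinuousLinearMap.id ℝ (Z →L[ℝ] W))
      (fun z => (hV.differentiable (by simp) z).hasFDerivAt) hV.continuous hV'.continuous (ih hV')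

lemma contDiff_postcomp {Z W : Type u} [NormedAddCommGroup Z] [NormedSpace ℝ Z]
    [NormedAddCommGroup W] [NormedSpace ℝ W] {V : Z → W} (hV : ContDiff ℝ ∞ V) :
    ContDiff ℝ ∞ (fun y : C(I, Z) => (⟨V, hV.continuous⟩ : C(Z, W)).comp y) :=
  contDiff_infty.2 fun n => contDiff_postcomp_nat n hV

end Nemytskii

section Primitive

variable {Z : Type*} [NormedAddCommGroup Z]

lemma continuous_comp_projIcc (y : C(unitInterval, Z)) :
    Continuous fun r : ℝ => y (projIcc 0 1 zero_le_one r) :=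
  y.continuous.comp continuous_projIcc

/-- The primitive, vanishing at `0`, of a continuous function on the unit interval. -/
noncomputable def primitiveCLM (Z : Type*) [NormedAddCommGroup Z] [NormedSpace ℝ Z] :
    C(unitInterval, Z) →L[ℝ] C(unitInterval, Z) :=
  LinearMap.mkContinuous
    { toFun := fun y => ⟨fun t => ∫ r in (0 : ℝ)..t, y (projIcc 0 1 zero_le_one r),
        (intervalIntegral.continuous_primitive
          (fun a b => (continuous_comp_projIcc y).intervalIntegrable a b) 0).comp
          continuous_subtype_val⟩
      map_add' := fun y y' => by
        ext t
        exact intervalIntegral.integral_add ((continuous_comp_projIcc y).intervalIntegrable _ _)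
          ((continuous_comp_projIcc y').intervalIntegrable _ _)
      map_smul' := fun c y => by
        ext t
        exact intervalIntegral.integral_smul c _ } 1 (by
    intro y
    rw [one_mul, ContinuousMap.norm_le _ (norm_nonneg _)]
    intro t
    change ‖∫ r in (0 : ℝ)..t, y (projIcc 0 1 zero_le_one r)‖ ≤ _
    refine (intervalIntegral.norm_integral_le_of_norm_le_const
      (fun r _ => y.norm_coe_le_norm _)).trans ?_
    rw [sub_zero, abs_of_nonneg t.2.1]
    exact mul_le_of_le_one_right (norm_nonneg _) t.2.2)

end Primitive

/-- Smooth dependence of solutions of `z' = ε V(z)` on `ε` and the initial value, near `ε = 0`. -/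
lemma exists_smooth_integral_solution {Z : Type u} [NormedAddCommGroup Z] [NormedSpace ℝ Z]
    [CompleteSpace Z] {V : Z → Z} (hV : ContDiff ℝ ∞ V) (z₀ : Z) :
    ∃ S : ℝ × Z → C(unitInterval, Z), S (0, z₀) = ContinuousMap.const _ z₀ ∧
      ∀ᶠ q in 𝓝 ((0 : ℝ), z₀), ContDiffAt ℝ ∞ S q ∧
        ∀ t : unitInterval, S q t =
          q.2 + q.1 • ∫ r in (0 : ℝ)..t, V (S q (projIcc 0 1 zero_le_one r)) := by
  let cst : Z →L[ℝ] C(unitInterval, Z) := ContinuousLinearMap.const ℝ unitInterval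
  let Nem : C(unitInterval, Z) → C(unitInterval, Z) :=
    fun y => (⟨V, hV.continuous⟩ : C(Z, Z)).comp y
  have hNem : ContDiff ℝ ∞ Nem := contDiff_postcomp hV
  let J := primitiveCLM Z
  let F : (ℝ × Z) × C(unitInterval, Z) → (ℝ × Z) × C(unitInterval, Z) :=
    fun q => (q.1, q.2 - cst q.1.2 - q.1.1 • J (Nem q.2))
  have hF : ContDiff ℝ ∞ F := by
    refine contDiff_fst.prodMk ((contDiff_snd.sub (cst.contDiff.comp contDiff_fst.snd)).sub ?_)
    exact contDiff_fst.fst.smul (J.contDiff.comp (hNem.comp contDiff_snd))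
  let y₀ : C(unitInterval, Z) := cst z₀
  let q₀ : (ℝ × Z) × C(unitInterval, Z) := ((0, z₀), y₀)
  let B : (ℝ × Z) →L[ℝ] C(unitInterval, Z) :=
    cst.comp (ContinuousLinearMap.snd ℝ ℝ Z) +
      (ContinuousLinearMap.fst ℝ ℝ Z).smulRight (J (Nem y₀))
  -- At ε = 0 the integral term does not vary with the curve, so the derivative of F is unipotent
  -- and has an explicit inverse.
  let e : ((ℝ × Z) × C(unitInterval, Z)) ≃L[ℝ] ((ℝ × Z) × C(unitInterval, Z)) :=
    ContinuousLinearEquiv.equivOfInverse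
      ((ContinuousLinearMap.fst ℝ _ _).prod
        (ContinuousLinearMap.snd ℝ _ _ - B.comp (ContinuousLinearMap.fst ℝ _ _)))
      ((ContinuousLinearMap.fst ℝ _ _).prod
        (ContinuousLinearMap.snd ℝ _ _ + B.comp (ContinuousLinearMap.fst ℝ _ _)))
      (fun q => by simp) (fun q => by simp)
  have he : HasFDerivAt F (e : _ →L[ℝ] _) q₀ := by
    have h1 : HasFDerivAt (fun q : (ℝ × Z) × C(unitInterval, Z) => J (Nem q.2))
        (J.comp ((fderiv ℝ Nem y₀).comp (ContinuousLinearMap.snd ℝ _ _))) q₀ :=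
      J.hasFDerivAt.comp q₀ (HasFDerivAt.comp (g := Nem) (f := Prod.snd) q₀
        (hNem.differentiable (by simp) y₀).hasFDerivAt hasFDerivAt_snd)
    have h2 : HasFDerivAt (fun q : (ℝ × Z) × C(unitInterval, Z) => q.1.1)
        ((ContinuousLinearMap.fst ℝ ℝ Z).comp (ContinuousLinearMap.fst ℝ _ _)) q₀ :=
      hasFDerivAt_fst.comp q₀ hasFDerivAt_fst
    have h3 : HasFDerivAt (fun q : (ℝ × Z) × C(unitInterval, Z) => cst q.1.2)
        (cst.comp ((ContinuousLinearMap.snd ℝ ℝ Z).comp (ContinuousLinearMap.fst ℝ _ _))) q₀ :=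
      cst.hasFDerivAt.comp q₀ (hasFDerivAt_snd.comp q₀ hasFDerivAt_fst)
    have h4 := hasFDerivAt_fst.prodMk ((hasFDerivAt_snd.sub h3).sub (h2.smul h1))
    refine h4.congr_fderiv ?_
    refine ContinuousLinearMap.ext fun q => ?_
    refine Prod.ext rfl ?_
    simp [e, B, q₀, sub_sub]
  obtain ⟨g, hg0, hg, -⟩ := exists_smooth_local_inverse
    (Eventually.of_forall fun q => hF.contDiffAt) e he
  have hFq₀ : F q₀ = ((0, z₀), 0) := by simp [F, q₀, y₀]
  rw [hFq₀] at hg0 hg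
  have hin : ContDiff ℝ ∞ (fun q : ℝ × Z => ((q, 0) : (ℝ × Z) × C(unitInterval, Z))) :=
    contDiff_id.prodMk contDiff_const
  refine ⟨fun q => (g (q, 0)).2, congrArg Prod.snd hg0, ?_⟩
  have hc : Tendsto (fun q : ℝ × Z => ((q, 0) : (ℝ × Z) × C(unitInterval, Z))) (𝓝 (0, z₀))
      (𝓝 ((0, z₀), 0)) := hin.continuous.tendsto _
  filter_upwards [hc.eventually hg] with q ⟨hq1, hq2⟩
  refine ⟨(hq1.comp q hin.contDiffAt).snd, fun t => ?_⟩
  have h5 : (g (q, 0)).1 = q := congrArg Prod.fst hq2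
  have h6 : (g (q, 0)).2 - cst (g (q, 0)).1.2 - (g (q, 0)).1.1 • J (Nem (g (q, 0)).2) = 0 :=
    congrArg Prod.snd hq2
  rw [h5, sub_sub, sub_eq_zero] at h6
  exact congrArg (fun y : C(unitInterval, Z) => y t) h6

end SmoothFlow

/-! ### The local flow of a smooth vector field. -/

section LocalFlow

open Filter Topology Set

universe u

/-- A smooth function on an open set agrees near each point with a globally smooth one. -/
lemma exists_contDiff_eventuallyEq {Z W : Type*} [NormedAddCommGroup Z] [NormedSpace ℝ Z]
    [FiniteDimensional ℝ Z] [NormedAddCommGroup W] [NormedSpace ℝ W] {V : Z → W} {O : Set Z}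
    (hO : IsOpen O) {z₀ : Z} (hz₀ : z₀ ∈ O) (hV : ContDiffOn ℝ ∞ V O) :
    ∃ V' : Z → W, ContDiff ℝ ∞ V' ∧ V' =ᶠ[𝓝 z₀] V := by
  obtain ⟨r, hr, hrO⟩ := Metric.isOpen_iff.1 hO z₀ hz₀
  let f : ContDiffBump z₀ := ⟨r / 4, r / 2, by positivity, by linarith⟩
  refine ⟨fun z => f z • V z, ?_, ?_⟩
  · rw [contDiff_iff_contDiffAt]
    intro z
    by_cases hz : z ∈ O
    · exact f.contDiffAt.smul (hV.contDiffAt (hO.mem_nhds hz))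
    · have h1 : z ∉ Metric.closedBall z₀ (r / 2) := fun h =>
        hz (hrO (Metric.closedBall_subset_ball (by linarith) h))
      have h2 : (fun z => f z • V z) =ᶠ[𝓝 z] fun _ => 0 := by
        filter_upwards [Metric.isClosed_closedBall.isOpen_compl.mem_nhds h1] with w hw
        have h3 : f w = 0 := f.zero_of_le_dist (le_of_lt (by
          simpa [Metric.mem_closedBall] using hw))
        rw [h3, zero_smul]
      exact contDiffAt_const.congr_of_eventuallyEq h2
  · filter_upwards [f.eventuallyEq_one] with z hz
    rw [hz]; simp

/-- Local existence, uniqueness and smooth dependence on the initial value for the flow of a smooth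
vector field. -/
theorem exists_smooth_flow {Z : Type u} [NormedAddCommGroup Z] [NormedSpace ℝ Z]
    [FiniteDimensional ℝ Z] {V : Z → Z} {O : Set Z} (hO : IsOpen O) {z₀ : Z} (hz₀ : z₀ ∈ O)
    (hV : ContDiffOn ℝ ∞ V O) :
    ∃ ε > 0, ∃ r > 0, ∃ Φ : Z → ℝ → Z, ∀ᶠ z in 𝓝 z₀,
      ContDiffAt ℝ ∞ (fun z => Φ z ε) z ∧ Φ z 0 = z ∧
      (∀ t ∈ Icc 0 ε, Φ z t ∈ Metric.ball z₀ r ∧ HasDerivAt (Φ z) (V (Φ z t)) t) ∧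
      ∀ ζ : ℝ → Z, ζ 0 = z → (∀ t ∈ Icc 0 ε, ζ t ∈ Metric.ball z₀ r ∧ HasDerivAt ζ (V (ζ t)) t) →
        ζ ε = Φ z ε := by
  have : CompleteSpace Z := FiniteDimensional.complete ℝ Z
  obtain ⟨V', hV', hVV'⟩ := exists_contDiff_eventuallyEq hO hz₀ hV
  obtain ⟨K, t, ht, hK⟩ := (hV'.contDiffAt (x := z₀)).of_le (by simp : (1 : ℕ∞ω) ≤ ∞)
    |>.exists_lipschitzOnWith
  obtain ⟨r, hr, hrB⟩ := Metric.mem_nhds_iff.1 (inter_mem ht hVV')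
  let B := Metric.ball z₀ r
  obtain ⟨S, hS0, hS⟩ := exists_smooth_integral_solution hV' z₀
  have hSc : ContinuousAt S (0, z₀) := (hS.self_of_nhds).1.continuousAt
  have hSB : ∀ᶠ q in 𝓝 ((0 : ℝ), z₀), ∀ t, S q t ∈ B := by
    have h1 := hSc.eventually (Metric.ball_mem_nhds (S (0, z₀)) hr)
    filter_upwards [h1] with q hq t
    have h2 := (ContinuousMap.dist_apply_le_dist (f := S q) (g := S (0, z₀)) t).trans_lt hq
    rwa [hS0] at h2
  have hev := (hS.and hSB)
  rw [nhds_prod_eq] at hev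
  have hev2 := hev.curry
  obtain ⟨ε, hε, hεz⟩ : ∃ ε : ℝ, 0 < ε ∧ ∀ᶠ z in 𝓝 z₀, (ContDiffAt ℝ ∞ S (ε, z) ∧
      ∀ t : unitInterval, S (ε, z) t =
          z + ε • ∫ r in (0 : ℝ)..t, V' (S (ε, z) (projIcc 0 1 zero_le_one r))) ∧
      ∀ t, S (ε, z) t ∈ B := by
    obtain ⟨δ, hδ, h⟩ := Metric.eventually_nhds_iff.1 hev2
    refine ⟨δ / 2, by positivity, h (y := δ / 2) ?_⟩
    rw [dist_zero_right, Real.norm_of_nonneg (by positivity)]; linarith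
  -- Rescaling time turns solutions of z' = εV(z) on [0,1] into solutions of z' = V(z) on [0,ε].
  -- Writing Φ as an integral defined for every real t gives two-sided derivatives at the endpoints
  -- 0 and ε.
  let Φ : Z → ℝ → Z := fun z t =>
    z + ε • ∫ r in (0 : ℝ)..(t / ε), V' (S (ε, z) (projIcc 0 1 zero_le_one r))
  refine ⟨ε, hε, r, hr, Φ, ?_⟩
  filter_upwards [hεz, hεz.eventually_nhds] with z ⟨⟨hz1, hz2⟩, hz3⟩ hz4
  have hmem : ∀ t ∈ Icc 0 ε, t / ε ∈ Icc (0 : ℝ) 1 := fun t ht =>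
    ⟨div_nonneg ht.1 hε.le, (div_le_one hε).2 ht.2⟩
  have hΦS : ∀ t (ht : t ∈ Icc 0 ε), Φ z t = S (ε, z) ⟨t / ε, hmem t ht⟩ := fun t ht =>
    (hz2 ⟨t / ε, hmem t ht⟩).symm
  have hder : ∀ t ∈ Icc 0 ε, Φ z t ∈ B ∧ HasDerivAt (Φ z) (V (Φ z t)) t := by
    intro t ht
    have hB : Φ z t ∈ B := by rw [hΦS t ht]; exact hz3 _
    refine ⟨hB, ?_⟩
    rw [← show V' (Φ z t) = V (Φ z t) from (hrB hB).2]
    have hcont : Continuous fun r : ℝ => V' (S (ε, z) (projIcc 0 1 zero_le_one r)) :=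
      hV'.continuous.comp (continuous_comp_projIcc _)
    have h1 : HasDerivAt (fun u => ∫ r in (0 : ℝ)..u, V' (S (ε, z) (projIcc 0 1 zero_le_one r)))
        (V' (S (ε, z) (projIcc 0 1 zero_le_one (t / ε)))) (t / ε) :=
      intervalIntegral.integral_hasDerivAt_right (hcont.intervalIntegrable _ _)
        hcont.stronglyMeasurable.stronglyMeasurableAtFilter hcont.continuousAt
    have h2 : HasDerivAt (fun t : ℝ => t / ε) (1 / ε) t := (hasDerivAt_id t).div_const ε
    have h3 := ((h1.scomp t h2).const_smul ε).const_add z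
    rw [smul_smul, mul_one_div_cancel hε.ne', one_smul, projIcc_of_mem _ (hmem t ht),
      ← hΦS t ht] at h3
    exact h3
  refine ⟨?_, by simp [Φ], hder, fun ζ hζ0 hζ => ?_⟩
  · have h1 : (fun z => Φ z ε) =ᶠ[𝓝 z] fun z => S (ε, z) 1 := by
      filter_upwards [hz4] with w hw
      have := hw.1.2 1
      simp only [Φ, div_self hε.ne', this]
      simp
    refine ContDiffAt.congr_of_eventuallyEq ?_ h1
    have h2 : ContDiffAt ℝ ∞ (fun w => S (ε, w)) z :=
      hz1.comp z (contDiffAt_const.prodMk contDiffAt_id)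
    exact (ContinuousMap.evalCLM ℝ (1 : unitInterval)).contDiff.contDiffAt.comp z h2
  · have hV'B : LipschitzOnWith K V' B := hK.mono fun w hw => (hrB hw).1
    refine ODE_solution_unique_of_mem_Icc_right (v := fun _ => V') (s := fun _ => B) (K := K)
      (a := 0) (b := ε) (fun t _ => hV'B) (fun t ht => (hζ t ht).2.continuousAt.continuousWithinAt)
      (fun t ht => ?_) (fun t ht => (hζ t (Ico_subset_Icc_self ht)).1)
      (fun t ht => (hder t ht).2.continuousAt.continuousWithinAt) (fun t ht => ?_)
      (fun t ht => (hder t (Ico_subset_Icc_self ht)).1) (by rw [hζ0]; simp [Φ]) ⟨hε.le, le_rfl⟩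
    · have h := hζ t (Ico_subset_Icc_self ht)
      rw [show V' (ζ t) = V (ζ t) from (hrB h.1).2]
      exact h.2.hasDerivWithinAt
    · have h := hder t (Ico_subset_Icc_self ht)
      rw [show V' (Φ z t) = V (Φ z t) from (hrB h.1).2]
      exact h.2.hasDerivWithinAt

end LocalFlow

/-! ### Derivatives, charts and the inverse function theorem in model-space terms. -/

section Toolkit

open Filter Topology Set

section HasD

variable {E E' E'' : Type*} [NormedAddCommGroup E] [NormedSpace ℝ E]
  [NormedAddCommGroup E'] [NormedSpace ℝ E'] [NormedAddCommGroup E''] [NormedSpace ℝ E'']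
  {M M' M'' : Type*} [TopologicalSpace M] [ChartedSpace E M]
  [TopologicalSpace M'] [ChartedSpace E' M'] [TopologicalSpace M''] [ChartedSpace E'' M'']

/-- `f` has derivative `L` at `x`, where tangent spaces are identified with the model spaces. -/
def HasD (f : M → M') (L : E →L[ℝ] E') (x : M) : Prop :=
  HasMFDerivAt 𝓘(ℝ, E) 𝓘(ℝ, E') f x L

/-- `f` is smooth at `x`. -/
def SmoothAt (E E' : Type*) [NormedAddCommGroup E] [NormedSpace ℝ E]
    [NormedAddCommGroup E'] [NormedSpace ℝ E'] {M M' : Type*} [TopologicalSpace M]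
    [ChartedSpace E M] [TopologicalSpace M'] [ChartedSpace E' M'] (f : M → M') (x : M) : Prop :=
  ContMDiffAt 𝓘(ℝ, E) 𝓘(ℝ, E') ∞ f x

namespace HasD

lemma comp_of_eq {f : M → M'} {g : M' → M''} {L : E →L[ℝ] E'} {L' : E' →L[ℝ] E''} {x : M} {y : M'}
    (hg : HasD g L' y) (hf : HasD f L x) (hy : f x = y) :
    HasD (fun x => g (f x)) (L'.comp L) x := by
  subst hy
  exact HasMFDerivAt.comp x hg hf

lemma unique {f : M → M'} {L L' : E →L[ℝ] E'} {x : M} (h : HasD f L x) (h' : HasD f L' x) :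
    L = L' := hasMFDerivAt_unique h h'

lemma congr {f g : M → M'} {L : E →L[ℝ] E'} {x : M} (h : HasD f L x) (hfg : g =ᶠ[𝓝 x] f) :
    HasD g L x := HasMFDerivAt.congr_of_eventuallyEq h hfg

lemma continuousAt {f : M → M'} {L : E →L[ℝ] E'} {x : M} (h : HasD f L x) : ContinuousAt f x :=
  HasMFDerivAt.continuousAt h

lemma id (x : M) : HasD (fun x : M => x) (ContinuousLinearMap.id ℝ E) x := hasMFDerivAt_id x

lemma const (y : M') (x : M) : HasD (fun _ : M => y) (0 : E →L[ℝ] E') x := hasMFDerivAt_const y x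

lemma iff_hasFDerivAt {f : E → E'} {L : E →L[ℝ] E'} {x : E} : HasD f L x ↔ HasFDerivAt f L x :=
  hasMFDerivAt_iff_hasFDerivAt

end HasD

namespace SmoothAt

lemma exists_hasD {f : M → M'} {x : M} (h : SmoothAt E E' f x) : ∃ L : E →L[ℝ] E', HasD f L x :=
  ⟨_, (ContMDiffAt.mdifferentiableAt h (by simp)).hasMFDerivAt⟩

lemma continuousAt {f : M → M'} {x : M} (h : SmoothAt E E' f x) : ContinuousAt f x :=
  ContMDiffAt.continuousAt h

lemma comp_of_eq {f : M → M'} {g : M' → M''} {x : M} {y : M'} (hg : SmoothAt E' E'' g y)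
    (hf : SmoothAt E E' f x) (hy : f x = y) : SmoothAt E E'' (fun x => g (f x)) x := by
  subst hy
  exact ContMDiffAt.comp x hg hf

lemma iff_contDiffAt {f : E → E'} {x : E} : SmoothAt E E' f x ↔ ContDiffAt ℝ ∞ f x :=
  contMDiffAt_iff_contDiffAt

lemma congr {f g : M → M'} {x : M} (h : SmoothAt E E' f x) (hfg : g =ᶠ[𝓝 x] f) :
    SmoothAt E E' g x := ContMDiffAt.congr_of_eventuallyEq h hfg

lemma const (y : M') (x : M) : SmoothAt E E' (fun _ : M => y) x := contMDiffAt_const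

lemma id (x : M) : SmoothAt E E (fun x : M => x) x := contMDiffAt_id

end SmoothAt

end HasD

section Param

variable {E : Type*} [NormedAddCommGroup E] [NormedSpace ℝ E]
  {M : Type*} [TopologicalSpace M] [ChartedSpace E M] [IsManifold 𝓘(ℝ, E) ∞ M]

lemma smoothAt_extChartAt {p x : M} (hx : x ∈ (extChartAt 𝓘(ℝ, E) p).source) :
    SmoothAt E E (extChartAt 𝓘(ℝ, E) p) x :=
  contMDiffAt_extChartAt' (by simpa using hx)

lemma smoothAt_extChartAt_symm {p : M} {y : E} (hy : y ∈ (extChartAt 𝓘(ℝ, E) p).target) :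
    SmoothAt E E (extChartAt 𝓘(ℝ, E) p).symm y :=
  (contMDiffOn_extChartAt_symm p).contMDiffAt ((isOpen_extChartAt_target p).mem_nhds hy)

lemma hasD_extChartAt_self (p : M) :
    HasD (extChartAt 𝓘(ℝ, E) p) (ContinuousLinearMap.id ℝ E) p := by
  have h := ((smoothAt_extChartAt (E := E) (mem_extChartAt_source p)).mdifferentiableAt
    (by simp)).hasMFDerivAt
  rw [mfderiv_extChartAt_self] at h
  exact h

lemma hasD_extChartAt_symm_self (p : M) :
    HasD (extChartAt 𝓘(ℝ, E) p).symm (ContinuousLinearMap.id ℝ E) (extChartAt 𝓘(ℝ, E) p p) := by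
  obtain ⟨L, hL⟩ := (smoothAt_extChartAt_symm (E := E) (mem_extChartAt_target p)).exists_hasD
  have h1 := (hasD_extChartAt_self p).comp_of_eq hL (extChartAt_to_inv (I := 𝓘(ℝ, E)) p)
  have h2 := (HasD.id (E := E) (extChartAt 𝓘(ℝ, E) p p)).congr
    (g := fun y => extChartAt 𝓘(ℝ, E) p ((extChartAt 𝓘(ℝ, E) p).symm y)) (by
      filter_upwards [(isOpen_extChartAt_target p).mem_nhds (mem_extChartAt_target p)] with y hy
      exact (extChartAt 𝓘(ℝ, E) p).right_inv hy)
  have h3 := h1.unique h2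
  rw [ContinuousLinearMap.id_comp] at h3
  rwa [h3] at hL

/-- A smooth parametrization of a neighborhood of `p` by a neighborhood of the origin. -/
lemma exists_smooth_param (p : M) : ∃ σ : E → M, σ 0 = p ∧ (∀ᶠ v in 𝓝 0, SmoothAt E E σ v) ∧
    HasD σ (ContinuousLinearMap.id ℝ E) 0 := by
  have hadd : ∀ v : E, ContDiffAt ℝ ∞ (fun v : E => extChartAt 𝓘(ℝ, E) p p + v) v := fun v =>
    contDiffAt_const.add contDiffAt_id
  refine ⟨fun v => (extChartAt 𝓘(ℝ, E) p).symm (extChartAt 𝓘(ℝ, E) p p + v), ?_, ?_, ?_⟩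
  · simp
  · have hc : Tendsto (fun v : E => extChartAt 𝓘(ℝ, E) p p + v) (𝓝 0)
        (𝓝 (extChartAt 𝓘(ℝ, E) p p)) := by
      have := (hadd 0).continuousAt
      rwa [ContinuousAt, add_zero] at this
    filter_upwards [hc.eventually ((isOpen_extChartAt_target p).mem_nhds
      (mem_extChartAt_target p))] with v hv
    exact (smoothAt_extChartAt_symm hv).comp_of_eq (SmoothAt.iff_contDiffAt.2 (hadd v)) rfl
  · have h1 : HasD (fun v : E => extChartAt 𝓘(ℝ, E) p p + v) (ContinuousLinearMap.id ℝ E) 0 :=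
      HasD.iff_hasFDerivAt.2 ((hasFDerivAt_id (0 : E)).const_add _)
    have := (hasD_extChartAt_symm_self p).comp_of_eq h1 (by simp)
    rwa [ContinuousLinearMap.id_comp] at this

/-- The inverse function theorem for maps from a vector space to a manifold. -/
lemma exists_smooth_local_inverse_manifold {X : Type*} [NormedAddCommGroup X] [NormedSpace ℝ X]
    [FiniteDimensional ℝ X] [FiniteDimensional ℝ E]
    {f : X → M} {x₀ : X} {p : M} (hp : f x₀ = p) (hf : ∀ᶠ x in 𝓝 x₀, SmoothAt X E f x)
    {f' : X →L[ℝ] E} (hf' : HasD f f' x₀) (hbij : Function.Bijective f') :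
    ∃ g : M → X, g p = x₀ ∧ (∀ᶠ y in 𝓝 p, SmoothAt E X g y) ∧ (∀ᶠ y in 𝓝 p, f (g y) = y) ∧
      ∀ᶠ x in 𝓝 x₀, g (f x) = x := by
  subst hp
  have : CompleteSpace X := FiniteDimensional.complete ℝ X
  set φ := extChartAt 𝓘(ℝ, E) (f x₀) with hφ
  let L : X ≃L[ℝ] E := (LinearEquiv.ofBijective f'.toLinearMap hbij).toContinuousLinearEquiv
  have hL : (L : X →L[ℝ] E) = f' := by ext x; rfl
  have hfc : ContinuousAt f x₀ := hf'.continuousAt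
  have hsrc : ∀ᶠ y in 𝓝 (f x₀), y ∈ φ.source := extChartAt_source_mem_nhds (f x₀)
  have hF : ∀ᶠ x in 𝓝 x₀, ContDiffAt ℝ ∞ (fun x => φ (f x)) x := by
    filter_upwards [hf, hfc.eventually hsrc] with x hx hx2
    exact SmoothAt.iff_contDiffAt.1 ((smoothAt_extChartAt hx2).comp_of_eq hx rfl)
  have hF' : HasFDerivAt (fun x => φ (f x)) (L : X →L[ℝ] E) x₀ := by
    have := (hasD_extChartAt_self (f x₀)).comp_of_eq hf' rfl
    rw [ContinuousLinearMap.id_comp, ← hL] at this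
    exact HasD.iff_hasFDerivAt.1 this
  obtain ⟨g, hg0, hg1, hg2⟩ := exists_smooth_local_inverse hF L hF'
  have hφc : ContinuousAt φ (f x₀) := continuousAt_extChartAt (f x₀)
  have hg1' := hφc.eventually hg1
  have hgc : Tendsto (fun y => g (φ y)) (𝓝 (f x₀)) (𝓝 x₀) := by
    have h1 : ContinuousAt g (φ (f x₀)) := hg1.self_of_nhds.1.continuousAt
    have := h1.comp hφc
    simpa [ContinuousAt, hg0, Function.comp_def] using this
  refine ⟨fun y => g (φ y), hg0, ?_, ?_, hg2⟩
  · filter_upwards [hg1', hsrc] with y hy hy2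
    exact (SmoothAt.iff_contDiffAt.2 hy.1).comp_of_eq (smoothAt_extChartAt hy2) rfl
  · filter_upwards [hg1', hsrc, hgc.eventually (hfc.eventually hsrc)] with y hy hy2 hy3
    exact φ.injOn hy3 hy2 hy.2

end Param

end Toolkit

/-! ### Smooth group actions: tangent spaces of orbits and compactness arguments. -/

section Action

open Filter Topology Set

variable {E E' : Type*} [NormedAddCommGroup E] [NormedSpace ℝ E]
  [NormedAddCommGroup E'] [NormedSpace ℝ E']
  {M : Type*} [TopologicalSpace M] [ChartedSpace E M]
  {G : Type*} [Group G] [TopologicalSpace G] [ChartedSpace E' G]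
  [MulAction G M]

variable (E E') in
/-- The derivative at `g` of the orbit map of `y`. -/
noncomputable def dOrb (g : G) (y : M) : E' →L[ℝ] E :=
  mfderiv 𝓘(ℝ, E') 𝓘(ℝ, E) (fun h : G => h • y) g

variable (E) in
/-- The derivative at `y` of the action of `g`. -/
noncomputable def dAct (g : G) (y : M) : E →L[ℝ] E :=
  mfderiv 𝓘(ℝ, E) 𝓘(ℝ, E) (fun z : M => g • z) y

variable (E E' G) in
/-- The tangent space of the orbit of `x`. -/
noncomputable def orbTan (x : M) : Submodule ℝ E := LinearMap.range (dOrb E E' (1 : G) x).toLinearMap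

section Smooth

variable [hsm : ContMDiffSMul 𝓘(ℝ, E') 𝓘(ℝ, E) ∞ G M]

lemma SmoothAt.smul {F : Type*} [NormedAddCommGroup F] [NormedSpace ℝ F] {P : Type*}
    [TopologicalSpace P] [ChartedSpace F P] {a : P → G} {f : P → M} {x : P}
    (ha : SmoothAt F E' a x) (hf : SmoothAt F E f x) : SmoothAt F E (fun x => a x • f x) x :=
  ContMDiffAt.smul ha hf

lemma smoothAt_smul_const (y : M) (g : G) : SmoothAt E' E (fun h : G => h • y) g :=
  (SmoothAt.id g).smul (SmoothAt.const y g)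

include hsm in
lemma smoothAt_const_smul (g : G) (y : M) : SmoothAt E E (fun z : M => g • z) y :=
  SmoothAt.smul (E' := E') (SmoothAt.const g y) (SmoothAt.id y)

lemma hasD_dOrb (g : G) (y : M) : HasD (fun h : G => h • y) (dOrb E E' g y) g :=
  (ContMDiffAt.mdifferentiableAt (smoothAt_smul_const (E := E) (E' := E') y g)
    (by simp)).hasMFDerivAt

include hsm in
lemma hasD_dAct (g : G) (y : M) : HasD (fun z : M => g • z) (dAct E g y) y :=
  (ContMDiffAt.mdifferentiableAt (smoothAt_const_smul (E := E) (E' := E') g y)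
    (by simp)).hasMFDerivAt

lemma HasD.smul {F : Type*} [NormedAddCommGroup F] [NormedSpace ℝ F] {P : Type*}
    [TopologicalSpace P] [ChartedSpace F P] {a : P → G} {f : P → M} {x : P} {a' : F →L[ℝ] E'}
    {f' : F →L[ℝ] E} (ha : HasD a a' x) (hf : HasD f f' x) :
    HasD (fun x => a x • f x)
      ((dOrb E E' (a x) (f x)).comp a' + (dAct E (a x) (f x)).comp f') x := by
  obtain ⟨L, hL⟩ : ∃ L : E' × E →L[ℝ] E, HasMFDerivAt (𝓘(ℝ, E').prod 𝓘(ℝ, E)) 𝓘(ℝ, E)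
      (fun p : G × M => p.1 • p.2) (a x, f x) L :=
    ⟨_, (((contMDiff_smul (I := 𝓘(ℝ, E')) (I' := 𝓘(ℝ, E)) (n := ∞) (G := G) (M := M)).mdifferentiable
      (by simp)) (a x, f x)).hasMFDerivAt⟩
  have h1 : HasD (fun h : G => h • f x) (L.comp (ContinuousLinearMap.inl ℝ E' E)) (a x) := by
    have h : HasMFDerivAt 𝓘(ℝ, E') (𝓘(ℝ, E').prod 𝓘(ℝ, E)) (fun h : G => (h, f x)) (a x) _ :=
      HasMFDerivAt.prodMk (hasMFDerivAt_id (a x)) (hasMFDerivAt_const (f x) (a x))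
    exact HasMFDerivAt.comp (f := fun h : G => (h, f x)) (a x) hL h
  have h2 : HasD (fun z : M => a x • z) (L.comp (ContinuousLinearMap.inr ℝ E' E)) (f x) := by
    have h : HasMFDerivAt 𝓘(ℝ, E) (𝓘(ℝ, E').prod 𝓘(ℝ, E)) (fun z : M => (a x, z)) (f x) _ :=
      HasMFDerivAt.prodMk (hasMFDerivAt_const (a x) (f x)) (hasMFDerivAt_id (f x))
    exact HasMFDerivAt.comp (f := fun z : M => (a x, z)) (f x) hL h
  have h3 : HasD (fun x => a x • f x) (L.comp (a'.prod f')) x := by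
    have h : HasMFDerivAt 𝓘(ℝ, F) (𝓘(ℝ, E').prod 𝓘(ℝ, E)) (fun x => (a x, f x)) x _ :=
      HasMFDerivAt.prodMk ha hf
    exact HasMFDerivAt.comp (f := fun x => (a x, f x)) x hL h
  rw [(hasD_dOrb (a x) (f x)).unique h1, (hasD_dAct (E' := E') (a x) (f x)).unique h2]
  convert h3 using 1
  ext v
  simp [← map_add]

include hsm in
lemma dAct_mul (g h : G) (x : M) :
    dAct E (g * h) x = (dAct E g (h • x)).comp (dAct E h x) := by
  have h1 := (hasD_dAct (E := E) (E' := E') g (h • x)).comp_of_eq (hasD_dAct (E' := E') h x) rfl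
  simp only [smul_smul] at h1
  exact (hasD_dAct (E' := E') (g * h) x).unique h1

include hsm in
lemma dAct_one (x : M) : dAct E (1 : G) x = ContinuousLinearMap.id ℝ E := by
  have h1 := hasD_dAct (E := E) (E' := E') (1 : G) x
  simp only [one_smul] at h1
  exact h1.unique (HasD.id x)

include hsm in
lemma dAct_inv_apply (g : G) (x : M) (v : E) : dAct E g⁻¹ (g • x) (dAct E g x v) = v := by
  have h := dAct_mul (E := E) (E' := E') g⁻¹ g x
  rw [inv_mul_cancel, dAct_one (E' := E')] at h
  exact (DFunLike.congr_fun h v).symm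

include hsm in
lemma dAct_injective (g : G) (x : M) : Function.Injective (dAct E g x) :=
  Function.LeftInverse.injective (dAct_inv_apply (E' := E') g x)

variable [LieGroup 𝓘(ℝ, E') ∞ G]

/-- Right translation by g carries the orbit map of `g • y` at 1 to the orbit map of y at g. -/
lemma range_dOrb (g : G) (y : M) :
    LinearMap.range (dOrb E E' g y).toLinearMap = orbTan E E' G (g • y) := by
  have : ContMDiffMul 𝓘(ℝ, E') ∞ G := LieGroup.toContMDiffMul
  have hR : ∀ k h : G, ∃ L : E' →L[ℝ] E', HasD (fun h : G => h * k) L h := fun k h =>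
    SmoothAt.exists_hasD (contMDiff_mul_right (I := 𝓘(ℝ, E')) (n := ∞) (a := k)).contMDiffAt
  apply le_antisymm
  · obtain ⟨L, hL⟩ := hR g⁻¹ g
    have h1 := (hasD_dOrb (E := E) (E' := E') (1 : G) (g • y)).comp_of_eq hL (mul_inv_cancel g)
    simp only [smul_smul, inv_mul_cancel_right] at h1
    rintro _ ⟨v, rfl⟩
    exact ⟨L v, DFunLike.congr_fun (h1.unique (hasD_dOrb g y)) v⟩
  · obtain ⟨L, hL⟩ := hR g 1
    have h1 := (hasD_dOrb (E := E) (E' := E') g y).comp_of_eq hL (one_mul g)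
    simp only [mul_smul] at h1
    rintro _ ⟨v, rfl⟩
    exact ⟨L v, DFunLike.congr_fun (h1.unique (hasD_dOrb 1 (g • y))) v⟩

lemma dOrb_mem_orbTan (g : G) (y : M) (ξ : E') : dOrb E E' g y ξ ∈ orbTan E E' G (g • y) := by
  rw [← range_dOrb]; exact ⟨ξ, rfl⟩

lemma dAct_mem_orbTan (g : G) {x : M} {v : E} (hv : v ∈ orbTan E E' G x) :
    dAct E g x v ∈ orbTan E E' G (g • x) := by
  have : ContMDiffMul 𝓘(ℝ, E') ∞ G := LieGroup.toContMDiffMul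
  obtain ⟨ξ, rfl⟩ := hv
  obtain ⟨L, hL⟩ : ∃ L : E' →L[ℝ] E', HasD (fun h : G => g * h) L (1 : G) :=
    SmoothAt.exists_hasD (contMDiff_mul_left (I := 𝓘(ℝ, E')) (n := ∞) (a := g)).contMDiffAt
  have h1 := (hasD_dOrb (E := E) (E' := E') g x).comp_of_eq hL (mul_one g)
  have h2 := (hasD_dAct (E := E) (E' := E') g x).comp_of_eq
    (hasD_dOrb (E := E) (E' := E') (1 : G) x) (one_smul G x)
  simp only [mul_smul] at h1
  have h3 := DFunLike.congr_fun (h2.unique h1) ξ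
  rw [show dAct E g x ((dOrb E E' (1 : G) x).toLinearMap ξ) = dOrb E E' g x (L ξ) from h3]
  exact dOrb_mem_orbTan g x _

lemma map_dAct_orbTan (g : G) (x : M) :
    (orbTan E E' G x).map (dAct E g x).toLinearMap = orbTan E E' G (g • x) := by
  apply le_antisymm
  · rintro _ ⟨v, hv, rfl⟩
    exact dAct_mem_orbTan g hv
  · intro w hw
    have h1 := dAct_mem_orbTan g⁻¹ hw
    rw [inv_smul_smul] at h1
    refine ⟨_, h1, ?_⟩
    have h2 := dAct_inv_apply (E := E) (E' := E') g⁻¹ (g • x) w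
    rwa [inv_inv, inv_smul_smul] at h2

lemma finrank_orbTan_smul (g : G) (x : M) :
    Module.finrank ℝ (orbTan E E' G (g • x)) = Module.finrank ℝ (orbTan E E' G x) := by
  rw [← map_dAct_orbTan]
  exact (Submodule.equivMapOfInjective _ (dAct_injective (E' := E') g x) _).finrank_eq.symm

end Smooth

section Compactness

variable {M : Type*} [TopologicalSpace M] [T2Space M] {G : Type*} [Group G] [TopologicalSpace G]
  [IsTopologicalGroup G] [CompactSpace G] [MulAction G M] [ContinuousSMul G M]

/-- The orbit may not return to p by group elements far from the isotropy group: the g for which `g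
• p` is not reached from near 1 form a compact set, whose image is closed and misses p. -/
lemma eventually_exists_mem_smul_eq {O : Set G} (hO : O ∈ 𝓝 (1 : G)) (p : M) :
    ∀ᶠ x in 𝓝 p, ∀ g : G, g • p = x → ∃ g' ∈ O, g' • p = x := by
  obtain ⟨U, hUO, hU, h1U⟩ := mem_nhds_iff.1 hO
  let C : Set G := {g | ∃ g' ∈ U, g' • p = g • p}ᶜ
  have hC : IsClosed C := by
    rw [isClosed_compl_iff]
    have : {g : G | ∃ g' ∈ U, g' • p = g • p} =
        ⋃ k ∈ MulAction.stabilizer G p, (fun g : G => g * k⁻¹) ⁻¹' U := by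
      ext g
      simp only [mem_ofPred_eq, mem_iUnion, mem_preimage, exists_prop, MulAction.mem_stabilizer_iff]
      constructor
      · rintro ⟨g', hg', h⟩
        exact ⟨g'⁻¹ * g, by rw [mul_smul, ← h, inv_smul_smul], by simpa using hg'⟩
      · rintro ⟨k, hk, h⟩
        exact ⟨_, h, by rw [mul_smul, inv_smul_eq_iff.2 hk.symm]⟩
    rw [this]
    exact isOpen_biUnion fun k _ => hU.preimage (continuous_mul_const _)
  have hCp : IsClosed ((fun g : G => g • p) '' C) :=
    (hC.isCompact.image (continuous_id.smul continuous_const)).isClosed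
  have hp : p ∉ (fun g : G => g • p) '' C := by
    rintro ⟨g, hg, h⟩
    exact hg ⟨1, h1U, by rw [one_smul]; exact h.symm⟩
  filter_upwards [hCp.isOpen_compl.mem_nhds hp] with x hx g hg
  by_contra hcon
  push Not at hcon
  exact hx ⟨g, fun ⟨g', hg', h⟩ => hcon g' (hUO hg') (h.trans hg), hg⟩

/-- If `y` and `g • y` are both close to `p`, then so is `g • p`. -/
lemma eventually_smul_mem_of_smul_mem (p : M) {Q : Set M} (hQ : Q ∈ 𝓝 p) :
    ∃ Q' ∈ 𝓝 p, ∀ (g : G) (y : M), y ∈ Q' → g • y ∈ Q' → g • p ∈ Q := by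
  obtain ⟨U, hUQ, hU, hpU⟩ := mem_nhds_iff.1 hQ
  have hC : IsCompact {g : G | g • p ∈ U}ᶜ :=
    (hU.preimage (continuous_id.smul continuous_const)).isClosed_compl.isCompact
  -- Each g that moves p out of U separates p from `g • p`; compactness of the set of such g makes
  -- the separation uniform.
  have h1 : ∀ᶠ q : M × M in 𝓝 (p, p), ∀ g ∈ {g : G | g • p ∈ U}ᶜ, g • q.1 ≠ q.2 := by
    apply hC.eventually_forall_of_forall_eventually
    intro g hg
    have hne : g • p ≠ p := fun h => hg (by rw [mem_ofPred_eq, h]; exact hpU)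
    have hc1 : Continuous fun z : (M × M) × G => z.2 • z.1.1 := by fun_prop
    have hc2 : Continuous fun z : (M × M) × G => z.1.2 := by fun_prop
    exact (isOpen_ne_fun hc1 hc2).mem_nhds hne
  rw [nhds_prod_eq] at h1
  obtain ⟨t, ht, h⟩ := mem_prod_same_iff.1 h1
  refine ⟨t, ht, fun g y hy hgy => hUQ ?_⟩
  by_contra hcon
  exact h (mk_mem_prod hy hgy) g hcon rfl

end Compactness

/-- A compact set of group elements fixing `p` maps a small neighborhood of `p` into a given one. -/
lemma eventually_forall_smul_mem {M : Type*} [TopologicalSpace M] {G : Type*} [Group G]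
    [TopologicalSpace G] [MulAction G M] [ContinuousSMul G M] {C : Set G}
    (hC : IsCompact C) {p : M} (hp : ∀ g ∈ C, g • p = p)
    {Q : Set M} (hQ : Q ∈ 𝓝 p) : ∀ᶠ y in 𝓝 p, ∀ g ∈ C, g • y ∈ Q := by
  apply hC.eventually_forall_of_forall_eventually
  intro g hg
  have hc : Continuous fun z : M × G => z.2 • z.1 := by fun_prop
  exact hc.continuousAt.preimage_mem_nhds (by simpa [hp g hg] using hQ)

end Action

/-! ### Slice charts. -/

section Slice

open Filter Topology Set

variable {E E' : Type*} [NormedAddCommGroup E] [NormedSpace ℝ E] [FiniteDimensional ℝ E]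
  [NormedAddCommGroup E'] [NormedSpace ℝ E'] [FiniteDimensional ℝ E']
  {M : Type*} [TopologicalSpace M] [ChartedSpace E M] [IsManifold 𝓘(ℝ, E) ∞ M]
  {G : Type*} [Group G] [TopologicalSpace G] [ChartedSpace E' G] [LieGroup 𝓘(ℝ, E') ∞ G]
  [MulAction G M] [hsm : ContMDiffSMul 𝓘(ℝ, E') 𝓘(ℝ, E) ∞ G M]
  {N : Type*} [NormedAddCommGroup N] [NormedSpace ℝ N] [FiniteDimensional ℝ N]

/-- `σ` parametrizes a slice at `p`, `a` parametrizes a submanifold of `G` that is mapped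
diffeomorphically to a neighborhood of `p` in its orbit, and `inv` is a smooth local inverse of
`(w, n) ↦ a w • σ n`. -/
structure IsSliceChart {W : Type*} [NormedAddCommGroup W] [NormedSpace ℝ W] (E E' : Type*)
    [NormedAddCommGroup E] [NormedSpace ℝ E] [NormedAddCommGroup E'] [NormedSpace ℝ E']
    {M : Type*} [TopologicalSpace M] [ChartedSpace E M]
    {G : Type*} [Group G] [TopologicalSpace G] [ChartedSpace E' G] [MulAction G M]
    {N : Type*} [NormedAddCommGroup N] [NormedSpace ℝ N]
    (p : M) (σ : N → M) (a : W → G) (inv : M → W × N) : Prop where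
  slice_zero : σ 0 = p
  slice_smooth : ∀ᶠ n in 𝓝 0, SmoothAt N E σ n
  a_zero : a 0 = 1
  a_smooth : ∀ᶠ w in 𝓝 0, SmoothAt W E' a w
  inv_self : inv p = 0
  inv_smooth : ∀ᶠ x in 𝓝 p, SmoothAt E (W × N) inv x
  right_inv : ∀ᶠ x in 𝓝 p, a (inv x).1 • σ (inv x).2 = x
  left_inv : ∀ᶠ q in 𝓝 (0 : W × N), inv (a q.1 • σ q.2) = q

lemma hasD_fst {W N : Type*} [NormedAddCommGroup W] [NormedSpace ℝ W] [NormedAddCommGroup N]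
    [NormedSpace ℝ N] (q : W × N) : HasD (fun q : W × N => q.1) (ContinuousLinearMap.fst ℝ W N) q :=
  HasD.iff_hasFDerivAt.2 hasFDerivAt_fst

lemma hasD_snd {W N : Type*} [NormedAddCommGroup W] [NormedSpace ℝ W] [NormedAddCommGroup N]
    [NormedSpace ℝ N] (q : W × N) : HasD (fun q : W × N => q.2) (ContinuousLinearMap.snd ℝ W N) q :=
  HasD.iff_hasFDerivAt.2 hasFDerivAt_snd

variable (E') in
/-- Existence of slice charts: a transversal `σ` to the orbit of `p` extends to a slice chart. -/
lemma exists_isSliceChart {p : M} {σ : N → M} (hσ0 : σ 0 = p)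
    (hσ : ∀ᶠ n in 𝓝 0, SmoothAt N E σ n) {σ' : N →L[ℝ] E} (hσ' : HasD σ σ' 0)
    (hinj : Function.Injective σ')
    (hcompl : IsCompl (LinearMap.range σ'.toLinearMap) (orbTan E E' G p)) :
    ∃ (W : Submodule ℝ E') (a : W → G) (inv : M → W × N), IsSliceChart E E' p σ a inv ∧
      Module.finrank ℝ (orbTan E E' G p) ≤ Module.finrank ℝ W := by
  obtain ⟨α, hα0, hα, hα'⟩ := exists_smooth_param (E := E') (1 : G)
  let A : E' →L[ℝ] E := dOrb E E' (1 : G) p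
  -- On a complement of the kernel, the derivative of the orbit map is an isomorphism onto the
  -- tangent space of the orbit.
  obtain ⟨W, hW⟩ := Submodule.exists_isCompl (LinearMap.ker A.toLinearMap)
  let ι : W →L[ℝ] E' := W.subtypeL
  have hι : Tendsto ι (𝓝 0) (𝓝 0) := by simpa using ι.continuous.tendsto 0
  let a : W → G := fun w => α (ι w)
  have ha0 : a 0 = 1 := by simp [a, hα0]
  have ha : ∀ᶠ w in 𝓝 0, SmoothAt W E' a w := by
    filter_upwards [hι.eventually hα] with w hw
    exact hw.comp_of_eq (SmoothAt.iff_contDiffAt.2 ι.contDiff.contDiffAt) rfl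
  have ha' : HasD a ι 0 := by
    have := hα'.comp_of_eq (HasD.iff_hasFDerivAt.2 (ι.hasFDerivAt (x := 0))) (map_zero ι)
    rwa [ContinuousLinearMap.id_comp] at this
  let Ψ : W × N → M := fun q => a q.1 • σ q.2
  have hΨ0 : Ψ 0 = p := by simp [Ψ, ha0, hσ0]
  have hfst : Tendsto (fun q : W × N => q.1) (𝓝 0) (𝓝 0) := continuous_fst.tendsto 0
  have hsnd : Tendsto (fun q : W × N => q.2) (𝓝 0) (𝓝 0) := continuous_snd.tendsto 0
  have hΨ : ∀ᶠ q in 𝓝 0, SmoothAt (W × N) E Ψ q := by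
    filter_upwards [hfst.eventually ha, hsnd.eventually hσ] with q h1 h2
    exact (h1.comp_of_eq (SmoothAt.iff_contDiffAt.2 contDiffAt_fst) rfl).smul
      (h2.comp_of_eq (SmoothAt.iff_contDiffAt.2 contDiffAt_snd) rfl)
  have hΨ' := (ha'.comp_of_eq (hasD_fst (0 : W × N)) rfl).smul
    (hσ'.comp_of_eq (hasD_snd (0 : W × N)) rfl)
  set Ψ' := ((dOrb E E' (a (0 : W × N).1) (σ (0 : W × N).2)).comp
      (ι.comp (ContinuousLinearMap.fst ℝ W N)) + (dAct E (a (0 : W × N).1) (σ (0 : W × N).2)).comp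
      (σ'.comp (ContinuousLinearMap.snd ℝ W N))) with hΨ'def
  have hΨ'apply : ∀ q : W × N, Ψ' q = A q.1 + σ' q.2 := by
    intro q
    simp [hΨ'def, ha0, hσ0, dAct_one (E' := E'), A, ι]
  have hAW : ∀ w : W, A w = 0 → w = 0 := by
    intro w hw
    have : (w : E') ∈ LinearMap.ker A.toLinearMap ⊓ W := ⟨hw, w.2⟩
    rw [hW.inf_eq_bot] at this
    exact Subtype.ext (by simpa using this)
  have hbij : Function.Bijective Ψ' := by
    constructor
    · rw [injective_iff_map_eq_zero]
      intro q hq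
      rw [hΨ'apply] at hq
      have h1 : σ' q.2 ∈ LinearMap.range σ'.toLinearMap ⊓ orbTan E E' G p := by
        refine ⟨⟨q.2, rfl⟩, ?_⟩
        rw [← neg_eq_of_add_eq_zero_right hq]
        exact neg_mem ⟨_, rfl⟩
      rw [hcompl.inf_eq_bot, Submodule.mem_bot] at h1
      rw [h1, add_zero] at hq
      exact Prod.ext (hAW _ hq) (hinj (by rw [h1, Prod.snd_zero, map_zero]))
    · intro v
      have hv : v ∈ LinearMap.range σ'.toLinearMap ⊔ orbTan E E' G p := by
        rw [hcompl.sup_eq_top]; trivial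
      obtain ⟨_, ⟨n, rfl⟩, _, ⟨ξ, rfl⟩, rfl⟩ := Submodule.mem_sup.1 hv
      have hξ : ξ ∈ LinearMap.ker A.toLinearMap ⊔ W := by rw [hW.sup_eq_top]; trivial
      obtain ⟨k, hk, w, hw, rfl⟩ := Submodule.mem_sup.1 hξ
      refine ⟨(⟨w, hw⟩, n), ?_⟩
      rw [hΨ'apply]
      have hk' : A k = 0 := hk
      change A w + σ' n = σ' n + A (k + w)
      rw [map_add, hk', zero_add, add_comm]
  obtain ⟨inv, hinv0, hinvs, hinvr, hinvl⟩ :=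
    exists_smooth_local_inverse_manifold hΨ0 hΨ hΨ' hbij
  refine ⟨W, a, inv, ⟨hσ0, hσ, ha0, ha, hinv0, hinvs, hinvr, hinvl⟩, ?_⟩
  have h1 := LinearMap.finrank_range_add_finrank_ker A.toLinearMap
  have h2 := Submodule.finrank_add_eq_of_isCompl hW
  change Module.finrank ℝ (LinearMap.range A.toLinearMap) ≤ _
  lia

namespace IsSliceChart

variable {W : Type*} [NormedAddCommGroup W] [NormedSpace ℝ W]
  {p : M} {σ : N → M} {a : W → G} {inv : M → W × N}

lemma tendsto_slice (h : IsSliceChart E E' p σ a inv) :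
    Tendsto (fun q : W × N => a q.1 • σ q.2) (𝓝 0) (𝓝 p) := by
  have h1 : ContinuousAt (fun q : W × N => a q.1 • σ q.2) 0 := by
    have ha := h.a_smooth.self_of_nhds
    have hσ := h.slice_smooth.self_of_nhds
    exact SmoothAt.continuousAt (E := W × N) (E' := E)
      ((ha.comp_of_eq (SmoothAt.iff_contDiffAt.2 contDiffAt_fst) rfl).smul
        (hσ.comp_of_eq (SmoothAt.iff_contDiffAt.2 contDiffAt_snd) rfl))
  have h2 : a (0 : W × N).1 • σ (0 : W × N).2 = p := by
    simp [h.a_zero, h.slice_zero]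
  rwa [ContinuousAt, h2] at h1

omit [IsManifold 𝓘(ℝ, E) ∞ M] [LieGroup 𝓘(ℝ, E') ∞ G] hsm [FiniteDimensional ℝ E]
  [FiniteDimensional ℝ E'] [FiniteDimensional ℝ N] in
lemma tendsto_inv (h : IsSliceChart E E' p σ a inv) : Tendsto inv (𝓝 p) (𝓝 0) := by
  have := h.inv_smooth.self_of_nhds.continuousAt
  rwa [ContinuousAt, h.inv_self] at this

/-- The derivative of the chart along the orbit directions is injective, with values in the tangent
space of the orbit. -/
lemma exists_hasD_orbit (h : IsSliceChart E E' p σ a inv) :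
    ∀ᶠ q in 𝓝 (0 : W × N), ∃ P : W →L[ℝ] E, HasD (fun w => a w • σ q.2) P q.1 ∧
      ∃ a' : W →L[ℝ] E', HasD a a' q.1 ∧ P = (dOrb E E' (a q.1) (σ q.2)).comp a' ∧
      (∀ w, P w ∈ orbTan E E' G (a q.1 • σ q.2)) ∧
      ∀ I' : E →L[ℝ] W × N, HasD inv I' (a q.1 • σ q.2) → ∀ w, I' (P w) = (w, 0) := by
  have hfst : Tendsto (fun q : W × N => q.1) (𝓝 0) (𝓝 0) := continuous_fst.tendsto 0
  filter_upwards [hfst.eventually h.a_smooth, h.left_inv.eventually_nhds] with q hq1 hq2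
  obtain ⟨a', ha'⟩ := hq1.exists_hasD
  have h1 := ha'.smul (HasD.const (E := W) (E' := E) (σ q.2) q.1)
  rw [ContinuousLinearMap.comp_zero, add_zero] at h1
  refine ⟨_, h1, a', ha', rfl, fun w => dOrb_mem_orbTan _ _ _, fun I' hI' w => ?_⟩
  have h2 := hI'.comp_of_eq h1 rfl
  have hin : HasD (fun w : W => (w, q.2)) (ContinuousLinearMap.inl ℝ W N) q.1 :=
    HasD.iff_hasFDerivAt.2 (hasFDerivAt_prodMk_left q.1 q.2)
  have hc : Tendsto (fun w : W => (w, q.2)) (𝓝 q.1) (𝓝 q) :=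
    (Continuous.prodMk_left q.2).tendsto q.1
  have h3 := hin.congr (g := fun w => inv (a w • σ q.2)) (hc.eventually hq2)
  exact DFunLike.congr_fun (h2.unique h3) w

/-- Near `p`, the orbit of `p` is given by the vanishing of the slice coordinate. -/
lemma orbit_eq [T2Space M] [CompactSpace G] [FiniteDimensional ℝ W]
    (h : IsSliceChart E E' p σ a inv)
    (hdim : Module.finrank ℝ (orbTan E E' G p) ≤ Module.finrank ℝ W) :
    ∀ᶠ x in 𝓝 p, ∀ g : G, g • p = x → (inv x).2 = 0 := by
  have : IsTopologicalGroup G := topologicalGroup_of_lieGroup 𝓘(ℝ, E') ∞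
  have : ContinuousSMul G M := ContMDiffSMul.continuousSMul (I := 𝓘(ℝ, E')) (I' := 𝓘(ℝ, E)) ∞
  obtain ⟨α, hα0, hα, hα'⟩ := exists_smooth_param (E := E') (1 : G)
  let f : E' → N := fun ξ => (inv (α ξ • p)).2
  have hαc : Tendsto (fun ξ => α ξ • p) (𝓝 0) (𝓝 p) := by
    have h1 : ContinuousAt (fun ξ => α ξ • p) 0 :=
      hα'.continuousAt.smul continuousAt_const
    rwa [ContinuousAt, hα0, one_smul] at h1
  -- Orbit tangent spaces have constant dimension along an orbit, so near p they are spanned by the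
  -- W-directions of the chart, along which the slice coordinate does not change.
  have hf : ∀ᶠ ξ in 𝓝 (0 : E'), HasFDerivAt f (0 : E' →L[ℝ] N) ξ := by
    filter_upwards [hα, hαc.eventually h.inv_smooth, hαc.eventually h.right_inv,
      (h.tendsto_inv.comp hαc).eventually h.exists_hasD_orbit] with ξ h1 h2 h3 h4
    obtain ⟨α', hα'⟩ := h1.exists_hasD
    obtain ⟨I', hI'⟩ := h2.exists_hasD
    obtain ⟨P, -, -, -, -, hP1, hP2⟩ := h4
    simp only [Function.comp_apply] at hP1 hP2
    rw [h3] at hP1 hP2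
    have hPI := hP2 I' hI'
    have hPinj : Function.Injective P := by
      intro w w' hww
      have := hPI w
      rw [hww, hPI w'] at this
      exact (congrArg Prod.fst this).symm
    have hrange : LinearMap.range P.toLinearMap = orbTan E E' G (α ξ • p) := by
      apply Submodule.eq_of_le_of_finrank_le
      · rintro _ ⟨w, rfl⟩
        exact hP1 w
      · rw [finrank_orbTan_smul, LinearMap.finrank_range_of_inj (f := P.toLinearMap) hPinj]
        exact hdim
    have h5 := ((hasD_snd (inv (α ξ • p))).comp_of_eq (hI'.comp_of_eq
      ((hasD_dOrb (E := E) (α ξ) p).comp_of_eq hα' rfl) rfl) rfl)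
    rw [← HasD.iff_hasFDerivAt]
    convert h5 using 1
    ext v
    have h6 : dOrb E E' (α ξ) p (α' v) ∈ orbTan E E' G (α ξ • p) := dOrb_mem_orbTan _ _ _
    rw [← hrange] at h6
    obtain ⟨w, hw⟩ := h6
    have hw' : P w = dOrb E E' (α ξ) p (α' v) := hw
    simp [← hw', hPI w]
  obtain ⟨r, hr, hball⟩ := Metric.eventually_nhds_iff_ball.1 hf
  have hconst : ∀ ξ ∈ Metric.ball (0 : E') r, f ξ = 0 := by
    intro ξ hξ
    have h1 := (convex_ball (0 : E') r).norm_image_sub_le_of_norm_hasFDerivWithin_le (f := f)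
      (f' := fun _ => (0 : E' →L[ℝ] N)) (C := 0) (fun ξ hξ => (hball ξ hξ).hasFDerivWithinAt) (by simp)
      (Metric.mem_ball_self hr) hξ
    rw [zero_mul, norm_le_zero_iff, sub_eq_zero] at h1
    rw [h1]
    simp [f, hα0, h.inv_self]
  obtain ⟨β, hβ0, hβs, hβr, -⟩ := exists_smooth_local_inverse_manifold hα0 hα hα'
    Function.bijective_id
  have hO : {g : G | (inv (g • p)).2 = 0} ∈ 𝓝 (1 : G) := by
    have hβc : Tendsto β (𝓝 1) (𝓝 0) := by
      have := hβs.self_of_nhds.continuousAt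
      rwa [ContinuousAt, hβ0] at this
    filter_upwards [hβr, hβc.eventually (Metric.ball_mem_nhds (0 : E') hr)] with g hg1 hg2
    have := hconst _ hg2
    simp only [f, hg1] at this
    exact this
  -- So far only group elements near 1 are covered; compactness shows that near p these give the
  -- whole orbit.
  filter_upwards [eventually_exists_mem_smul_eq hO p] with x hx g hg
  obtain ⟨g', hg', h1⟩ := hx g hg
  rw [← h1]
  exact hg'

end IsSliceChart

end Slice

/-! ### The Riemannian metric on the model space. -/

section Metric

open Filter Topology Set MeasureTheory
open scoped ENNReal NNReal

/-- The orthogonal complement of a subspace, parametrized by a Euclidean space. -/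
lemma exists_isometry_orthogonal {V : Type*} [NormedAddCommGroup V] [InnerProductSpace ℝ V]
    [FiniteDimensional ℝ V] (R : Submodule ℝ V) :
    ∃ (n : ℕ) (J : EuclideanSpace ℝ (Fin n) →ₗ[ℝ] V),
      (∀ v w, inner ℝ (J v) (J w) = inner ℝ v w) ∧ IsCompl (LinearMap.range J) R ∧
      (∀ v, ∀ r ∈ R, inner ℝ (J v) r = 0) ∧
      ∀ w, (∀ r ∈ R, inner ℝ w r = 0) → w ∈ LinearMap.range J := by
  let b := stdOrthonormalBasis ℝ (Rᗮ : Submodule ℝ V)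
  let J : EuclideanSpace ℝ (Fin (Module.finrank ℝ (Rᗮ : Submodule ℝ V))) →ₗ[ℝ] V :=
    (Rᗮ : Submodule ℝ V).subtype.comp b.repr.symm.toLinearEquiv.toLinearMap
  have hrange : LinearMap.range J = Rᗮ := by
    rw [LinearMap.range_comp, LinearEquiv.range, Submodule.map_top, Submodule.range_subtype]
  refine ⟨_, J, fun v w => ?_, ?_, fun v r hr => ?_, fun w hw => ?_⟩
  · exact b.repr.symm.inner_map_map v w
  · rw [hrange]; exact R.isCompl_orthogonal.symm
  · have : J v ∈ Rᗮ := hrange.le ⟨v, rfl⟩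
    exact (Submodule.mem_orthogonal' R _).1 this r hr
  · rw [hrange]; exact (Submodule.mem_orthogonal' R _).2 hw

variable {E : Type*} [NormedAddCommGroup E] [NormedSpace ℝ E]
  {M : Type*} [TopologicalSpace M] [ChartedSpace E M]
  [RiemannianBundle (fun x : M => TangentSpace 𝓘(ℝ, E) x)]

/-- The Riemannian metric at `x`, as a function on the model space. -/
noncomputable def riem (x : M) (v w : E) : ℝ := @inner ℝ (TangentSpace 𝓘(ℝ, E) x) _ v w

lemma riem_comm (x : M) (v w : E) : riem x v w = riem x w v :=
  real_inner_comm (F := TangentSpace 𝓘(ℝ, E) x) w v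

lemma riem_add_left (x : M) (u v w : E) : riem x (u + v) w = riem x u w + riem x v w :=
  inner_add_left (E := TangentSpace 𝓘(ℝ, E) x) (𝕜 := ℝ) u v w

lemma riem_smul_left (x : M) (c : ℝ) (v w : E) : riem x (c • v) w = c * riem x v w :=
  real_inner_smul_left (F := TangentSpace 𝓘(ℝ, E) x) v w c

lemma riem_add_right (x : M) (u v w : E) : riem x u (v + w) = riem x u v + riem x u w :=
  inner_add_right (E := TangentSpace 𝓘(ℝ, E) x) (𝕜 := ℝ) u v w

lemma riem_smul_right (x : M) (c : ℝ) (v w : E) : riem x v (c • w) = c * riem x v w :=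
  real_inner_smul_right (F := TangentSpace 𝓘(ℝ, E) x) v w c

lemma riem_self_nonneg (x : M) (v : E) : 0 ≤ riem x v v :=
  real_inner_self_nonneg (F := TangentSpace 𝓘(ℝ, E) x) (x := v)

lemma riem_self_eq_zero (x : M) {v : E} : riem x v v = 0 ↔ v = 0 :=
  inner_self_eq_zero (𝕜 := ℝ) (E := TangentSpace 𝓘(ℝ, E) x) (x := v)

lemma enorm_tangentSpace_eq (x : M) (v : E) :
    @enorm (TangentSpace 𝓘(ℝ, E) x) _ v = ENNReal.ofReal (Real.sqrt (riem x v v)) := by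
  refine (ofReal_norm (E := TangentSpace 𝓘(ℝ, E) x) v).symm.trans (congrArg ENNReal.ofReal ?_)
  exact norm_eq_sqrt_real_inner (F := TangentSpace 𝓘(ℝ, E) x) v

lemma riem_exists_isometry_orthogonal [FiniteDimensional ℝ E] (x : M) (R : Submodule ℝ E) :
    ∃ (n : ℕ) (J : EuclideanSpace ℝ (Fin n) →ₗ[ℝ] E),
      (∀ v w, riem x (J v) (J w) = inner ℝ v w) ∧ IsCompl (LinearMap.range J) R ∧
      (∀ v, ∀ r ∈ R, riem x (J v) r = 0) ∧
      ∀ w, (∀ r ∈ R, riem x w r = 0) → w ∈ LinearMap.range J := by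
  have : FiniteDimensional ℝ (TangentSpace 𝓘(ℝ, E) x) := inferInstanceAs (FiniteDimensional ℝ E)
  exact exists_isometry_orthogonal (V := TangentSpace 𝓘(ℝ, E) x) R

section Smooth

variable [IsManifold 𝓘(ℝ, E) ∞ M]
  [hr : IsContMDiffRiemannianBundle 𝓘(ℝ, E) ∞ E (fun x : M => TangentSpace 𝓘(ℝ, E) x)]

lemma contDiffOn_riem {X : Type*} [NormedAddCommGroup X] [NormedSpace ℝ X] {f : X → M} {s : Set X}
    (hs : IsOpen s) (hf : ∀ x ∈ s, SmoothAt X E f x) {f' : X → X →L[ℝ] E}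
    (hf' : ∀ x ∈ s, HasD f (f' x) x) (v w : X) :
    ContDiffOn ℝ ∞ (fun x => riem (f x) (f' x v) (f' x w)) s := by
  have hfs : ContMDiffOn 𝓘(ℝ, X) 𝓘(ℝ, E) ∞ f s := fun x hx => (hf x hx).contMDiffWithinAt
  have hT := hfs.contMDiffOn_tangentMapWithin (m := ∞) (by simp) hs.uniqueMDiffOn
  have hsec : ∀ v : X, ContMDiffOn 𝓘(ℝ, X) (𝓘(ℝ, E).prod 𝓘(ℝ, E)) ∞
      (fun x => (⟨f x, f' x v⟩ : TotalSpace E (fun x : M => TangentSpace 𝓘(ℝ, E) x))) s := by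
    intro v
    have hv : ContMDiff 𝓘(ℝ, X) (𝓘(ℝ, X).prod 𝓘(ℝ, X)) ∞
        (fun x => (⟨x, v⟩ : TangentBundle 𝓘(ℝ, X) X)) := by
      rw [contMDiff_vectorSpace_iff_contDiff (V := fun _ => v)]
      exact contDiff_const
    have h1 := hT.comp hv.contMDiffOn (s := s) (fun x hx => hx)
    refine h1.congr fun x hx => ?_
    simp only [Function.comp_apply, tangentMapWithin]
    congr 1
    have h2 : mfderivWithin 𝓘(ℝ, X) 𝓘(ℝ, E) f s x = f' x := by
      rw [mfderivWithin_of_isOpen hs hx]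
      exact HasMFDerivAt.mfderiv (hf' x hx)
    rw [h2]
    rfl
  have h3 := ContMDiffOn.inner_bundle (E := fun x : M => TangentSpace 𝓘(ℝ, E) x) (b := f)
    (v := fun x => f' x v) (w := fun x => f' x w) (hsec v) (hsec w)
  exact contMDiffOn_iff_contDiffOn.1 h3

end Smooth

end Metric

/-! ### Comparison of the distance with speeds and gradients. -/

section Distance

open Filter Topology Set MeasureTheory
open scoped ENNReal NNReal

variable {E : Type*} [NormedAddCommGroup E] [NormedSpace ℝ E]
  {M : Type*} [MetricSpace M] [ChartedSpace E M] [IsManifold 𝓘(ℝ, E) ∞ M]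
  [RiemannianBundle (fun x : M => TangentSpace 𝓘(ℝ, E) x)]
  [hr : IsContMDiffRiemannianBundle 𝓘(ℝ, E) ∞ E (fun x : M => TangentSpace 𝓘(ℝ, E) x)]
  [hM : IsRiemannianManifold 𝓘(ℝ, E) M]

lemma enorm_mfderiv_one {γ : ℝ → M} {γ' : ℝ →L[ℝ] E} {t : ℝ} (h : HasD γ γ' t) :
    ‖mfderiv 𝓘(ℝ, ℝ) 𝓘(ℝ, E) γ t 1‖ₑ = ENNReal.ofReal (Real.sqrt (riem (γ t) (γ' 1) (γ' 1))) := by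
  rw [← enorm_tangentSpace_eq, HasMFDerivAt.mfderiv h]
  rfl

/-- If the speed at t₀ were below c, it would stay below some m < c on an interval, and the length
of that piece of the curve would be less than the distance of its ends. -/
lemma le_speed_of_dist_eq {γ : ℝ → M} (hγ : ∀ t, SmoothAt ℝ E γ t) {γ' : ℝ → ℝ →L[ℝ] E}
    (hγ' : ∀ t, HasD γ (γ' t) t) {c : ℝ} {t₀ : ℝ}
    (hd : ∀ᶠ t in 𝓝 t₀, dist (γ t₀) (γ t) = c * |t₀ - t|) :
    c ≤ Real.sqrt (riem (γ t₀) (γ' t₀ 1) (γ' t₀ 1)) := by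
  by_contra hlt
  push Not at hlt
  obtain ⟨m, hm1, hm2⟩ := exists_between hlt
  have hm0 : 0 ≤ m := (Real.sqrt_nonneg _).trans hm1.le
  have hcont : Continuous fun t => Real.sqrt (riem (γ t) (γ' t 1) (γ' t 1)) := by
    have h := contDiffOn_riem isOpen_univ (fun t _ => hγ t) (fun t _ => hγ' t) 1 1
    exact Real.continuous_sqrt.comp (continuousOn_univ.1 h.continuousOn)
  have hev := (hcont.continuousAt.eventually (gt_mem_nhds hm1)).and hd
  obtain ⟨δ, hδ, h⟩ := Metric.eventually_nhds_iff.1 hev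
  let t₁ := t₀ + δ / 2
  have ht₁ : t₀ ≤ t₁ := by simp only [t₁]; linarith
  have hnear : ∀ t ∈ Icc t₀ t₁, dist t t₀ < δ := by
    intro t ht
    rw [Real.dist_eq, abs_of_nonneg (by linarith [ht.1])]
    have := ht.2
    simp only [t₁] at this
    linarith
  have h1 : edist (γ t₀) (γ t₁) ≤ ENNReal.ofReal (m * (t₁ - t₀)) := by
    rw [hM.out]
    refine (Manifold.riemannianEDist_le_pathELength (γ := γ) (a := t₀) (b := t₁) (fun t _ =>
      ((hγ t).of_le (by simp)).contMDiffWithinAt) rfl rfl ht₁).trans ?_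
    rw [Manifold.pathELength_eq_lintegral_mfderiv_Icc]
    refine (setLIntegral_mono_ae' (g := fun _ => ENNReal.ofReal m) measurableSet_Icc
      (ae_of_all _ fun t ht => ?_)).trans ?_
    · rw [enorm_mfderiv_one (hγ' t)]
      exact ENNReal.ofReal_le_ofReal (h (hnear t ht)).1.le
    · rw [setLIntegral_const, Real.volume_Icc, ENNReal.ofReal_mul hm0]
  have h2 := (h (hnear t₁ ⟨ht₁, le_rfl⟩)).2
  rw [edist_dist, h2] at h1
  have hpos : 0 < t₁ - t₀ := by simp only [t₁]; linarith
  rw [ENNReal.ofReal_le_ofReal_iff (mul_nonneg hm0 hpos.le), abs_sub_comm, abs_of_pos hpos] at h1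
  nlinarith

lemma eventually_abs_sub_le_mul_dist {f : M → ℝ} {p : M} {L : ℝ} (hL : 0 ≤ L)
    (hf : ∀ᶠ x in 𝓝 p, SmoothAt E ℝ f x ∧ ∀ f' : E →L[ℝ] ℝ, HasD f f' x →
      ∀ v, |f' v| ≤ L * Real.sqrt (riem x v v)) :
    ∀ᶠ x in 𝓝 p, |f x - f p| ≤ L * dist x p := by
  obtain ⟨δ, hδ, h⟩ := Metric.eventually_nhds_iff.1 hf
  filter_upwards [Metric.ball_mem_nhds p hδ] with x hx
  rw [Metric.mem_ball, dist_comm] at hx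
  -- Integrate the bound on df along a path from p to x of length less than r; since r < δ, the path
  -- stays in the ball where the bound holds.
  have hkey : ∀ r, dist p x < r → r < δ → |f x - f p| ≤ L * r := by
    intro r hr1 hr2
    have hr0 : 0 < r := dist_nonneg.trans_lt hr1
    have h1 : Manifold.riemannianEDist 𝓘(ℝ, E) p x < ENNReal.ofReal r := by
      rw [← hM.out, edist_dist]
      exact (ENNReal.ofReal_lt_ofReal_iff hr0).2 hr1
    obtain ⟨η, hη0, hη1, hη, hlen⟩ := Manifold.exists_lt_of_riemannianEDist_lt h1
    have hball : ∀ t ∈ Icc (0 : ℝ) 1, dist (η t) p < δ := by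
      intro t ht
      have h2 : edist p (η t) ≤ Manifold.pathELength 𝓘(ℝ, E) η 0 t := by
        rw [hM.out]
        exact Manifold.riemannianEDist_le_pathELength (hη.mono (Icc_subset_Icc_right ht.2)) hη0
          rfl ht.1
      have h3 := (h2.trans (Manifold.pathELength_mono le_rfl ht.2)).trans_lt hlen
      rw [edist_dist, ENNReal.ofReal_lt_ofReal_iff hr0] at h3
      rw [dist_comm]
      exact h3.trans hr2
    have hfη : ContMDiffOn 𝓘(ℝ, ℝ) 𝓘(ℝ, ℝ) 1 (fun t => f (η t)) (Icc 0 1) := by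
      intro t ht
      exact ContMDiffAt.comp_contMDiffWithinAt t ((h (hball t ht)).1.of_le (by simp)) (hη t ht)
    have h4 : edist (f p) (f x) ≤ ENNReal.ofReal L * Manifold.pathELength 𝓘(ℝ, E) η 0 1 := by
      rw [IsRiemannianManifold.out (I := 𝓘(ℝ, ℝ)) (f p) (f x)]
      refine (Manifold.riemannianEDist_le_pathELength hfη (by rw [hη0]) (by rw [hη1])
        zero_le_one).trans ?_
      rw [Manifold.pathELength_eq_lintegral_mfderiv_Ioo, Manifold.pathELength_eq_lintegral_mfderiv_Ioo,
        ← lintegral_const_mul' _ _ ENNReal.ofReal_ne_top]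
      refine setLIntegral_mono_ae' measurableSet_Ioo (ae_of_all _ fun t ht => ?_)
      obtain ⟨η', hηt⟩ : ∃ η' : ℝ →L[ℝ] E, HasD η η' t :=
        ⟨_, ((hη.contMDiffAt (Icc_mem_nhds ht.1 ht.2)).mdifferentiableAt one_ne_zero).hasMFDerivAt⟩
      have hb := h (hball t (Ioo_subset_Icc_self ht))
      obtain ⟨f', hf'⟩ := hb.1.exists_hasD
      have hcomp := hf'.comp_of_eq hηt rfl
      rw [enorm_mfderiv_one hηt, ← ENNReal.ofReal_mul hL,
        show mfderiv 𝓘(ℝ, ℝ) 𝓘(ℝ, ℝ) (fun t => f (η t)) t = _ from HasMFDerivAt.mfderiv hcomp,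
        enorm_tangentSpace_vectorSpace]
      refine le_of_eq_of_le (Real.enorm_eq_ofReal_abs (f' (η' 1))) ?_
      exact ENNReal.ofReal_le_ofReal (hb.2 f' hf' _)
    have h5 : edist (f p) (f x) ≤ ENNReal.ofReal (L * r) := by
      rw [ENNReal.ofReal_mul hL]
      exact h4.trans (by gcongr)
    rw [edist_dist, ENNReal.ofReal_le_ofReal_iff (by positivity), Real.dist_eq, abs_sub_comm] at h5
    exact h5
  rw [dist_comm]
  refine le_of_forall_gt_imp_ge_of_dense fun b hb => ?_
  have hcont : ContinuousAt (fun r => L * r) (dist p x) := by fun_prop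
  have hev : ∀ᶠ r in 𝓝[>] dist p x, L * r < b ∧ r < δ :=
    ((hcont.eventually (gt_mem_nhds hb)).and (gt_mem_nhds hx)).filter_mono nhdsWithin_le_nhds
  obtain ⟨r, ⟨hr1, hr2⟩, hr3⟩ := (hev.and self_mem_nhdsWithin).exists
  exact (hkey r hr3 hr2).trans hr1.le

end Distance

/-! ### Normal geodesics: orbits over the interior have codimension one. -/

section NormalLift

open Filter Topology Set

/-- Dimension one is the only case in which removing the centre disconnects a ball; this is how the
codimension of an orbit is detected. In dimension 0 the set is empty. -/
lemma isPreconnected_ball_diff_zero {N : Type*} [NormedAddCommGroup N] [NormedSpace ℝ N]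
    [FiniteDimensional ℝ N] (h : Module.finrank ℝ N ≠ 1) {r : ℝ} (hr : 0 < r) :
    IsPreconnected (Metric.ball (0 : N) r \ {0}) := by
  rcases Nat.lt_or_gt_of_ne h with h0 | h1
  · have : Subsingleton N := Module.finrank_zero_iff.1 (by lia : Module.finrank ℝ N = 0)
    exact Set.Subsingleton.isPreconnected (Set.subsingleton_of_subsingleton)
  · have hc := (isConnected_compl_singleton_of_one_lt_rank
      (Module.one_lt_rank_of_one_lt_finrank h1) (0 : N)).isPreconnected
    have hcont : Continuous fun v : N => (r / (1 + ‖v‖)) • v :=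
      (continuous_const.div (by fun_prop) fun v => by positivity).smul continuous_id
    have := hc.image _ hcont.continuousOn
    convert this using 1
    ext y
    simp only [Set.mem_sdiff, Metric.mem_ball, dist_zero_right, mem_singleton_iff, mem_image,
      mem_compl_iff]
    constructor
    · rintro ⟨hy, hy0⟩
      have hpos : 0 < r - ‖y‖ := by linarith
      refine ⟨(r - ‖y‖)⁻¹ • y, by simp [hpos.ne', hy0], ?_⟩
      rw [smul_smul, norm_smul, Real.norm_of_nonneg (by positivity)]
      have : r / (1 + (r - ‖y‖)⁻¹ * ‖y‖) * (r - ‖y‖)⁻¹ = 1 := by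
        have h2 : 1 + (r - ‖y‖)⁻¹ * ‖y‖ = r * (r - ‖y‖)⁻¹ := by field_simp; ring
        rw [h2]
        field_simp
      rw [this, one_smul]
    · rintro ⟨v, hv, rfl⟩
      have hpos : 0 < 1 + ‖v‖ := by positivity
      refine ⟨?_, by simp [hv, hpos.ne', hr.ne']⟩
      rw [norm_smul, Real.norm_of_nonneg (by positivity), div_mul_eq_mul_div, div_lt_iff₀ hpos]
      nlinarith [norm_nonneg v]

/-- The projection `f` to the orbit space `[0, 2]` and a normal geodesic `β` lifting it, with
velocity `β'` and speed `c`. -/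
structure IsNormalLift (E E' G : Type*) [NormedAddCommGroup E] [NormedSpace ℝ E]
    [NormedAddCommGroup E'] [NormedSpace ℝ E'] [Group G] [TopologicalSpace G] [ChartedSpace E' G]
    {M : Type*} [MetricSpace M] [ChartedSpace E M]
    [RiemannianBundle (fun x : M => TangentSpace 𝓘(ℝ, E) x)] [MulAction G M]
    (f : M → ℝ) (β : ℝ → M) (β' : ℝ → E) (c : ℝ) : Prop where
  continuous : Continuous f
  map_smul : ∀ (g : G) x, f (g • x) = f x
  exists_smul : ∀ x y, f x = f y → ∃ g : G, g • x = y
  mem_Icc : ∀ x, f x ∈ Icc (0 : ℝ) 2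
  image_open : ∀ U : Set M, IsOpen U → ∃ V : Set ℝ, IsOpen V ∧ f '' U = V ∩ Icc 0 2
  lift : ∀ t ∈ Icc (0 : ℝ) 2, f (β t) = t
  smooth : ∀ t, SmoothAt ℝ E β t
  hasD : ∀ t, HasD β (ContinuousLinearMap.toSpanSingleton ℝ (β' t)) t
  perp : ∀ t, ∀ v ∈ orbTan E E' G (β t), riem (β t) (β' t) v = 0
  isometric : ∀ (g : G) (x : M) (v w : E),
    riem (g • x) (dAct E g x v) (dAct E g x w) = riem x v w
  c_pos : 0 < c
  dist_eq : ∀ t₀, ∀ᶠ t in 𝓝 t₀, dist (β t₀) (β t) = c * |t₀ - t|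

namespace IsNormalLift

variable {E E' : Type*} [NormedAddCommGroup E] [NormedSpace ℝ E] [FiniteDimensional ℝ E]
  [NormedAddCommGroup E'] [NormedSpace ℝ E'] [FiniteDimensional ℝ E']
  {M : Type*} [MetricSpace M] [ChartedSpace E M] [IsManifold 𝓘(ℝ, E) ∞ M]
  [RiemannianBundle (fun x : M => TangentSpace 𝓘(ℝ, E) x)]
  [hr : IsContMDiffRiemannianBundle 𝓘(ℝ, E) ∞ E (fun x : M => TangentSpace 𝓘(ℝ, E) x)]
  [hM : IsRiemannianManifold 𝓘(ℝ, E) M]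
  {G : Type*} [Group G] [TopologicalSpace G] [ChartedSpace E' G] [LieGroup 𝓘(ℝ, E') ∞ G]
  [CompactSpace G]
  [MulAction G M] [hsm : ContMDiffSMul 𝓘(ℝ, E') 𝓘(ℝ, E) ∞ G M]
  {f : M → ℝ} {β : ℝ → M} {β' : ℝ → E} {c : ℝ}

omit [FiniteDimensional ℝ E] [FiniteDimensional ℝ E'] [LieGroup 𝓘(ℝ, E') ∞ G] [CompactSpace G]
  hsm in
lemma le_speed (h : IsNormalLift E E' G f β β' c) (t : ℝ) :
    c ≤ Real.sqrt (riem (β t) (β' t) (β' t)) := by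
  have := le_speed_of_dist_eq h.smooth h.hasD (h.dist_eq t)
  simpa using this

omit [FiniteDimensional ℝ E] [FiniteDimensional ℝ E'] [LieGroup 𝓘(ℝ, E') ∞ G] [CompactSpace G]
  hsm in
lemma velocity_ne_zero (h : IsNormalLift E E' G f β β' c) (t : ℝ) : β' t ≠ 0 := by
  intro h0
  have h1 := h.le_speed t
  rw [h0, (riem_self_eq_zero (β t)).2 rfl, Real.sqrt_zero] at h1
  exact h.c_pos.not_ge h1

omit [FiniteDimensional ℝ E] [FiniteDimensional ℝ E'] [LieGroup 𝓘(ℝ, E') ∞ G] [CompactSpace G]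
  hsm [IsManifold 𝓘(ℝ, E) ∞ M] hr hM in
lemma exists_forall_abs_sub_lt (h : IsNormalLift E E' G f β β' c) {t₀ : ℝ}
    (ht₀ : t₀ ∈ Ioo (0 : ℝ) 2) {U : Set M} (hU : U ∈ 𝓝 (β t₀)) :
    ∃ ε > 0, ∀ t, |t - t₀| < ε → ∃ x ∈ U, f x = t := by
  obtain ⟨O, hOU, hO, hβO⟩ := mem_nhds_iff.1 hU
  obtain ⟨V, hV, hVO⟩ := h.image_open O hO
  have h1 : t₀ ∈ V ∩ Ioo 0 2 :=
    ⟨(hVO.le ⟨β t₀, hβO, h.lift t₀ (Ioo_subset_Icc_self ht₀)⟩).1, ht₀⟩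
  obtain ⟨ε, hε, hball⟩ := Metric.isOpen_iff.1 (hV.inter isOpen_Ioo) t₀ h1
  refine ⟨ε, hε, fun t ht => ?_⟩
  have h2 := hball (by simpa [Real.dist_eq] using ht : t ∈ Metric.ball t₀ ε)
  obtain ⟨x, hx, rfl⟩ := hVO.ge ⟨h2.1, Ioo_subset_Icc_self h2.2⟩
  exact ⟨x, hOU hx, rfl⟩

omit hr hM in
/-- The orbits over the interior of the orbit space have codimension one. -/
lemma finrank_eq_one_of_isCompl (h : IsNormalLift E E' G f β β' c) {t₀ : ℝ}
    (ht₀ : t₀ ∈ Ioo (0 : ℝ) 2) {N : Submodule ℝ E} (hN : IsCompl N (orbTan E E' G (β t₀))) :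
    Module.finrank ℝ N = 1 := by
  by_contra hne
  obtain ⟨σ, hσ0, hσ, hσ'⟩ := exists_smooth_param (E := E) (β t₀)
  have hι : Tendsto (N.subtypeL : N → E) (𝓝 0) (𝓝 0) := by
    simpa using N.subtypeL.continuous.tendsto 0
  have hσ'N : HasD (fun n : N => σ n) N.subtypeL 0 := by
    have := hσ'.comp_of_eq (HasD.iff_hasFDerivAt.2 (N.subtypeL.hasFDerivAt (x := 0)))
      (map_zero N.subtypeL)
    rwa [ContinuousLinearMap.id_comp] at this
  have hσN : ∀ᶠ n : N in 𝓝 0, SmoothAt N E (fun n : N => σ n) n := by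
    filter_upwards [hι.eventually hσ] with n hn
    exact hn.comp_of_eq (SmoothAt.iff_contDiffAt.2 N.subtypeL.contDiff.contDiffAt) rfl
  obtain ⟨W, a, inv, hs, hdim⟩ := exists_isSliceChart E' (σ := fun n : N => σ n)
    (by simpa using hσ0) hσN hσ'N Subtype.val_injective (by simpa using hN)
  have h0 : Tendsto (fun n : N => ((0 : W), n)) (𝓝 0) (𝓝 0) :=
    (Continuous.prodMk_right (0 : W)).tendsto 0
  have h1 : Tendsto (fun n : N => σ n) (𝓝 0) (𝓝 (β t₀)) := by
    simpa [ContinuousAt, hσ0] using hσ'N.continuousAt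
  have hne : ∀ᶠ n : N in 𝓝 0, ContinuousAt (fun n : N => σ n) n ∧ (f (σ n) = t₀ → n = 0) := by
    filter_upwards [hσN, h0.eventually hs.left_inv, h1.eventually (hs.orbit_eq hdim)]
      with n hn1 hn2 hn3
    refine ⟨hn1.continuousAt, fun hn => ?_⟩
    obtain ⟨g, hg⟩ := h.exists_smul (β t₀) (σ n) (by rw [hn, h.lift _ (Ioo_subset_Icc_self ht₀)])
    have h3 := hn3 g hg
    simp only [hs.a_zero, one_smul] at hn2
    rwa [hn2] at h3
  obtain ⟨r, hr, hball⟩ := Metric.eventually_nhds_iff_ball.1 hne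
  have hU : ∀ᶠ x in 𝓝 (β t₀), ∃ n ∈ Metric.ball (0 : N) r, f x = f (σ n) := by
    have h3 : Tendsto (fun x => (inv x).2) (𝓝 (β t₀)) (𝓝 0) :=
      (continuous_snd.tendsto (0 : W × N)).comp hs.tendsto_inv
    filter_upwards [hs.right_inv, h3.eventually (Metric.ball_mem_nhds 0 hr)] with x hx1 hx2
    refine ⟨_, hx2, ?_⟩
    conv_lhs => rw [← hx1]
    exact h.map_smul _ _
  obtain ⟨ε, hε, hrange⟩ := h.exists_forall_abs_sub_lt ht₀ hU
  -- Since f is open onto [0,2], on the punctured slice it takes values on both sides of t₀. By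
  -- connectedness it would also take the value t₀, although the slice meets the orbit over t₀ only
  -- at its centre.
  have hpre : IsPreconnected ((fun n : N => f (σ n)) '' (Metric.ball (0 : N) r \ {0})) := by
    refine (isPreconnected_ball_diff_zero ‹_› hr).image _ fun n hn => ?_
    exact (h.continuous.continuousAt.comp (hball n hn.1).1).continuousWithinAt
  have hmem : ∀ t, |t - t₀| < ε → t ≠ t₀ →
      t ∈ (fun n : N => f (σ n)) '' (Metric.ball (0 : N) r \ {0}) := by
    intro t ht htne
    obtain ⟨x, ⟨n, hn, hxn⟩, rfl⟩ := hrange t ht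
    refine ⟨n, ⟨hn, ?_⟩, hxn.symm⟩
    rintro rfl
    apply htne
    rw [hxn]
    simp only [ZeroMemClass.coe_zero, hσ0]
    exact h.lift _ (Ioo_subset_Icc_self ht₀)
  have h4 := hmem (t₀ - ε / 2) (by rw [sub_sub_cancel_left, abs_neg, abs_of_pos] <;> linarith)
    (by linarith)
  have h5 := hmem (t₀ + ε / 2) (by rw [add_sub_cancel_left, abs_of_pos] <;> linarith)
    (by linarith)
  obtain ⟨n, hn, hfn⟩ := hpre.Icc_subset h4 h5 (⟨by linarith, by linarith⟩ : t₀ ∈ Icc _ _)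
  exact hn.2 ((hball n hn.1).2 hfn)

omit hM hr in
lemma disjoint_velocity (h : IsNormalLift E E' G f β β' c) (hne : ∀ t, β' t ≠ 0) (t : ℝ) :
    Disjoint (Submodule.span ℝ {β' t}) (orbTan E E' G (β t)) := by
  rw [Submodule.disjoint_def]
  intro v hv hv'
  obtain ⟨a, rfl⟩ := Submodule.mem_span_singleton.1 hv
  have h1 := h.perp t _ hv'
  rw [riem_smul_right, mul_eq_zero, riem_self_eq_zero] at h1
  rw [h1.resolve_right (hne t), zero_smul]

lemma isCompl_velocity (h : IsNormalLift E E' G f β β' c) {t : ℝ} (ht : t ∈ Ioo (0 : ℝ) 2) :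
    IsCompl (Submodule.span ℝ {β' t}) (orbTan E E' G (β t)) := by
  have hd := h.disjoint_velocity h.velocity_ne_zero t
  obtain ⟨N, hN, hNc⟩ := hd.exists_isCompl
  have h1 := h.finrank_eq_one_of_isCompl ht hNc
  rwa [Submodule.eq_of_le_of_finrank_eq hN
    (by rw [h1, finrank_span_singleton (h.velocity_ne_zero t)])]

/-- The slice chart given by the normal geodesic at an interior point. -/
lemma exists_isSliceChart_of_mem_Ioo (h : IsNormalLift E E' G f β β' c) {t₀ : ℝ}
    (ht₀ : t₀ ∈ Ioo (0 : ℝ) 2) :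
    ∃ (W : Submodule ℝ E') (a : W → G) (inv : M → W × ℝ),
      IsSliceChart E E' (β t₀) (fun τ => β (t₀ + τ)) a inv ∧
      ∀ᶠ x in 𝓝 (β t₀), f x = t₀ + (inv x).2 := by
  have hadd : ∀ τ : ℝ, HasD (fun τ : ℝ => t₀ + τ) (ContinuousLinearMap.id ℝ ℝ) τ := fun τ =>
    HasD.iff_hasFDerivAt.2 ((hasFDerivAt_id τ).const_add t₀)
  have hσ : ∀ τ, SmoothAt ℝ E (fun τ => β (t₀ + τ)) τ := fun τ =>
    (h.smooth (t₀ + τ)).comp_of_eq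
      (SmoothAt.iff_contDiffAt.2 (contDiffAt_const.add contDiffAt_id)) rfl
  have hσ' := (h.hasD t₀).comp_of_eq (hadd 0) (add_zero t₀)
  rw [ContinuousLinearMap.comp_id] at hσ'
  obtain ⟨W, a, inv, hs, -⟩ := exists_isSliceChart E' (σ := fun τ => β (t₀ + τ))
    (by rw [add_zero]) (Eventually.of_forall hσ) hσ' (by
      intro x y hxy
      simpa [h.velocity_ne_zero t₀] using hxy) (by
      have := h.isCompl_velocity ht₀
      rwa [ContinuousLinearMap.toLinearMap_toSpanSingleton, ← LinearMap.span_singleton_eq_range])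
  refine ⟨W, a, inv, hs, ?_⟩
  have h3 : Tendsto (fun x => t₀ + (inv x).2) (𝓝 (β t₀)) (𝓝 t₀) := by
    have := ((continuous_snd.tendsto (0 : W × ℝ)).comp hs.tendsto_inv).const_add t₀
    simpa using this
  filter_upwards [hs.right_inv, h3.eventually (Icc_mem_nhds ht₀.1 ht₀.2)] with x hx1 hx2
  conv_lhs => rw [← hx1]
  rw [h.map_smul, h.lift _ hx2]

end IsNormalLift

end NormalLift

/-! ### The regular part: constant isotropy, the gradient of f, constant speed. -/

section NormalLiftRegular

open Filter Topology Set

namespace IsNormalLift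

variable {E E' : Type*} [NormedAddCommGroup E] [NormedSpace ℝ E] [FiniteDimensional ℝ E]
  [NormedAddCommGroup E'] [NormedSpace ℝ E'] [FiniteDimensional ℝ E']
  {M : Type*} [MetricSpace M] [ChartedSpace E M] [IsManifold 𝓘(ℝ, E) ∞ M]
  [RiemannianBundle (fun x : M => TangentSpace 𝓘(ℝ, E) x)]
  [hr : IsContMDiffRiemannianBundle 𝓘(ℝ, E) ∞ E (fun x : M => TangentSpace 𝓘(ℝ, E) x)]
  [hM : IsRiemannianManifold 𝓘(ℝ, E) M]
  {G : Type*} [Group G] [TopologicalSpace G] [ChartedSpace E' G] [LieGroup 𝓘(ℝ, E') ∞ G]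
  [CompactSpace G]
  [MulAction G M] [hsm : ContMDiffSMul 𝓘(ℝ, E') 𝓘(ℝ, E) ∞ G M]
  {f : M → ℝ} {β : ℝ → M} {β' : ℝ → E} {c : ℝ}

omit hr hM [FiniteDimensional ℝ E] [FiniteDimensional ℝ E'] [IsManifold 𝓘(ℝ, E) ∞ M]
  [CompactSpace G] in
lemma dAct_perp (h : IsNormalLift E E' G f β β' c) (g : G) (t : ℝ) {v : E}
    (hv : v ∈ orbTan E E' G (g • β t)) : riem (g • β t) (dAct E g (β t) (β' t)) v = 0 := by
  rw [← map_dAct_orbTan] at hv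
  obtain ⟨w, hw, rfl⟩ := hv
  exact (h.isometric g (β t) _ w).trans (h.perp t w hw)

/-- An element fixing an interior point of the normal geodesic fixes nearby points as well. -/
lemma eventually_smul_eq (h : IsNormalLift E E' G f β β' c) {t₀ : ℝ}
    (ht₀ : t₀ ∈ Ioo (0 : ℝ) 2) {g : G} (hg : g • β t₀ = β t₀) :
    ∀ᶠ t in 𝓝 t₀, g • β t = β t := by
  obtain ⟨W, a, inv, hs, hf⟩ := h.exists_isSliceChart_of_mem_Ioo ht₀
  let w : ℝ → W := fun τ => (inv (g • β (t₀ + τ))).1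
  have hadd : ∀ τ : ℝ, HasD (fun τ : ℝ => t₀ + τ) (ContinuousLinearMap.id ℝ ℝ) τ := fun τ =>
    HasD.iff_hasFDerivAt.2 ((hasFDerivAt_id τ).const_add t₀)
  have hσ : ∀ τ, HasD (fun τ => β (t₀ + τ))
      (ContinuousLinearMap.toSpanSingleton ℝ (β' (t₀ + τ))) τ := fun τ => by
    have := (h.hasD (t₀ + τ)).comp_of_eq (hadd τ) rfl
    rwa [ContinuousLinearMap.comp_id] at this
  have hgσ : ∀ τ, HasD (fun τ => g • β (t₀ + τ)) _ τ := fun τ =>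
    (hasD_dAct (E := E) (E' := E') g (β (t₀ + τ))).comp_of_eq (hσ τ) rfl
  have hc : Tendsto (fun τ => g • β (t₀ + τ)) (𝓝 0) (𝓝 (β t₀)) := by
    have := (hgσ 0).continuousAt
    rwa [ContinuousAt, add_zero, hg] at this
  have ht : Tendsto (fun τ => t₀ + τ) (𝓝 0) (𝓝 t₀) := by
    simpa using (continuous_const_add t₀).tendsto 0
  have hsnd : ∀ᶠ τ in 𝓝 (0 : ℝ), (inv (g • β (t₀ + τ))).2 = τ := by
    filter_upwards [hc.eventually hf, ht.eventually (Icc_mem_nhds ht₀.1 ht₀.2)] with τ h1 h2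
    rw [h.map_smul, h.lift _ h2] at h1
    linarith
  have hinv : ∀ᶠ τ in 𝓝 (0 : ℝ), a (w τ) • β (t₀ + τ) = g • β (t₀ + τ) := by
    filter_upwards [hc.eventually hs.right_inv, hsnd] with τ h1 h2
    rw [h2] at h1
    exact h1
  have hw0 : w 0 = 0 := by simp [w, hg, hs.inv_self]
  have hinvc : Tendsto (fun τ => inv (g • β (t₀ + τ))) (𝓝 0) (𝓝 0) := hs.tendsto_inv.comp hc
  -- Differentiate a(w τ) • β = g • β. The translates of β' by a(w τ) and by g are both normal to
  -- the orbit, and they differ by P(w'), which is tangent to it; so P(w') = 0 and w' = 0.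
  have hw : ∀ᶠ τ in 𝓝 (0 : ℝ), HasFDerivAt w (0 : ℝ →L[ℝ] W) τ := by
    filter_upwards [hinv.eventually_nhds, hsnd, hc.eventually hs.inv_smooth,
      hinvc.eventually hs.exists_hasD_orbit] with τ h1 h2 h3 h4
    obtain ⟨I', hI'⟩ := h3.exists_hasD
    obtain ⟨P, -, a', ha', hP, hPR, hPI⟩ := h4
    have hw' := (hasD_fst (inv (g • β (t₀ + τ)))).comp_of_eq (hI'.comp_of_eq (hgσ τ) rfl) rfl
    set w' := (ContinuousLinearMap.fst ℝ W ℝ).comp (I'.comp ((dAct E g (β (t₀ + τ))).comp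
      (ContinuousLinearMap.toSpanSingleton ℝ (β' (t₀ + τ)))))
    have h5 := (ha'.comp_of_eq hw' rfl).smul (hσ τ)
    have h6 := (h5.congr (g := fun τ => g • β (t₀ + τ)) (h1.mono fun _ h => h.symm)).unique (hgσ τ)
    have h7 := DFunLike.congr_fun h6 1
    have hpt : a (w τ) • β (t₀ + τ) = g • β (t₀ + τ) := h1.self_of_nhds
    have hP' : P = (dOrb E E' (a (w τ)) (β (t₀ + τ))).comp a' := by rw [hP, h2]
    have hPR' : ∀ w, P w ∈ orbTan E E' G (g • β (t₀ + τ)) := by rw [← hpt]; rwa [h2] at hPR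
    have hPI' : ∀ w, I' (P w) = (w, 0) := by
      refine hPI I' ?_
      rw [h2]
      change HasD inv I' (a (w τ) • β (t₀ + τ))
      rwa [hpt]
    have h8 : P (w' 1) + dAct E (a (w τ)) (β (t₀ + τ)) (β' (t₀ + τ)) =
        dAct E g (β (t₀ + τ)) (β' (t₀ + τ)) := by
      rw [hP']
      simpa using h7
    have h9 := h.dAct_perp g (t₀ + τ) (hPR' (w' 1))
    have h10 : riem (g • β (t₀ + τ)) (dAct E (a (w τ)) (β (t₀ + τ)) (β' (t₀ + τ)))
        (P (w' 1)) = 0 := by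
      have := h.dAct_perp (a (w τ)) (t₀ + τ) (v := P (w' 1)) (by rw [hpt]; exact hPR' _)
      rwa [hpt] at this
    rw [← h8, riem_add_left, h10, add_zero, riem_self_eq_zero] at h9
    have h11 := hPI' (w' 1)
    rw [h9, map_zero] at h11
    have h12 : w' = 0 := by
      refine ContinuousLinearMap.ext_ring ?_
      exact (congrArg Prod.fst h11).symm
    rw [h12] at hw'
    exact HasD.iff_hasFDerivAt.1 hw'
  obtain ⟨r, hr, hball⟩ := Metric.eventually_nhds_iff_ball.1 (hw.and hinv)
  have hsub : Tendsto (fun t => t - t₀) (𝓝 t₀) (𝓝 0) := by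
    simpa using (continuous_sub_right t₀).tendsto t₀
  filter_upwards [hsub.eventually (Metric.ball_mem_nhds (0 : ℝ) hr)] with t ht
  have h1 := (convex_ball (0 : ℝ) r).norm_image_sub_le_of_norm_hasFDerivWithin_le (f := w)
    (f' := fun _ => (0 : ℝ →L[ℝ] W)) (C := 0) (fun ξ hξ => (hball ξ hξ).1.hasFDerivWithinAt)
    (by simp) (Metric.mem_ball_self hr) ht
  rw [zero_mul, norm_le_zero_iff, sub_eq_zero, hw0] at h1
  have h2 := (hball _ ht).2
  rw [h1, hs.a_zero, one_smul, add_sub_cancel] at h2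
  exact h2.symm

/-- The isotropy groups along the interior of the normal geodesic coincide. -/
lemma smul_eq_of_smul_eq (h : IsNormalLift E E' G f β β' c) {t₀ t₁ : ℝ}
    (ht₀ : t₀ ∈ Ioo (0 : ℝ) 2) (ht₁ : t₁ ∈ Ioo (0 : ℝ) 2) {g : G} (hg : g • β t₀ = β t₀) :
    g • β t₁ = β t₁ := by
  have : ContinuousSMul G M := ContMDiffSMul.continuousSMul (I := 𝓘(ℝ, E')) (I' := 𝓘(ℝ, E)) ∞
  have hβ : Continuous β := continuous_iff_continuousAt.2 fun t => (h.smooth t).continuousAt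
  have hcl : IsClosed {t | g • β t = β t} := isClosed_eq (hβ.const_smul g) hβ
  -- The parameters fixed by g form a closed set, and by `eventually_smul_eq` those in (0,2) are
  -- interior points of it.
  have hsub := (isPreconnected_Ioo (a := (0 : ℝ)) (b := 2)).subset_of_closure_inter_subset
    (u := interior {t | g • β t = β t}) isOpen_interior
    ⟨t₀, ht₀, mem_interior_iff_mem_nhds.2 (h.eventually_smul_eq ht₀ hg)⟩ (by
      rintro t ⟨ht, ht2⟩
      exact mem_interior_iff_mem_nhds.2 (h.eventually_smul_eq ht2
        (closure_minimal interior_subset hcl ht)))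
  exact (interior_subset (hsub ht₁) : t₁ ∈ {t | g • β t = β t})

/-- On the regular part, `f` is smooth and its gradient is proportional to the velocity of the
translates of the normal geodesic. -/
lemma gradient (h : IsNormalLift E E' G f β β' c) {t : ℝ} (ht : t ∈ Ioo (0 : ℝ) 2) (g : G) :
    SmoothAt E ℝ f (g • β t) ∧ ∀ f' : E →L[ℝ] ℝ, HasD f f' (g • β t) → ∀ v,
      f' v * riem (β t) (β' t) (β' t) = riem (g • β t) (dAct E g (β t) (β' t)) v := by
  constructor
  · obtain ⟨W, a, inv, hs, hf⟩ := h.exists_isSliceChart_of_mem_Ioo ht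
    have h1 : SmoothAt E ℝ f (β t) := by
      refine SmoothAt.congr (f := fun x => t + (inv x).2) ?_ hf
      have h2 : SmoothAt (W × ℝ) ℝ (fun q : W × ℝ => t + q.2) (inv (β t)) :=
        SmoothAt.iff_contDiffAt.2 (contDiffAt_const.add contDiffAt_snd)
      exact h2.comp_of_eq hs.inv_smooth.self_of_nhds rfl
    refine SmoothAt.congr (f := fun x => f (g⁻¹ • x)) ?_
      (Eventually.of_forall fun x => (h.map_smul g⁻¹ x).symm)
    exact h1.comp_of_eq (smoothAt_const_smul (E := E) (E' := E') g⁻¹ (g • β t)) (by simp)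
  · intro f' hf' v
    -- The derivative is 1 on the translated velocity and 0 on the orbit directions. These span, and
    -- the metric expression takes proportional values on them.
    have hd1 : f' (dAct E g (β t) (β' t)) = 1 := by
      have h1 := hf'.comp_of_eq ((hasD_dAct (E' := E') g (β t)).comp_of_eq (h.hasD t) rfl) rfl
      have h2 : HasD (fun τ : ℝ => f (g • β τ)) (ContinuousLinearMap.id ℝ ℝ) t := by
        refine (HasD.id (E := ℝ) t).congr ?_
        filter_upwards [Icc_mem_nhds ht.1 ht.2] with τ hτ
        rw [h.map_smul g, h.lift τ hτ]
      simpa using DFunLike.congr_fun (h1.unique h2) 1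
    have hfs : ∀ (k : G) x, f (k • x) = f x := h.map_smul
    have hd0 : ∀ r ∈ orbTan E E' G (g • β t), f' r = 0 := by
      rintro _ ⟨ξ, rfl⟩
      have h1 := hf'.comp_of_eq (hasD_dOrb (E := E) (E' := E') (1 : G) (g • β t)) (one_smul _ _)
      simp only [hfs] at h1
      exact DFunLike.congr_fun (h1.unique (HasD.const _ _)) ξ
    have hv : dAct E g⁻¹ (g • β t) v ∈
        Submodule.span ℝ {β' t} ⊔ orbTan E E' G (β t) := by
      rw [(h.isCompl_velocity ht).sup_eq_top]; trivial
    obtain ⟨_, hy, r, hr, hyr⟩ := Submodule.mem_sup.1 hv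
    obtain ⟨l, rfl⟩ := Submodule.mem_span_singleton.1 hy
    have h3 : v = l • dAct E g (β t) (β' t) + dAct E g (β t) r := by
      have := dAct_inv_apply (E := E) (E' := E') g⁻¹ (g • β t) v
      rw [inv_inv, inv_smul_smul] at this
      rw [← this, ← hyr, map_add, _root_.map_smul]
    have hr' := dAct_mem_orbTan g hr
    rw [h3, map_add, _root_.map_smul, hd1, hd0 _ hr', riem_add_right, riem_smul_right, h.isometric,
      h.dAct_perp g t hr']
    simp

/-- The normal geodesic has constant speed `c`. -/
lemma riem_velocity (h : IsNormalLift E E' G f β β' c) {t : ℝ} (ht : t ∈ Ioo (0 : ℝ) 2) :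
    riem (β t) (β' t) (β' t) = c ^ 2 := by
  have hnn : ∀ t, 0 ≤ riem (β t) (β' t) (β' t) := fun t => riem_self_nonneg _ _
  have hge := h.le_speed t
  suffices hle : Real.sqrt (riem (β t) (β' t) (β' t)) ≤ c by
    rw [← le_antisymm hle hge, Real.sq_sqrt (hnn t)]
  by_contra hlt
  push Not at hlt
  obtain ⟨m, hm1, hm2⟩ := exists_between hlt
  have hm0 : 0 < m := h.c_pos.trans hm1
  have hcont : Continuous fun t => Real.sqrt (riem (β t) (β' t) (β' t)) := by
    have h1 := contDiffOn_riem isOpen_univ (fun t _ => h.smooth t) (fun t _ => h.hasD t) 1 1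
    simp only [ContinuousLinearMap.toSpanSingleton_apply, one_smul] at h1
    exact Real.continuous_sqrt.comp (continuousOn_univ.1 h1.continuousOn)
  have hev : ∀ᶠ x in 𝓝 (β t), f x ∈ Ioo (0 : ℝ) 2 ∧
      m < Real.sqrt (riem (β (f x)) (β' (f x)) (β' (f x))) := by
    have hft := h.lift t (Ioo_subset_Icc_self ht)
    refine (h.continuous.tendsto (β t)).eventually (p := fun y => y ∈ Ioo (0 : ℝ) 2 ∧
      m < Real.sqrt (riem (β y) (β' y) (β' y))) ?_
    rw [hft]
    exact (show ∀ᶠ y in 𝓝 t, y ∈ Ioo (0 : ℝ) 2 from Ioo_mem_nhds ht.1 ht.2).and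
      (hcont.continuousAt.eventually (lt_mem_nhds hm2))
  -- The gradient of f has norm 1/speed. If the speed exceeded m > c near t, f would be
  -- m⁻¹-Lipschitz at `β t`, whereas it changes by |t' - t| over the distance c|t' - t|.
  have hlip := eventually_abs_sub_le_mul_dist (f := f) (p := β t) (L := m⁻¹) (by positivity) (by
    filter_upwards [hev] with x hx
    obtain ⟨g, hg⟩ := h.exists_smul (β (f x)) x (h.lift _ (Ioo_subset_Icc_self hx.1))
    have hgrad := h.gradient hx.1 g
    rw [hg] at hgrad
    refine ⟨hgrad.1, fun f' hf' v => ?_⟩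
    have h1 := hgrad.2 f' hf' v
    set ρ := riem (β (f x)) (β' (f x)) (β' (f x)) with hρ
    have hsq : Real.sqrt ρ ^ 2 = ρ := Real.sq_sqrt (hnn _)
    set u := dAct E g (β (f x)) (β' (f x)) with hu
    have huu : riem x u u = ρ := by
      have := h.isometric g (β (f x)) (β' (f x)) (β' (f x))
      rwa [hg] at this
    have hcs : |riem x u v| ≤ Real.sqrt ρ * Real.sqrt (riem x v v) := by
      have h2 := abs_real_inner_le_norm (F := TangentSpace 𝓘(ℝ, E) x) u v
      have h3 : ∀ w : E, @norm (TangentSpace 𝓘(ℝ, E) x) _ w = Real.sqrt (riem x w w) := fun w =>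
        norm_eq_sqrt_real_inner (F := TangentSpace 𝓘(ℝ, E) x) w
      rw [h3, h3, huu] at h2
      exact h2
    rw [← h1, abs_mul, abs_of_nonneg (hnn _)] at hcs
    have hpos : 0 < Real.sqrt ρ := hm0.trans hx.2
    have h4 : |f' v| * Real.sqrt ρ ≤ Real.sqrt (riem x v v) := by
      refine le_of_mul_le_mul_right ?_ hpos
      calc |f' v| * Real.sqrt ρ * Real.sqrt ρ = |f' v| * ρ := by rw [mul_assoc, ← sq, hsq]
        _ ≤ Real.sqrt ρ * Real.sqrt (riem x v v) := hcs
        _ = _ := mul_comm _ _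
    rw [inv_mul_eq_div, le_div_iff₀ hm0]
    exact (mul_le_mul_of_nonneg_left hx.2.le (abs_nonneg _)).trans h4)
  have hβ : Tendsto β (𝓝 t) (𝓝 (β t)) := (h.smooth t).continuousAt
  have h5 : ∀ᶠ t' in 𝓝[≠] t, False := by
    filter_upwards [(hβ.eventually hlip).filter_mono nhdsWithin_le_nhds,
      (h.dist_eq t).filter_mono nhdsWithin_le_nhds, self_mem_nhdsWithin,
      (show ∀ᶠ t' in 𝓝 t, t' ∈ Icc (0 : ℝ) 2 from Icc_mem_nhds ht.1 ht.2).filter_mono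
        nhdsWithin_le_nhds] with t' h1 h2 h3 h4
    rw [h.lift t' h4, h.lift t (Ioo_subset_Icc_self ht), dist_comm, h2, inv_mul_eq_div,
      le_div_iff₀ hm0, abs_sub_comm t t'] at h1
    have : 0 < |t' - t| := abs_pos.2 (sub_ne_zero.2 h3)
    nlinarith
  exact h5.exists.choose_spec

end IsNormalLift

end NormalLiftRegular

/-! ### Geodesics in Hamiltonian form and the exponential map in coordinates. -/

section Exponential

open Filter Topology Set

set_option maxSynthPendingDepth 3

variable {E : Type*} [NormedAddCommGroup E] [NormedSpace ℝ E]

/-- The derivative in the base point of the kinetic energy of the metric `g`. -/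
noncomputable def kinDeriv (g : E → E →L[ℝ] E →L[ℝ] ℝ) (x u : E) : E →L[ℝ] ℝ :=
  (1 / 2 : ℝ) • (ContinuousLinearMap.apply ℝ ℝ u).comp
    ((ContinuousLinearMap.apply ℝ (E →L[ℝ] ℝ) u).comp (fderiv ℝ g x))

lemma kinDeriv_apply (g : E → E →L[ℝ] E →L[ℝ] ℝ) (x u w : E) :
    kinDeriv g x u w = 1 / 2 * fderiv ℝ g x w u u := rfl

lemma kinDeriv_smul (g : E → E →L[ℝ] E →L[ℝ] ℝ) (x u : E) (l : ℝ) :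
    kinDeriv g x (l • u) = (l * l) • kinDeriv g x u := by
  ext w
  simp [kinDeriv_apply]
  ring

/-- The Hamiltonian vector field of the metric `g`, on pairs of a position and a momentum. -/
noncomputable def hamVF (g : E → E →L[ℝ] E →L[ℝ] ℝ) (z : E × (E →L[ℝ] ℝ)) : E × (E →L[ℝ] ℝ) :=
  ((g z.1).inverse z.2, kinDeriv g z.1 ((g z.1).inverse z.2))

/-- Quadratic homogeneity of the energy: scaling the momentum amounts to rescaling time, so a flow
known for one time ε and small momenta yields the exponential map. -/
lemma hamVF_smul (g : E → E →L[ℝ] E →L[ℝ] ℝ) (x : E) (μ : E →L[ℝ] ℝ) (l : ℝ) :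
    hamVF g (x, l • μ) = (l • (hamVF g (x, μ)).1, (l * l) • (hamVF g (x, μ)).2) := by
  simp only [hamVF, map_smul, kinDeriv_smul]

lemma hasDerivAt_scale_hamVF {g : E → E →L[ℝ] E →L[ℝ] ℝ} {z : ℝ → E × (E →L[ℝ] ℝ)} {l t : ℝ}
    (hz : HasDerivAt z (hamVF g (z (l * t))) (l * t)) :
    HasDerivAt (fun t => ((z (l * t)).1, l • (z (l * t)).2))
      (hamVF g ((z (l * t)).1, l • (z (l * t)).2)) t := by
  have h1 : HasDerivAt (fun t : ℝ => l * t) l t := by simpa using (hasDerivAt_id t).const_mul l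
  have h2 := hz.scomp t h1
  have h3 : HasDerivAt (fun t => (z (l * t)).1) (l • (hamVF g (z (l * t))).1) t :=
    (ContinuousLinearMap.fst ℝ E (E →L[ℝ] ℝ)).hasFDerivAt.comp_hasDerivAt t h2
  have h4 : HasDerivAt (fun t => (z (l * t)).2) (l • (hamVF g (z (l * t))).2) t :=
    (ContinuousLinearMap.snd ℝ E (E →L[ℝ] ℝ)).hasFDerivAt.comp_hasDerivAt t h2
  rw [hamVF_smul, mul_smul]
  exact h3.prodMk (h4.const_smul l)

variable [FiniteDimensional ℝ E]

lemma exists_equiv_of_injective {A : E →L[ℝ] E →L[ℝ] ℝ} (hA : Function.Injective A) :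
    ∃ e : E ≃L[ℝ] (E →L[ℝ] ℝ), (e : E →L[ℝ] E →L[ℝ] ℝ) = A := by
  have hfr : Module.finrank ℝ E = Module.finrank ℝ (E →L[ℝ] ℝ) := by
    rw [← (LinearMap.toContinuousLinearMap (𝕜 := ℝ) (E := E) (F' := ℝ)).finrank_eq]
    exact (Subspace.dual_finrank_eq (K := ℝ) (V := E)).symm
  refine ⟨(LinearEquiv.ofInjectiveOfFinrankEq A.toLinearMap hA hfr).toContinuousLinearEquiv, ?_⟩
  ext
  rfl

lemma inverse_apply_of_injective {A : E →L[ℝ] E →L[ℝ] ℝ} (hA : Function.Injective A) (v : E) :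
    A.inverse (A v) = v := by
  obtain ⟨e, rfl⟩ := exists_equiv_of_injective hA
  simp

lemma hamVF_apply {g : E → E →L[ℝ] E →L[ℝ] ℝ} {x : E} (hg : Function.Injective (g x)) (u : E) :
    hamVF g (x, g x u) = (u, kinDeriv g x u) := by
  simp only [hamVF, inverse_apply_of_injective hg]

lemma contDiffOn_hamVF {g : E → E →L[ℝ] E →L[ℝ] ℝ} {O : Set E} (hO : IsOpen O)
    (hg : ContDiffOn ℝ ∞ g O) (hinj : ∀ x ∈ O, Function.Injective (g x)) :
    ContDiffOn ℝ ∞ (hamVF g) (O ×ˢ univ) := by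
  have : CompleteSpace E := FiniteDimensional.complete ℝ E
  have h1 : ContDiffOn ℝ ∞ (fun z : E × (E →L[ℝ] ℝ) => (g z.1).inverse) (O ×ˢ univ) := by
    intro z hz
    obtain ⟨e, he⟩ := exists_equiv_of_injective (hinj z.1 hz.1)
    have h2 := contDiffAt_map_inverse (𝕜 := ℝ) (n := ∞) e
    rw [he] at h2
    have h3 : ContDiffAt ℝ ∞ (fun z : E × (E →L[ℝ] ℝ) => g z.1) z :=
      (hg.contDiffAt (hO.mem_nhds hz.1)).comp z contDiffAt_fst
    exact (ContDiffAt.comp z h2 h3).contDiffWithinAt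
  have h4 : ContDiffOn ℝ ∞ (fun z : E × (E →L[ℝ] ℝ) => (g z.1).inverse z.2) (O ×ˢ univ) :=
    h1.clm_apply contDiffOn_snd
  refine h4.prodMk ?_
  rw [contDiffOn_clm_apply]
  intro w
  simp only [kinDeriv_apply]
  have h5 : ContDiffOn ℝ ∞ (fun z : E × (E →L[ℝ] ℝ) => fderiv ℝ g z.1) (O ×ˢ univ) :=
    (hg.fderiv_of_isOpen hO (m := ∞) (by simp)).comp contDiffOn_fst fun z hz => hz.1
  exact contDiffOn_const.mul (((h5.clm_apply contDiffOn_const).clm_apply h4).clm_apply h4)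

/-- The exponential map at the origin of a Riemannian metric `g` on a vector space. -/
theorem exists_exponential {O : Set E} (hO : IsOpen O) (h0 : (0 : E) ∈ O)
    {g : E → E →L[ℝ] E →L[ℝ] ℝ} (hg : ContDiffOn ℝ ∞ g O)
    (hinj : ∀ x ∈ O, Function.Injective (g x)) :
    ∃ ex : E → E, ex 0 = 0 ∧ (∀ᶠ v in 𝓝 0, ContDiffAt ℝ ∞ ex v) ∧
      HasFDerivAt ex (ContinuousLinearMap.id ℝ E) 0 ∧
      ∃ ρ > 0, ∀ (z : ℝ → E × (E →L[ℝ] ℝ)) (τ : ℝ), 0 ≤ τ → (z 0).1 = 0 →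
        (∀ t ∈ Icc 0 τ, ‖(z t).1‖ < ρ ∧ τ * ‖(z t).2‖ < ρ ∧ HasDerivAt z (hamVF g (z t)) t) →
        ∀ v, (z 0).2 = g 0 v → ex (τ • v) = (z τ).1 := by
  obtain ⟨ε, hε, r, hr, Φ, hΦ⟩ := exists_smooth_flow (hO.prod isOpen_univ)
    (z₀ := ((0 : E), (0 : E →L[ℝ] ℝ))) (mk_mem_prod h0 (mem_univ _)) (contDiffOn_hamVF hO hg hinj)
  obtain ⟨r', hr', hball⟩ := Metric.eventually_nhds_iff_ball.1 hΦ
  have hmemball : ∀ {R : ℝ} (z : E × (E →L[ℝ] ℝ)),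
      z ∈ Metric.ball ((0 : E), (0 : E →L[ℝ] ℝ)) R ↔ ‖z.1‖ < R ∧ ‖z.2‖ < R := by
    intro R z
    rw [Metric.mem_ball, Prod.dist_eq, max_lt_iff, dist_zero_right, dist_zero_right]
  -- The time-one map on covectors, realised as the time-ε map with the momentum divided by ε.
  let ex₁ : (E →L[ℝ] ℝ) → E := fun μ => (Φ (0, ε⁻¹ • μ) ε).1
  have hcore : ∀ (z : ℝ → E × (E →L[ℝ] ℝ)) (τ : ℝ), 0 ≤ τ → (z 0).1 = 0 →
      τ * ‖(z 0).2‖ < ε * r' → (∀ t ∈ Icc 0 τ, ‖(z t).1‖ < r ∧ τ * ‖(z t).2‖ < ε * r ∧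
        HasDerivAt z (hamVF g (z t)) t) → ex₁ (τ • (z 0).2) = (z τ).1 := by
    intro z τ hτ hz0 hzr' hz
    let l := τ / ε
    have hl : 0 ≤ l := div_nonneg hτ hε.le
    have hlε : l * ε = τ := div_mul_cancel₀ _ hε.ne'
    have hnorm : ∀ (μ : E →L[ℝ] ℝ) (R : ℝ), τ * ‖μ‖ < ε * R → ‖l • μ‖ < R := by
      intro μ R h
      rw [norm_smul, Real.norm_of_nonneg hl, div_mul_eq_mul_div, div_lt_iff₀ hε, mul_comm R]
      exact h
    have hmem : ((0 : E), l • (z 0).2) ∈ Metric.ball ((0 : E), (0 : E →L[ℝ] ℝ)) r' := by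
      rw [hmemball]
      exact ⟨by simpa using hr', hnorm _ _ hzr'⟩
    have h1 := (hball _ hmem).2.2.2 (fun t => ((z (l * t)).1, l • (z (l * t)).2))
      (by simp [hz0]) (by
        intro t ht
        have h2 := hz (l * t) ⟨mul_nonneg hl ht.1, by
          rw [← hlε]; exact mul_le_mul_of_nonneg_left ht.2 hl⟩
        exact ⟨(hmemball _).2 ⟨h2.1, hnorm _ _ h2.2.1⟩, hasDerivAt_scale_hamVF h2.2.2⟩)
    have h2 := congrArg Prod.fst h1
    simp only [hlε] at h2
    rw [h2]
    simp only [ex₁, smul_smul]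
    rw [inv_mul_eq_div]
  have hin : ContDiff ℝ ∞ fun μ : E →L[ℝ] ℝ => ((0 : E), ε⁻¹ • μ) :=
    contDiff_const.prodMk (contDiff_id.const_smul ε⁻¹)
  have hin0 : Tendsto (fun μ : E →L[ℝ] ℝ => ((0 : E), ε⁻¹ • μ)) (𝓝 0) (𝓝 (0, 0)) := by
    simpa using hin.continuous.tendsto 0
  have hsm : ∀ᶠ μ in 𝓝 0, ContDiffAt ℝ ∞ ex₁ μ := by
    filter_upwards [hin0.eventually hΦ] with μ hμ
    exact (ContDiffAt.comp (g := fun z => Φ z ε) μ hμ.1 hin.contDiffAt).fst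
  obtain ⟨A, hA⟩ : ∃ A, HasFDerivAt ex₁ A 0 :=
    ⟨_, (hsm.self_of_nhds.differentiableAt (by simp)).hasFDerivAt⟩
  -- Along a ray τμ with μ small, ex₁ traces the geodesic with initial momentum μ, whose initial
  -- velocity is g(0)⁻¹μ; linearity removes the smallness.
  have hAeq : ∀ μ, A μ = (g 0).inverse μ := by
    have hsmall : ∀ μ : E →L[ℝ] ℝ, ‖μ‖ < r' → A μ = (g 0).inverse μ := by
      intro μ hμ
      have hb := hball (0, μ) ((hmemball _).2 ⟨by simpa using hr', hμ⟩)
      have hΦ0 : Φ (0, μ) 0 = (0, μ) := hb.2.1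
      have h1 : ∀ τ ∈ Icc 0 ε, ex₁ (τ • μ) = (Φ (0, μ) τ).1 := by
        intro τ hτ
        have h2 := hcore (Φ (0, μ)) τ hτ.1 (by rw [hΦ0]) (by
          rw [hΦ0]
          calc τ * ‖μ‖ ≤ ε * ‖μ‖ := mul_le_mul_of_nonneg_right hτ.2 (norm_nonneg _)
            _ < ε * r' := mul_lt_mul_of_pos_left hμ hε) (by
          intro t ht
          have h3 := hb.2.2.1 t ⟨ht.1, ht.2.trans hτ.2⟩
          have h4 := (hmemball _).1 h3.1
          refine ⟨h4.1, ?_, h3.2⟩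
          calc τ * ‖(Φ (0, μ) t).2‖ ≤ ε * ‖(Φ (0, μ) t).2‖ :=
                mul_le_mul_of_nonneg_right hτ.2 (norm_nonneg _)
            _ < ε * r := mul_lt_mul_of_pos_left h4.2 hε)
        rw [hΦ0] at h2
        exact h2
      have h5 : HasDerivAt (fun τ => (Φ (0, μ) τ).1) ((g 0).inverse μ) 0 := by
        have h6 := (hb.2.2.1 0 ⟨le_rfl, hε.le⟩).2
        have h7 := (ContinuousLinearMap.fst ℝ E (E →L[ℝ] ℝ)).hasFDerivAt.comp_hasDerivAt 0 h6
        rw [hΦ0] at h7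
        exact h7
      have h8 : HasDerivAt (fun τ : ℝ => ex₁ (τ • μ)) (A μ) 0 := by
        have h9 : HasDerivAt (fun τ : ℝ => τ • μ) μ 0 := by
          simpa using (hasDerivAt_id (0 : ℝ)).smul_const μ
        exact HasFDerivAt.comp_hasDerivAt (0 : ℝ) (by rwa [zero_smul]) h9
      have h10 : HasDerivWithinAt (fun τ : ℝ => ex₁ (τ • μ)) ((g 0).inverse μ) (Icc 0 ε) 0 :=
        h5.hasDerivWithinAt.congr h1 (h1 0 ⟨le_rfl, hε.le⟩)
      exact (uniqueDiffOn_Icc hε 0 ⟨le_rfl, hε.le⟩).eq_deriv _ h8.hasDerivWithinAt h10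
    intro μ
    have hpos : 0 < r' / (1 + ‖μ‖) := by positivity
    have h1 := hsmall ((r' / (1 + ‖μ‖)) • μ) (by
      rw [norm_smul, Real.norm_of_nonneg hpos.le, div_mul_eq_mul_div, div_lt_iff₀ (by positivity)]
      nlinarith)
    rw [map_smul, map_smul] at h1
    exact smul_right_injective _ hpos.ne' h1
  have hg0 : Tendsto (g 0) (𝓝 0) (𝓝 0) := by simpa using (g 0).continuous.tendsto 0
  -- The radius r confines positions and εr confines τ times the momenta, so that uniqueness of the
  -- flow applies; εr' keeps the initial data in the domain of the flow.
  refine ⟨fun v => ex₁ (g 0 v), ?_, ?_, ?_, min r (min (ε * r) (ε * r')),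
    lt_min hr (lt_min (by positivity) (by positivity)), ?_⟩
  · have h1 := hcore (fun _ => 0) 0 le_rfl rfl (by simp [hε, hr']) (by
      intro t ht
      refine ⟨by simpa using hr, by simp [hε, hr], ?_⟩
      have : hamVF g (0 : E × (E →L[ℝ] ℝ)) = 0 := by
        have := hamVF_smul g 0 0 0
        rw [zero_smul, zero_smul, mul_zero, zero_smul] at this
        exact this
      rw [this]
      exact hasDerivAt_const _ _)
    simpa using h1
  · filter_upwards [hg0.eventually hsm] with v hv
    exact ContDiffAt.comp (g := ex₁) v hv (g 0).contDiff.contDiffAt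
  · have h1 : HasFDerivAt (fun v => ex₁ (g 0 v)) (A.comp (g 0)) 0 :=
      HasFDerivAt.comp (g := ex₁) (0 : E) (by rwa [map_zero]) (g 0).hasFDerivAt
    refine h1.congr_fderiv ?_
    ext v
    rw [ContinuousLinearMap.comp_apply, hAeq, inverse_apply_of_injective (hinj 0 h0)]
    rfl
  · intro z τ hτ hz0 hz v hv
    have h1 := hcore z τ hτ hz0
      ((hz 0 ⟨le_rfl, hτ⟩).2.1.trans_le ((min_le_right _ _).trans (min_le_right _ _)))
      (fun t ht => ⟨(hz t ht).1.trans_le (min_le_left _ _),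
        (hz t ht).2.1.trans_le ((min_le_right _ _).trans (min_le_left _ _)), (hz t ht).2.2⟩)
    simp only [← h1, hv, map_smul]

/-- Gradient curves of a solution of the eikonal equation are geodesics. -/
lemma fderiv_fderiv_of_eikonal {g : E → E →L[ℝ] E →L[ℝ] ℝ} {y₀ : E}
    (hg : DifferentiableAt ℝ g y₀) (hsymm : ∀ u w, g y₀ u w = g y₀ w u) {f : E → ℝ}
    (hf : ContDiffAt ℝ ∞ f y₀) {U : E → E} (hU : DifferentiableAt ℝ U y₀) {C : ℝ}
    (hgrad : ∀ᶠ y in 𝓝 y₀, g y (U y) = fderiv ℝ f y) (heik : ∀ᶠ y in 𝓝 y₀, g y (U y) (U y) = C) :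
    fderiv ℝ (fderiv ℝ f) y₀ (U y₀) = kinDeriv g y₀ (U y₀) := by
  ext w
  have hsnd : fderiv ℝ (fderiv ℝ f) y₀ (U y₀) w = fderiv ℝ (fderiv ℝ f) y₀ w (U y₀) :=
    (hf.isSymmSndFDerivAt (by
      rw [minSmoothness_of_isRCLikeNormedField]
      exact WithTop.coe_le_coe.2 (le_top : (2 : ℕ∞) ≤ ⊤))).eq _ _
  have h1 := hg.hasFDerivAt.clm_apply hU.hasFDerivAt
  have h2 := h1.clm_apply hU.hasFDerivAt
  have h3 : HasFDerivAt (fun y => g y (U y) (U y)) (0 : E →L[ℝ] ℝ) y₀ :=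
    (hasFDerivAt_const C y₀).congr_of_eventuallyEq heik
  have h4 := DFunLike.congr_fun (h2.unique h3) w
  have h5 : HasFDerivAt (fun y => g y (U y)) (fderiv ℝ (fderiv ℝ f) y₀) y₀ := by
    have h6 : ContDiffAt ℝ ∞ (fderiv ℝ f) y₀ := hf.fderiv_right (by simp)
    exact (h6.differentiableAt (by simp)).hasFDerivAt.congr_of_eventuallyEq hgrad
  -- The derivatives in direction w of g U = df, evaluated at U, and of g(U,U) = C both contain g(DU
  -- w, U). Eliminating it leaves D²f(w,U) = ½ Dg(w)(U,U).
  have h7 := DFunLike.congr_fun (DFunLike.congr_fun (h1.unique h5) w) (U y₀)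
  rw [hsnd, kinDeriv_apply]
  simp at h4 h7
  rw [hsymm (U y₀)] at h4
  linarith

end Exponential

/-! ### The exponential map at the endpoint of the normal geodesic. -/

section NormalExponential

open Filter Topology Set

set_option maxSynthPendingDepth 3

section Pullback

variable {E : Type*} [NormedAddCommGroup E] [NormedSpace ℝ E] [FiniteDimensional ℝ E]
  {M : Type*} [TopologicalSpace M] [ChartedSpace E M]
  [RiemannianBundle (fun x : M => TangentSpace 𝓘(ℝ, E) x)]

lemma riem_sq_le (x : M) (u v : E) : riem x u v ^ 2 ≤ riem x u u * riem x v v := by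
  have h := real_inner_mul_inner_self_le (F := TangentSpace 𝓘(ℝ, E) x) u v
  rw [sq]
  exact h

/-- The Riemannian metric at `x` as a continuous bilinear form on the model space. -/
noncomputable def riemCLM (x : M) : E →L[ℝ] E →L[ℝ] ℝ :=
  LinearMap.toContinuousLinearMap ((LinearMap.toContinuousLinearMap (𝕜 := ℝ) (E := E)
    (F' := ℝ)).toLinearMap ∘ₗ LinearMap.mk₂ ℝ (riem x) (riem_add_left x) (riem_smul_left x)
      (riem_add_right x) (riem_smul_right x))

/-- The pullback of the Riemannian metric at `x` by a linear map. -/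
noncomputable def pullMetric (x : M) (D : E →L[ℝ] E) : E →L[ℝ] E →L[ℝ] ℝ :=
  (riemCLM x).bilinearComp D D

lemma pullMetric_apply (x : M) (D : E →L[ℝ] E) (u v : E) :
    pullMetric x D u v = riem x (D u) (D v) := rfl

lemma pullMetric_injective (x : M) {D : E →L[ℝ] E} (hD : Function.Injective D) :
    Function.Injective (pullMetric x D) := by
  rw [injective_iff_map_eq_zero]
  intro u hu
  have h1 : riem x (D u) (D u) = 0 := by rw [← pullMetric_apply, hu]; rfl
  exact (map_eq_zero_iff D hD).1 ((riem_self_eq_zero x).1 h1)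

lemma contDiffOn_pullMetric [IsManifold 𝓘(ℝ, E) ∞ M]
    [hr : IsContMDiffRiemannianBundle 𝓘(ℝ, E) ∞ E (fun x : M => TangentSpace 𝓘(ℝ, E) x)]
    {ψ : E → M} {O : Set E} (hO : IsOpen O) (hψ : ∀ x ∈ O, SmoothAt E E ψ x)
    {D : E → E →L[ℝ] E} (hD : ∀ x ∈ O, HasD ψ (D x) x) :
    ContDiffOn ℝ ∞ (fun x => pullMetric (ψ x) (D x)) O := by
  rw [contDiffOn_clm_apply]
  intro v
  rw [contDiffOn_clm_apply]
  intro w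
  exact contDiffOn_riem hO hψ hD v w

end Pullback

/-- The geodesic equation is derived from f, whose smoothness is established only over the interior;
continuity carries the equation to the endpoint. -/
lemma deriv_eq_at_zero_of_forall_pos {F : Type*} [NormedAddCommGroup F] [NormedSpace ℝ F]
    {P R : ℝ → F} {δ : ℝ} (hδ : 0 < δ) (hP : ContDiffOn ℝ ∞ P (Ioo (-δ) δ))
    (hR : ContinuousAt R 0) (h : ∀ t ∈ Ioo 0 δ, HasDerivAt P (R t) t) :
    ∀ t ∈ Ico 0 δ, HasDerivAt P (R t) t := by
  intro t ht
  rcases ht.1.eq_or_lt with rfl | h0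
  · have h0 : (0 : ℝ) ∈ Ioo (-δ) δ := ⟨by linarith, hδ⟩
    have hmem : Ioo (-δ) δ ∈ 𝓝 (0 : ℝ) := isOpen_Ioo.mem_nhds h0
    have hc : ContinuousAt (deriv P) 0 :=
      ((hP.deriv_of_isOpen (m := ∞) isOpen_Ioo (by simp)).continuousOn).continuousAt hmem
    have heq : deriv P =ᶠ[𝓝[>] 0] R := by
      filter_upwards [Ioo_mem_nhdsGT hδ] with t ht using (h t ht).deriv
    have h1 : Tendsto R (𝓝[>] 0) (𝓝 (deriv P 0)) :=
      (hc.tendsto.mono_left nhdsWithin_le_nhds).congr' heq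
    have h2 := tendsto_nhds_unique h1 (hR.tendsto.mono_left nhdsWithin_le_nhds)
    rw [← h2]
    exact ((hP.contDiffAt hmem).differentiableAt (by simp)).hasDerivAt
  · exact h t ⟨h0, ht.2⟩

namespace IsNormalLift

variable {E E' : Type*} [NormedAddCommGroup E] [NormedSpace ℝ E] [FiniteDimensional ℝ E]
  [NormedAddCommGroup E'] [NormedSpace ℝ E'] [FiniteDimensional ℝ E']
  {M : Type*} [MetricSpace M] [ChartedSpace E M] [IsManifold 𝓘(ℝ, E) ∞ M]
  [RiemannianBundle (fun x : M => TangentSpace 𝓘(ℝ, E) x)]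
  [hr : IsContMDiffRiemannianBundle 𝓘(ℝ, E) ∞ E (fun x : M => TangentSpace 𝓘(ℝ, E) x)]
  [hM : IsRiemannianManifold 𝓘(ℝ, E) M]
  {G : Type*} [Group G] [TopologicalSpace G] [ChartedSpace E' G] [LieGroup 𝓘(ℝ, E') ∞ G]
  [CompactSpace G]
  [MulAction G M] [hsm : ContMDiffSMul 𝓘(ℝ, E') 𝓘(ℝ, E) ∞ G M]
  {f : M → ℝ} {β : ℝ → M} {β' : ℝ → E} {c : ℝ}

/-- In a local parametrization `ψ`, the translates of the normal geodesic solve the geodesic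
equation on the regular part. -/
lemma hasDerivAt_momentum (h : IsNormalLift E E' G f β β' c) {ψ : E → M} {O : Set E}
    (hO : IsOpen O) (hψ : ∀ x ∈ O, SmoothAt E E ψ x) {D : E → E →L[ℝ] E}
    (hD : ∀ x ∈ O, HasD ψ (D x) x) (hinj : ∀ x ∈ O, Function.Injective (D x))
    (k : G) {x : ℝ → E} {u : ℝ → E} {t₀ : ℝ} (ht₀ : t₀ ∈ Ioo (0 : ℝ) 2)
    (hx : ∀ᶠ t in 𝓝 t₀, x t ∈ O ∧ ψ (x t) = k • β t ∧
      D (x t) (u t) = dAct E k (β t) (β' t)) (hu : HasDerivAt x (u t₀) t₀) :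
    HasDerivAt (fun t => pullMetric (ψ (x t)) (D (x t)) (u t))
      (kinDeriv (fun y => pullMetric (ψ y) (D y)) (x t₀) (u t₀)) t₀ := by
  set g : E → E →L[ℝ] E →L[ℝ] ℝ := fun y => pullMetric (ψ y) (D y) with hgdef
  have hg : ContDiffOn ℝ ∞ g O := contDiffOn_pullMetric hO hψ hD
  have hginj : ∀ y ∈ O, Function.Injective (g y) := fun y hy => pullMetric_injective _ (hinj y hy)
  -- The gradient of f is the translated velocity divided by c². The factor c² makes the gradient of
  -- F the velocity itself.
  let F : E → ℝ := fun y => c ^ 2 * f (ψ y)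
  obtain ⟨hx0O, hx0, hx0u⟩ := hx.self_of_nhds
  have hψc : ContinuousAt ψ (x t₀) := (hψ _ hx0O).continuousAt
  have hev : ∀ᶠ y in 𝓝 (x t₀), y ∈ O ∧ f (ψ y) ∈ Ioo (0 : ℝ) 2 := by
    refine (show ∀ᶠ y in 𝓝 (x t₀), y ∈ O from hO.mem_nhds hx0O).and
      ((h.continuous.continuousAt.comp hψc).eventually (p := fun r => r ∈ Ioo (0 : ℝ) 2) ?_)
    rw [Function.comp_apply, hx0, h.map_smul, h.lift _ (Ioo_subset_Icc_self ht₀)]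
    exact Ioo_mem_nhds ht₀.1 ht₀.2
  have hF : ∀ y, y ∈ O ∧ f (ψ y) ∈ Ioo (0 : ℝ) 2 → ContDiffAt ℝ ∞ F y ∧
      ∃ v, g y v = fderiv ℝ F y ∧ g y v v = c ^ 2 ∧
        ∀ (k : G) (t : ℝ) (w : E), t ∈ Icc 0 2 → ψ y = k • β t → D y w = dAct E k (β t) (β' t) →
          g y w = fderiv ℝ F y := by
    rintro y ⟨hyO, hy⟩
    have key : ∀ (k : G) (t : ℝ) (w : E), t ∈ Icc 0 2 → ψ y = k • β t →
        D y w = dAct E k (β t) (β' t) → ContDiffAt ℝ ∞ F y ∧ g y w = fderiv ℝ F y ∧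
          g y w w = c ^ 2 := by
      intro k t w ht hk hw
      have hft : f (ψ y) = t := by rw [hk, h.map_smul, h.lift _ ht]
      rw [hft] at hy
      obtain ⟨hs, hgrad⟩ := h.gradient hy k
      rw [← hk] at hs hgrad
      have hfψ : SmoothAt E ℝ (fun y => f (ψ y)) y := hs.comp_of_eq (hψ y hyO) rfl
      have hFs : ContDiffAt ℝ ∞ F y := contDiffAt_const.mul (SmoothAt.iff_contDiffAt.1 hfψ)
      obtain ⟨f', hf'⟩ := hs.exists_hasD
      have h1 := (HasD.iff_hasFDerivAt.1 (hf'.comp_of_eq (hD y hyO) rfl)).const_mul (c ^ 2)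
      refine ⟨hFs, ?_, ?_⟩
      · rw [HasFDerivAt.fderiv h1]
        ext v
        have h2 := hgrad f' hf' (D y v)
        rw [h.riem_velocity hy, ← hw] at h2
        rw [hgdef, pullMetric_apply, ← h2]
        simp [mul_comm]
      · rw [hgdef, pullMetric_apply, hw, hk, h.isometric, h.riem_velocity hy]
    obtain ⟨k, hk⟩ := h.exists_smul (β (f (ψ y))) (ψ y) (h.lift _ (Ioo_subset_Icc_self hy))
    obtain ⟨v, hv⟩ := LinearMap.injective_iff_surjective.1 (hinj y hyO)
      (dAct E k (β (f (ψ y))) (β' (f (ψ y))))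
    obtain ⟨h1, h2, h3⟩ := key k _ v (Ioo_subset_Icc_self hy) hk.symm hv
    exact ⟨h1, v, h2, h3, fun k t w ht hk hw => (key k t w ht hk hw).2.1⟩
  have h0 := hev.self_of_nhds
  have hFs := (hF _ h0).1
  let U : E → E := fun y => (hamVF g (y, fderiv ℝ F y)).1
  have hUeq : ∀ y, y ∈ O ∧ f (ψ y) ∈ Ioo (0 : ℝ) 2 → ∀ v, g y v = fderiv ℝ F y → U y = v := by
    intro y hy v hv
    change (g y).inverse (fderiv ℝ F y) = v
    rw [← hv]
    exact inverse_apply_of_injective (hginj y hy.1) v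
  have hUd : DifferentiableAt ℝ U (x t₀) := by
    have h1 : ContDiffAt ℝ ∞ (fun y => (y, fderiv ℝ F y)) (x t₀) :=
      contDiffAt_id.prodMk (hFs.fderiv_right (by simp))
    have h2 : ContDiffAt ℝ ∞ (hamVF g) (x t₀, fderiv ℝ F (x t₀)) :=
      (contDiffOn_hamVF hO hg hginj).contDiffAt
        ((hO.prod isOpen_univ).mem_nhds (mk_mem_prod h0.1 (mem_univ _)))
    exact ((ContDiffAt.comp (g := hamVF g) (x t₀) h2 h1).fst).differentiableAt (by simp)
  have hfd := fderiv_fderiv_of_eikonal (g := g) (f := F) (U := U) (C := c ^ 2)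
    ((hg.contDiffAt (hO.mem_nhds h0.1)).differentiableAt (by simp))
    (fun v w => riem_comm _ _ _) hFs hUd
    (hev.mono fun y hy => by
      obtain ⟨-, v, h1, -⟩ := hF y hy
      rw [hUeq y hy v h1, h1])
    (hev.mono fun y hy => by
      obtain ⟨-, v, h1, h2, -⟩ := hF y hy
      rw [hUeq y hy v h1, h2])
  have hgF : ∀ᶠ t in 𝓝 t₀, g (x t) (u t) = fderiv ℝ F (x t) := by
    filter_upwards [hx, hu.continuousAt.eventually hev, Icc_mem_nhds ht₀.1 ht₀.2]
      with t ht1 ht2 ht3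
    obtain ⟨-, -, -, -, h1⟩ := hF _ ht2
    exact h1 k t (u t) ht3 ht1.2.1 ht1.2.2
  rw [hUeq _ h0 _ hgF.self_of_nhds] at hfd
  rw [← hfd]
  have h3 : HasFDerivAt (fderiv ℝ F) (fderiv ℝ (fderiv ℝ F) (x t₀)) (x t₀) :=
    ((hFs.fderiv_right (m := ∞) (by simp)).differentiableAt (by simp)).hasFDerivAt
  exact (h3.comp_hasDerivAt t₀ hu).congr_of_eventuallyEq hgF

/-- The exponential map at the endpoint `β 0` of the normal geodesic. -/
theorem exists_exp (h : IsNormalLift E E' G f β β' c) :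
    ∃ σ : E → M, σ 0 = β 0 ∧ (∀ᶠ v in 𝓝 0, SmoothAt E E σ v) ∧
      HasD σ (ContinuousLinearMap.id ℝ E) 0 ∧ ∃ δ > 0, ∀ τ ∈ Icc 0 δ, ∀ k : G, k • β 0 = β 0 →
        σ (τ • dAct E k (β 0) (β' 0)) = k • β τ := by
  have : ContinuousSMul G M := ContMDiffSMul.continuousSMul (I := 𝓘(ℝ, E')) (I' := 𝓘(ℝ, E)) ∞
  obtain ⟨ψ, hψ0, hψs, hψ'⟩ := exists_smooth_param (E := E) (β 0)
  obtain ⟨φ, hφ0, hφs, hψφ, hφψ⟩ := exists_smooth_local_inverse_manifold hψ0 hψs hψ'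
    Function.bijective_id
  have hψc : Tendsto ψ (𝓝 0) (𝓝 (β 0)) := by
    have := hψ'.continuousAt
    rwa [ContinuousAt, hψ0] at this
  have hφc : Tendsto φ (𝓝 (β 0)) (𝓝 0) := by
    have := hφs.self_of_nhds.continuousAt
    rwa [ContinuousAt, hφ0] at this
  obtain ⟨O, hOev, hO, h0O⟩ := eventually_nhds_iff.1
    (hψs.and (hφψ.and (hψc.eventually hφs)))
  let D : E → E →L[ℝ] E := fun v => mfderiv 𝓘(ℝ, E) 𝓘(ℝ, E) ψ v
  have hD : ∀ v ∈ O, HasD ψ (D v) v := fun v hv =>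
    (ContMDiffAt.mdifferentiableAt (hOev v hv).1 (by simp)).hasMFDerivAt
  have hψO : ∀ v ∈ O, SmoothAt E E ψ v := fun v hv => (hOev v hv).1
  have hinj : ∀ v ∈ O, Function.Injective (D v) := by
    intro v hv
    obtain ⟨L, hL⟩ := (hOev v hv).2.2.exists_hasD
    have h1 := hL.comp_of_eq (hD v hv) rfl
    have h2 : HasD (fun v => φ (ψ v)) (ContinuousLinearMap.id ℝ E) v := by
      refine (HasD.id v).congr ?_
      filter_upwards [hO.mem_nhds hv] with w hw using (hOev w hw).2.1
    exact Function.LeftInverse.injective (g := L) fun w => DFunLike.congr_fun (h1.unique h2) w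
  have hD0 : D 0 = ContinuousLinearMap.id ℝ E := (hD 0 h0O).unique hψ'
  let g : E → E →L[ℝ] E →L[ℝ] ℝ := fun y => pullMetric (ψ y) (D y)
  have hg : ContDiffOn ℝ ∞ g O := contDiffOn_pullMetric hO hψO hD
  have hginj : ∀ y ∈ O, Function.Injective (g y) := fun y hy => pullMetric_injective _ (hinj y hy)
  obtain ⟨ex, hex0, hexs, hex', ρ, hρ, hex⟩ := exists_exponential hO h0O hg hginj
  have hexc : Tendsto ex (𝓝 0) (𝓝 0) := by
    have := hex'.continuousAt
    rwa [ContinuousAt, hex0] at this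
  refine ⟨fun v => ψ (ex v), by simp only [hex0, hψ0], ?_, ?_, ?_⟩
  · filter_upwards [hexs, hexc.eventually hψs] with v h1 h2
    exact h2.comp_of_eq (SmoothAt.iff_contDiffAt.2 h1) rfl
  · have := hψ'.comp_of_eq (HasD.iff_hasFDerivAt.2 hex') hex0
    rwa [ContinuousLinearMap.comp_id] at this
  have hgc : ContinuousAt g 0 := (hg.continuousOn).continuousAt (hO.mem_nhds h0O)
  let C := ‖g 0‖ + 1
  have hC : 0 ≤ C := by positivity
  have hQ : ∀ᶠ y in 𝓝 (β 0), SmoothAt E E φ y ∧ ψ (φ y) = y ∧ φ y ∈ O ∧ ‖φ y‖ < ρ ∧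
      ‖g (φ y)‖ < C := by
    have h1 : ∀ᶠ v in 𝓝 (0 : E), v ∈ O ∧ ‖v‖ < ρ ∧ ‖g v‖ < C := by
      refine (show ∀ᶠ v in 𝓝 0, v ∈ O from hO.mem_nhds h0O).and (Eventually.and ?_ ?_)
      · exact continuous_norm.continuousAt.eventually (gt_mem_nhds (by simpa using hρ))
      · exact hgc.norm.eventually (gt_mem_nhds (lt_add_one _))
    exact hφs.and (hψφ.and (hφc.eventually h1))
  have hstab : IsCompact {k : G | k • β 0 = β 0} :=
    (isClosed_eq (by fun_prop) continuous_const).isCompact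
  have hβ : Continuous β := continuous_iff_continuousAt.2 fun t => (h.smooth t).continuousAt
  have hspeed : Continuous fun t => riem (β t) (β' t) (β' t) := by
    have h1 := contDiffOn_riem isOpen_univ (fun t _ => h.smooth t) (fun t _ => h.hasD t) 1 1
    simp only [ContinuousLinearMap.toSpanSingleton_apply, one_smul] at h1
    exact continuousOn_univ.1 h1.continuousOn
  let C' := riem (β 0) (β' 0) (β' 0) + 1
  have hC' : 0 ≤ C' := by have := riem_self_nonneg (β 0) (β' 0); simp only [C']; linarith
  -- Compactness of the isotropy group makes δ independent of k.
  obtain ⟨δ, hδ, hδev⟩ := Metric.eventually_nhds_iff_ball.1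
    (((hβ.tendsto 0).eventually (eventually_forall_smul_mem hstab (fun _ hg => hg) hQ)).and
      (hspeed.continuousAt.eventually (gt_mem_nhds (lt_add_one (riem (β 0) (β' 0) (β' 0))))))
  let δ₁ := min δ 2
  have hδ₁ : 0 < δ₁ := lt_min hδ two_pos
  have hball : ∀ t ∈ Ioo (-δ₁) δ₁, t ∈ Metric.ball (0 : ℝ) δ := by
    intro t ht
    rw [mem_ball_zero_iff, Real.norm_eq_abs]
    exact (abs_lt.2 ht).trans_le (min_le_left _ _)
  -- By Cauchy–Schwarz the momentum norm is at most the square root of the squared speed, bounded by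
  -- C', times the norm of the metric, bounded by C.
  let B := Real.sqrt (C' * C)
  have hB : 0 ≤ B := Real.sqrt_nonneg _
  refine ⟨min (δ₁ / 2) (ρ / (B + 1) / 2), by positivity, fun τ hτ k hk => ?_⟩
  have hτδ : τ < δ₁ := (hτ.2.trans (min_le_left _ _)).trans_lt (by linarith)
  have hτB : τ * B < ρ := by
    have h1 : τ < ρ / (B + 1) := (hτ.2.trans (min_le_right _ _)).trans_lt
      (half_lt_self (by positivity))
    rw [lt_div_iff₀ (by positivity)] at h1
    nlinarith [hτ.1]
  have hk' : ∀ t ∈ Ioo (-δ₁) δ₁, SmoothAt E E φ (k • β t) ∧ ψ (φ (k • β t)) = k • β t ∧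
      φ (k • β t) ∈ O ∧ ‖φ (k • β t)‖ < ρ ∧ ‖g (φ (k • β t))‖ < C := fun t ht =>
    (hδev t (hball t ht)).1 k hk
  let x : ℝ → E := fun t => φ (k • β t)
  have hxs : ContDiffOn ℝ ∞ x (Ioo (-δ₁) δ₁) := by
    intro t ht
    refine (SmoothAt.iff_contDiffAt.1 ?_).contDiffWithinAt
    exact (hk' t ht).1.comp_of_eq
      ((smoothAt_const_smul (E := E) (E' := E') k (β t)).comp_of_eq (h.smooth t) rfl) rfl
  let u : ℝ → E := deriv x
  have hus : ContDiffOn ℝ ∞ u (Ioo (-δ₁) δ₁) := hxs.deriv_of_isOpen isOpen_Ioo (by simp)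
  have hxu : ∀ t ∈ Ioo (-δ₁) δ₁, HasDerivAt x (u t) t := fun t ht =>
    ((hxs.contDiffAt (isOpen_Ioo.mem_nhds ht)).differentiableAt (by simp)).hasDerivAt
  have hDu : ∀ t ∈ Ioo (-δ₁) δ₁, D (x t) (u t) = dAct E k (β t) (β' t) := by
    intro t ht
    have h1 := (hD (x t) (hk' t ht).2.2.1).comp_of_eq
      (HasD.iff_hasFDerivAt.2 (hxu t ht).hasFDerivAt) rfl
    have h2 := (hasD_dAct (E := E) (E' := E') k (β t)).comp_of_eq (h.hasD t) rfl
    have h3 := h2.congr (g := fun t => ψ (x t)) (by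
      filter_upwards [isOpen_Ioo.mem_nhds ht] with r hr using (hk' r hr).2.1)
    simpa using DFunLike.congr_fun (h1.unique h3) 1
  have hgx : ContDiffOn ℝ ∞ (fun t => g (x t)) (Ioo (-δ₁) δ₁) :=
    hg.comp hxs fun t ht => (hk' t ht).2.2.1
  have hder : ∀ t ∈ Ico 0 δ₁, HasDerivAt (fun t => g (x t) (u t)) (kinDeriv g (x t) (u t)) t := by
    have h0 : (0 : ℝ) ∈ Ioo (-δ₁) δ₁ := ⟨by linarith, hδ₁⟩
    refine deriv_eq_at_zero_of_forall_pos hδ₁ (hgx.clm_apply hus) ?_ ?_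
    · have h1 : ContDiffOn ℝ ∞ (fun t => hamVF g (x t, g (x t) (u t))) (Ioo (-δ₁) δ₁) :=
        (contDiffOn_hamVF hO hg hginj).comp (hxs.prodMk (hgx.clm_apply hus))
          fun t ht => mk_mem_prod (hk' t ht).2.2.1 (mem_univ _)
      have h2 := (h1.snd.continuousOn).continuousAt (isOpen_Ioo.mem_nhds h0)
      refine h2.congr ?_
      filter_upwards [isOpen_Ioo.mem_nhds h0] with t ht
      rw [hamVF_apply (hginj _ (hk' t ht).2.2.1)]
    · intro t ht
      have ht' : t ∈ Ioo (-δ₁) δ₁ := ⟨by linarith [ht.1], ht.2⟩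
      refine h.hasDerivAt_momentum hO hψO hD hinj k ⟨ht.1, ht.2.trans_le (min_le_right _ _)⟩ ?_
        (hxu t ht')
      filter_upwards [isOpen_Ioo.mem_nhds ht'] with r hr
      exact ⟨(hk' r hr).2.2.1, (hk' r hr).2.1, hDu r hr⟩
  have hbound : ∀ t ∈ Ioo (-δ₁) δ₁, ‖g (x t) (u t)‖ ≤ B := by
    intro t ht
    refine ContinuousLinearMap.opNorm_le_bound _ hB fun w => ?_
    have h1 := riem_sq_le (ψ (x t)) (D (x t) (u t)) (D (x t) w)
    have h2 : riem (ψ (x t)) (D (x t) (u t)) (D (x t) (u t)) ≤ C' := by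
      rw [hDu t ht, show ψ (x t) = k • β t from (hk' t ht).2.1, h.isometric]
      exact (hδev t (hball t ht)).2.le
    have h3 : riem (ψ (x t)) (D (x t) w) (D (x t) w) ≤ C * ‖w‖ ^ 2 := by
      have h4 : ‖g (x t) w w‖ ≤ ‖g (x t)‖ * ‖w‖ * ‖w‖ := (g (x t)).le_opNorm₂ w w
      calc _ ≤ ‖g (x t) w w‖ := Real.le_norm_self _
        _ ≤ ‖g (x t)‖ * ‖w‖ * ‖w‖ := h4
        _ = ‖g (x t)‖ * ‖w‖ ^ 2 := by ring
        _ ≤ C * ‖w‖ ^ 2 := mul_le_mul_of_nonneg_right (hk' t ht).2.2.2.2.le (by positivity)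
    have h5 : g (x t) (u t) w ^ 2 ≤ C' * (C * ‖w‖ ^ 2) :=
      h1.trans (mul_le_mul h2 h3 (riem_self_nonneg _ _) hC')
    rw [Real.norm_eq_abs]
    refine abs_le_of_sq_le_sq ?_ (by positivity)
    rw [mul_pow, Real.sq_sqrt (by positivity)]
    linarith
  have hx0 : x 0 = 0 := by simp [x, hk, hφ0]
  have hfin := hex (fun t => (x t, g (x t) (u t))) τ hτ.1 hx0 (by
    intro t ht
    have ht' : t ∈ Ioo (-δ₁) δ₁ := ⟨by linarith [ht.1], ht.2.trans_lt hτδ⟩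
    refine ⟨(hk' t ht').2.2.2.1,
      (mul_le_mul_of_nonneg_left (hbound t ht') hτ.1).trans_lt hτB, ?_⟩
    have h1 := (hxu t ht').prodMk (hder t ⟨ht.1, ht.2.trans_lt hτδ⟩)
    rw [← hamVF_apply (hginj _ (hk' t ht').2.2.1)] at h1
    exact h1) (u 0) (by simp only [hx0])
  have h0 : (0 : ℝ) ∈ Ioo (-δ₁) δ₁ := ⟨by linarith, hδ₁⟩
  have hu0 : u 0 = dAct E k (β 0) (β' 0) := by
    rw [← hDu 0 h0, hx0, hD0]; rfl
  simp only [← hu0, hfin]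
  exact (hk' τ ⟨by linarith [hτ.1], hτδ⟩).2.1

end IsNormalLift

end NormalExponential

/-! ### The slice representation in polar form. -/

section PolarSlice

open Filter Topology Set

/-- A slice chart at the endpoint `β 0` of a normal geodesic, in which the translates of the
geodesic are rays. The representation of the isotropy group on the slice is `ρ`. -/
structure IsPolarSlice {W : Type*} [NormedAddCommGroup W] [NormedSpace ℝ W] (E E' : Type*)
    [NormedAddCommGroup E] [NormedSpace ℝ E] [NormedAddCommGroup E'] [NormedSpace ℝ E']
    {M : Type*} [TopologicalSpace M] [ChartedSpace E M]
    {G : Type*} [Group G] [TopologicalSpace G] [ChartedSpace E' G] [MulAction G M]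
    {N : Type*} [NormedAddCommGroup N] [NormedSpace ℝ N]
    (β : ℝ → M) (σ : N → M) (a : W → G) (inv : M → W × N) (ρ : G → N →L[ℝ] N) (ν : N) (δ : ℝ) :
    Prop where
  chart : IsSliceChart E E' (β 0) σ a inv
  orbit_eq : ∀ᶠ x in 𝓝 (β 0), ∀ g : G, g • β 0 = x → (inv x).2 = 0
  rho_one : ρ 1 = 1
  rho_mul : ∀ k l : G, k • β 0 = β 0 → l • β 0 = β 0 → ρ (k * l) = ρ k * ρ l
  norm_rho : ∀ k : G, k • β 0 = β 0 → ∀ u, ‖ρ k u‖ = ‖u‖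
  ne_zero : ν ≠ 0
  delta_pos : 0 < δ
  slice_eq : ∀ τ ∈ Icc 0 δ, ∀ k : G, k • β 0 = β 0 → σ (τ • ρ k ν) = k • β τ

variable {E E' : Type*} [NormedAddCommGroup E] [NormedSpace ℝ E] [FiniteDimensional ℝ E]
  [NormedAddCommGroup E'] [NormedSpace ℝ E'] [FiniteDimensional ℝ E']
  {M : Type*} [MetricSpace M] [ChartedSpace E M] [IsManifold 𝓘(ℝ, E) ∞ M]
  [RiemannianBundle (fun x : M => TangentSpace 𝓘(ℝ, E) x)]
  [hr : IsContMDiffRiemannianBundle 𝓘(ℝ, E) ∞ E (fun x : M => TangentSpace 𝓘(ℝ, E) x)]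
  [hM : IsRiemannianManifold 𝓘(ℝ, E) M]
  {G : Type*} [Group G] [TopologicalSpace G] [ChartedSpace E' G] [LieGroup 𝓘(ℝ, E') ∞ G]
  [CompactSpace G]
  [MulAction G M] [hsm : ContMDiffSMul 𝓘(ℝ, E') 𝓘(ℝ, E) ∞ G M]
  {f : M → ℝ} {β : ℝ → M} {β' : ℝ → E} {c : ℝ}

/-- The slice is the exponential map restricted to the normal space, which J identifies
isometrically with a Euclidean space. ρ is defined on all of G, but it represents the differential
of the action only on the isotropy group, where the normal space is preserved. -/
lemma IsNormalLift.exists_isPolarSlice (h : IsNormalLift E E' G f β β' c) :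
    ∃ (n : ℕ) (W : Submodule ℝ E') (σ : EuclideanSpace ℝ (Fin n) → M) (a : W → G)
      (inv : M → W × EuclideanSpace ℝ (Fin n))
      (ρ : G → EuclideanSpace ℝ (Fin n) →L[ℝ] EuclideanSpace ℝ (Fin n))
      (ν : EuclideanSpace ℝ (Fin n)) (δ : ℝ), IsPolarSlice E E' β σ a inv ρ ν δ := by
  obtain ⟨σ, hσ0, hσ, hσ', δ, hδ, hexp⟩ := h.exists_exp
  obtain ⟨n, J₀, hJ, hcompl, hperp, hrange⟩ :=
    riem_exists_isometry_orthogonal (β 0) (orbTan E E' G (β 0))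
  let J := LinearMap.toContinuousLinearMap J₀
  have hJ0 : ∀ u, J u = J₀ u := fun _ => rfl
  have hJinj : Function.Injective J₀ := by
    rw [injective_iff_map_eq_zero]
    intro u hu
    have := hJ u u
    rwa [hu, (riem_self_eq_zero (β 0)).2 rfl, eq_comm, inner_self_eq_zero] at this
  obtain ⟨Jl₀, hJl⟩ := LinearMap.exists_leftInverse_of_injective J₀ (LinearMap.ker_eq_bot.2 hJinj)
  let Jl := LinearMap.toContinuousLinearMap Jl₀
  have hJlJ : ∀ u, Jl (J u) = u := fun u => DFunLike.congr_fun hJl u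
  have hJJl : ∀ w, (∀ r ∈ orbTan E E' G (β 0), riem (β 0) w r = 0) → J (Jl w) = w := by
    intro w hw
    obtain ⟨u, rfl⟩ := hrange w hw
    exact congrArg J (hJlJ u)
  let ρ : G → EuclideanSpace ℝ (Fin n) →L[ℝ] EuclideanSpace ℝ (Fin n) := fun k =>
    Jl.comp ((dAct E k (β 0)).comp J)
  have hρ : ∀ k : G, k • β 0 = β 0 → ∀ u, J (ρ k u) = dAct E k (β 0) (J u) := by
    intro k hk u
    refine hJJl _ fun r hr => ?_
    have hmap := map_dAct_orbTan (E := E) (E' := E') k (β 0)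
    rw [hk] at hmap
    rw [← hmap] at hr
    obtain ⟨r', hr', rfl⟩ := hr
    have h1 := h.isometric k (β 0) (J u) r'
    rw [hk] at h1
    exact h1.trans (hperp u r' hr')
  have hν : J (Jl (β' 0)) = β' 0 := hJJl _ (h.perp 0)
  have hJc : Tendsto J (𝓝 0) (𝓝 0) := by simpa using J.continuous.tendsto 0
  have hσJ' : HasD (fun u => σ (J u)) J 0 := by
    have := hσ'.comp_of_eq (HasD.iff_hasFDerivAt.2 (J.hasFDerivAt (x := 0))) (map_zero J)
    rwa [ContinuousLinearMap.id_comp] at this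
  have hσJ : ∀ᶠ u in 𝓝 0, SmoothAt (EuclideanSpace ℝ (Fin n)) E (fun u => σ (J u)) u := by
    filter_upwards [hJc.eventually hσ] with u hu
    exact hu.comp_of_eq (SmoothAt.iff_contDiffAt.2 J.contDiff.contDiffAt) rfl
  obtain ⟨W, a, inv, hs, hdim⟩ := exists_isSliceChart E' (σ := fun u => σ (J u))
    (by simpa using hσ0) hσJ hσJ' hJinj hcompl
  refine ⟨n, W, fun u => σ (J u), a, inv, ρ, Jl (β' 0), δ, hs, hs.orbit_eq hdim, ?_, ?_, ?_, ?_, hδ,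
    ?_⟩
  · ext1 u
    simp only [ρ, dAct_one (E := E) (E' := E')]
    exact hJlJ u
  · intro k l hk hl
    ext1 u
    have h1 := hρ l hl u
    simp only [ρ, dAct_mul (E := E) (E' := E'), hl]
    change Jl (dAct E k (β 0) (dAct E l (β 0) (J u))) = Jl (dAct E k (β 0) (J (ρ l u)))
    rw [h1]
  · intro k hk u
    have h1 := h.isometric k (β 0) (J u) (J u)
    rw [hk, ← hρ k hk, hJ0, hJ0, hJ, hJ, real_inner_self_eq_norm_sq,
      real_inner_self_eq_norm_sq] at h1
    exact (pow_left_inj₀ (norm_nonneg _) (norm_nonneg _) two_ne_zero).1 h1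
  · intro h0
    rw [h0, map_zero] at hν
    exact h.velocity_ne_zero 0 hν.symm
  · intro τ hτ k hk
    change σ (J (τ • ρ k (Jl (β' 0)))) = k • β τ
    rw [_root_.map_smul, hρ k hk, hν]
    exact hexp τ hτ k hk

namespace IsPolarSlice

variable {N : Type*} [NormedAddCommGroup N] [InnerProductSpace ℝ N] [FiniteDimensional ℝ N]
  {W : Type*} [NormedAddCommGroup W] [NormedSpace ℝ W] {σ : N → M} {a : W → G}
  {inv : M → W × N} {ρ : G → N →L[ℝ] N} {ν : N} {δ : ℝ}

/-- Near `β 0`, the slice chart is given by polar coordinates. -/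
lemma eventually_exists_mul (P : IsPolarSlice E E' β σ a inv ρ ν δ)
    (h : IsNormalLift E E' G f β β' c) :
    ∀ᶠ y in 𝓝 (β 0), ∀ (g : G) (t : ℝ), t ∈ Icc (0 : ℝ) 2 → y = g • β t →
      t ≤ δ ∧ ∃ k : G, k • β 0 = β 0 ∧ g = a (inv y).1 * k ∧ (inv y).2 = t • ρ k ν := by
  have : IsTopologicalGroup G := topologicalGroup_of_lieGroup 𝓘(ℝ, E') ∞
  have : ContinuousSMul G M := ContMDiffSMul.continuousSMul (I := 𝓘(ℝ, E')) (I' := 𝓘(ℝ, E)) ∞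
  obtain ⟨r, hr, hball⟩ := Metric.eventually_nhds_iff_ball.1 P.chart.left_inv
  have hQ : ∀ᶠ x in 𝓝 (β 0), a (inv x).1 • σ (inv x).2 = x ∧
      (∀ g : G, g • β 0 = x → (inv x).2 = 0) ∧ inv x ∈ Metric.ball 0 r :=
    P.chart.right_inv.and (P.orbit_eq.and
      (P.chart.tendsto_inv.eventually (Metric.ball_mem_nhds 0 hr)))
  obtain ⟨Q, hQ', hQmem⟩ := eventually_smul_mem_of_smul_mem (G := G) (β 0) hQ
  have hf0 : f (β 0) = 0 := h.lift 0 ⟨le_rfl, zero_le_two⟩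
  have hft : Tendsto f (𝓝 (β 0)) (𝓝 0) := by
    have := h.continuous.tendsto (β 0)
    rwa [hf0] at this
  have hβf : Tendsto (fun y => β (f y)) (𝓝 (β 0)) (𝓝 (β 0)) :=
    (h.smooth 0).continuousAt.tendsto.comp hft
  have hνr : 0 < r / (1 + ‖ν‖) := by positivity
  filter_upwards [hQ', hβf.eventually hQ', hft.eventually (gt_mem_nhds P.delta_pos),
    hft.eventually (gt_mem_nhds hνr)] with y hy1 hy2 hy3 hy4 g t ht hy
  have hfy : f y = t := by rw [hy, h.map_smul, h.lift t ht]
  rw [hfy] at hy2 hy3 hy4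
  -- With `β t` and `g • β t` near `β 0`, the point `g • β 0` lies in the chart too and has slice
  -- coordinate 0; hence it equals a(w) • β 0, and a(w)⁻¹g fixes `β 0`.
  obtain ⟨hx1, hx2, hx3⟩ := hQmem g (β t) hy2 (by rwa [← hy])
  rw [hx2 g rfl, P.chart.slice_zero] at hx1
  set w := (inv (g • β 0)).1 with hw
  have hk : ((a w)⁻¹ * g) • β 0 = β 0 := by rw [mul_smul, ← hx1, inv_smul_smul]
  have hyk : y = a w • σ (t • ρ ((a w)⁻¹ * g) ν) := by
    rw [P.slice_eq t ⟨ht.1, hy3.le⟩ _ hk, smul_smul, mul_inv_cancel_left, hy]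
  have hinv : inv y = (w, t • ρ ((a w)⁻¹ * g) ν) := by
    rw [hyk]
    refine hball (w, t • ρ ((a w)⁻¹ * g) ν) ?_
    rw [Metric.mem_ball, Prod.dist_eq, max_lt_iff]
    refine ⟨?_, ?_⟩
    · rw [Metric.mem_ball, Prod.dist_eq, max_lt_iff] at hx3
      exact hx3.1
    · change dist (t • ρ ((a w)⁻¹ * g) ν) 0 < r
      rw [dist_zero_right, norm_smul, P.norm_rho _ hk, Real.norm_of_nonneg ht.1]
      rw [lt_div_iff₀ (by positivity)] at hy4
      nlinarith [ht.1, norm_nonneg ν]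
  exact ⟨hy3.le, (a w)⁻¹ * g, hk, by rw [hinv, mul_inv_cancel_left], by rw [hinv]⟩

/-- The isotropy group of `β 0` acts transitively on the directions of the slice. -/
lemma exists_smul_rho_eq (P : IsPolarSlice E E' β σ a inv ρ ν δ)
    (h : IsNormalLift E E' G f β β' c) (u : N) :
    ∃ k : G, k • β 0 = β 0 ∧ u = (‖u‖ / ‖ν‖) • ρ k ν := by
  have h0 : Tendsto (fun n : N => ((0 : W), n)) (𝓝 0) (𝓝 0) :=
    (Continuous.prodMk_right (0 : W)).tendsto 0
  have h1 := P.chart.tendsto_slice.comp h0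
  have h2 : Tendsto (fun l : ℝ => l • u) (𝓝 0) (𝓝 0) := by
    have : Continuous fun l : ℝ => l • u := by fun_prop
    simpa using this.tendsto 0
  have h3 : ∀ᶠ l : ℝ in 𝓝[>] 0, inv (a (0 : W) • σ (l • u)) = ((0 : W), l • u) ∧
      ∀ (g : G) (t : ℝ), t ∈ Icc (0 : ℝ) 2 → a (0 : W) • σ (l • u) = g • β t →
        t ≤ δ ∧ ∃ k : G, k • β 0 = β 0 ∧ g = a (inv (a (0 : W) • σ (l • u))).1 * k ∧
          (inv (a (0 : W) • σ (l • u))).2 = t • ρ k ν :=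
    (((h0.comp h2).eventually P.chart.left_inv).and
      ((h1.comp h2).eventually (P.eventually_exists_mul h))).filter_mono nhdsWithin_le_nhds
  -- Scaled down by l, u enters the range of polar coordinates; its image under σ lies on some orbit
  -- through `β t`, because f separates the orbits and β meets every level.
  obtain ⟨l, ⟨hl1, hl2⟩, hl⟩ := (h3.and self_mem_nhdsWithin).exists
  have hl0 : (0 : ℝ) < l := hl
  have hmem := h.mem_Icc (a (0 : W) • σ (l • u))
  obtain ⟨g, hg⟩ := h.exists_smul _ (a (0 : W) • σ (l • u)) (h.lift _ hmem)
  obtain ⟨-, k, hk, -, hk2⟩ := hl2 g _ hmem hg.symm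
  rw [hl1] at hk2
  set t := f (a (0 : W) • σ (l • u))
  have hu : u = (l⁻¹ * t) • ρ k ν := by rw [mul_smul, ← hk2, inv_smul_smul₀ hl0.ne']
  have hnorm : ‖u‖ = l⁻¹ * t * ‖ν‖ := by
    rw [hu, norm_smul, P.norm_rho k hk, Real.norm_of_nonneg]
    exact mul_nonneg (inv_nonneg.2 hl0.le) hmem.1
  refine ⟨k, hk, ?_⟩
  rw [hnorm, mul_div_cancel_right₀ _ (norm_ne_zero_iff.2 P.ne_zero)]
  exact hu

omit hr hM [FiniteDimensional ℝ E] [FiniteDimensional ℝ E'] [IsManifold 𝓘(ℝ, E) ∞ M]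
  [CompactSpace G] [LieGroup 𝓘(ℝ, E') ∞ G] hsm [FiniteDimensional ℝ N] in
lemma eventually_inv_smul (P : IsPolarSlice E E' β σ a inv ρ ν δ) :
    ∀ᶠ τ in 𝓝[>] (0 : ℝ), τ ≤ δ ∧ ∀ k : G, k • β 0 = β 0 → inv (k • β τ) = (0, τ • ρ k ν) := by
  obtain ⟨r, hr, hball⟩ := Metric.eventually_nhds_iff_ball.1 P.chart.left_inv
  have hνr : 0 < r / (1 + ‖ν‖) := by positivity
  filter_upwards [Ioo_mem_nhdsGT (lt_min P.delta_pos hνr)] with τ hτ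
  have hτδ : τ ≤ δ := hτ.2.le.trans (min_le_left _ _)
  refine ⟨hτδ, fun k hk => ?_⟩
  have h1 := hball (0, τ • ρ k ν) (by
    rw [Metric.mem_ball, Prod.dist_eq, max_lt_iff]
    refine ⟨by simpa using hr, ?_⟩
    change dist (τ • ρ k ν) 0 < r
    rw [dist_zero_right, norm_smul, P.norm_rho _ hk, Real.norm_of_nonneg hτ.1.le]
    have h2 := hτ.2.trans_le (min_le_right _ _)
    rw [lt_div_iff₀ (by positivity)] at h2
    nlinarith [hτ.1, norm_nonneg ν])
  rwa [P.chart.a_zero, one_smul, P.slice_eq τ ⟨hτ.1.le, hτδ⟩ k hk] at h1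

/-- Fixing ν means fixing `β τ` for small τ > 0, and the isotropy is constant over the interior. So
the stabilizer of ν is H. -/
lemma rho_eq_iff (P : IsPolarSlice E E' β σ a inv ρ ν δ) (h : IsNormalLift E E' G f β β' c)
    {k : G} (hk : k • β 0 = β 0) : ρ k ν = ν ↔ k • β 1 = β 1 := by
  have hone : (1 : ℝ) ∈ Ioo (0 : ℝ) 2 := ⟨one_pos, one_lt_two⟩
  obtain ⟨τ, ⟨⟨hτδ, hτ⟩, hτ2⟩⟩ := (P.eventually_inv_smul.and (Ioo_mem_nhdsGT two_pos)).exists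
  constructor
  · intro hkν
    have h1 := P.slice_eq τ ⟨hτ2.1.le, hτδ⟩ k hk
    have h2 := P.slice_eq τ ⟨hτ2.1.le, hτδ⟩ 1 (one_smul G _)
    rw [P.rho_one, one_smul] at h2
    rw [hkν] at h1
    exact h.smul_eq_of_smul_eq hτ2 hone (h1.symm.trans h2)
  · intro hk1
    have h1 := hτ k hk
    have h2 := hτ 1 (one_smul G _)
    rw [h.smul_eq_of_smul_eq hone hτ2 hk1] at h1
    rw [one_smul, h1, P.rho_one] at h2
    exact smul_right_injective _ hτ2.1.ne' (congrArg Prod.snd h2)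

/-- The slice coordinate of `k • β τ`, divided by a fixed small τ, is smooth in k on a neighborhood
in G of the isotropy group. It extends k ↦ ρ k ν smoothly, although nothing is known about ρ off
that group. -/
lemma exists_smooth_orbit (P : IsPolarSlice E E' β σ a inv ρ ν δ)
    (h : IsNormalLift E E' G f β β' c) :
    ∃ b : G → N, ∀ k : G, k • β 0 = β 0 → (∀ᶠ l in 𝓝 k, SmoothAt E' N b l) ∧ b k = ρ k ν := by
  have : ContinuousSMul G M := ContMDiffSMul.continuousSMul (I := 𝓘(ℝ, E')) (I' := 𝓘(ℝ, E)) ∞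
  have hstab : IsCompact {k : G | k • β 0 = β 0} :=
    (isClosed_eq (by fun_prop) continuous_const).isCompact
  have h1 := (h.smooth 0).continuousAt.tendsto.eventually
    (eventually_forall_smul_mem hstab (fun _ hg => hg) P.chart.inv_smooth.eventually_nhds)
  obtain ⟨τ, ⟨⟨-, hτ⟩, hτ2⟩, hτ0⟩ :=
    ((P.eventually_inv_smul.and (h1.filter_mono nhdsWithin_le_nhds)).and
      self_mem_nhdsWithin).exists
  have hτ0' : (0 : ℝ) < τ := hτ0
  refine ⟨fun k => τ⁻¹ • (inv (k • β τ)).2, fun k hk => ⟨?_, ?_⟩⟩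
  · have hc : ContinuousAt (fun l : G => l • β τ) k := by fun_prop
    filter_upwards [hc.eventually (hτ2 k hk)] with l hl
    have h2 : SmoothAt E' (W × N) (fun l : G => inv (l • β τ)) l :=
      hl.comp_of_eq (smoothAt_smul_const (β τ) l) rfl
    have h3 : SmoothAt (W × N) N (fun q : W × N => τ⁻¹ • q.2) (inv (l • β τ)) :=
      SmoothAt.iff_contDiffAt.2 (contDiffAt_snd.const_smul τ⁻¹)
    exact h3.comp_of_eq h2 rfl
  · simp only [hτ k hk]
    exact inv_smul_smul₀ hτ0'.ne' _

/-- By transitivity the stabilizers of nonzero vectors are conjugates of the stabilizer H of ν.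
Normality makes them all equal to H, so an element fixing one nonzero vector acts trivially. -/
lemma isSimplyTransitive (P : IsPolarSlice E E' β σ a inv ρ ν δ)
    (h : IsNormalLift E E' G f β β' c)
    (hn : ∀ k l : G, k • β 0 = β 0 → l • β 1 = β 1 → (k * l * k⁻¹) • β 1 = β 1) :
    IsSimplyTransitive (ρ '' {k : G | k • β 0 = β 0}) := by
  have : IsTopologicalGroup G := topologicalGroup_of_lieGroup 𝓘(ℝ, E') ∞
  have : ContinuousSMul G M := ContMDiffSMul.continuousSMul (I := 𝓘(ℝ, E')) (I' := 𝓘(ℝ, E)) ∞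
  have hstab : IsCompact {k : G | k • β 0 = β 0} :=
    (isClosed_eq (by fun_prop) continuous_const).isCompact
  have hmul : ∀ {k l : G}, k • β 0 = β 0 → l • β 0 = β 0 → (k * l) • β 0 = β 0 := by
    intro k l hk hl; rw [mul_smul, hl, hk]
  have hinv : ∀ {k : G}, k • β 0 = β 0 → k⁻¹ • β 0 = β 0 := by
    intro k hk; rw [inv_smul_eq_iff, hk]
  have hcancel : ∀ {k : G}, k • β 0 = β 0 → ∀ u, ρ k⁻¹ (ρ k u) = u := by
    intro k hk u
    have := P.rho_mul k⁻¹ k (hinv hk) hk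
    rw [inv_mul_cancel, P.rho_one] at this
    exact (DFunLike.congr_fun this u).symm
  have hmulapp : ∀ {k l : G}, k • β 0 = β 0 → l • β 0 = β 0 → ∀ u, ρ (k * l) u = ρ k (ρ l u) :=
    fun hk hl u => DFunLike.congr_fun (P.rho_mul _ _ hk hl) u
  constructor
  · exact ⟨1, one_smul G _, P.rho_one⟩
  · rintro _ ⟨k, hk, rfl⟩ _ ⟨l, hl, rfl⟩
    exact ⟨k * l, hmul hk hl, P.rho_mul k l hk hl⟩
  · rintro _ ⟨k, hk, rfl⟩
    refine ⟨ρ k⁻¹, ⟨k⁻¹, hinv hk, rfl⟩, ?_, ?_⟩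
    · rw [← P.rho_mul _ _ (hinv hk) hk, inv_mul_cancel, P.rho_one]
    · rw [← P.rho_mul _ _ hk (hinv hk), mul_inv_cancel, P.rho_one]
  -- Continuity of ρ is tested on vectors; each vector is a multiple of some ρ l ν, on which ρ k
  -- acts through b(kl).
  · obtain ⟨b, hb⟩ := P.exists_smooth_orbit h
    refine hstab.image_of_continuousOn (continuousOn_clm_apply.2 fun u => ?_)
    obtain ⟨l, hl, hu⟩ := P.exists_smul_rho_eq h u
    have hc : ContinuousOn (fun k => (‖u‖ / ‖ν‖) • b (k * l)) {k : G | k • β 0 = β 0} := by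
      intro k hk
      have h1 : ContinuousAt b (k * l) := ((hb _ (hmul hk hl)).1.self_of_nhds).continuousAt
      have h2 : ContinuousAt (fun k => b (k * l)) k :=
        ContinuousAt.comp (f := fun k => k * l) h1 (by fun_prop)
      exact (h2.const_smul _).continuousWithinAt
    refine hc.congr fun k hk => ?_
    simp only [(hb _ (hmul hk hl)).2]
    rw [hmulapp hk hl, ← map_smul, ← hu]
  · rintro _ ⟨k, hk, rfl⟩
    exact P.norm_rho k hk
  · rintro _ ⟨k, hk, rfl⟩ u hu0 hku
    obtain ⟨l, hl, hu⟩ := P.exists_smul_rho_eq h u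
    have hne : ‖u‖ / ‖ν‖ ≠ 0 := div_ne_zero (norm_ne_zero_iff.2 hu0) (norm_ne_zero_iff.2 P.ne_zero)
    have h1 : ρ k (ρ l ν) = ρ l ν := by
      rw [hu, map_smul] at hku
      exact smul_right_injective _ hne hku
    have h2 : ρ (l⁻¹ * k * l) ν = ν := by
      rw [hmulapp (hmul (hinv hl) hk) hl, hmulapp (hinv hl) hk, h1, hcancel hl]
    have h3 := (P.rho_eq_iff h (hmul (hmul (hinv hl) hk) hl)).1 h2
    ext1 v
    obtain ⟨m, hm, hv⟩ := P.exists_smul_rho_eq h v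
    -- Conjugating l⁻¹kl ∈ H by m⁻¹l gives m⁻¹km ∈ H, so k also fixes ρ m ν.
    have h4 := hn (m⁻¹ * l) _ (hmul (hinv hm) hl) h3
    have h5 : m⁻¹ * l * (l⁻¹ * k * l) * (m⁻¹ * l)⁻¹ = m⁻¹ * k * m := by group
    rw [h5] at h4
    have h6 := (P.rho_eq_iff h (hmul (hmul (hinv hm) hk) hm)).2 h4
    have h7 : ρ k (ρ m ν) = ρ m ν := by
      conv_rhs => rw [← h6]
      rw [← hmulapp hk hm, ← hmulapp hm (hmul (hmul (hinv hm) hk) hm)]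
      congr 1
      group
    rw [hv, map_smul, h7]
    rfl
  · intro u v huv
    obtain ⟨k, hk, hu⟩ := P.exists_smul_rho_eq h u
    obtain ⟨l, hl, hv⟩ := P.exists_smul_rho_eq h v
    refine ⟨_, ⟨l * k⁻¹, hmul hl (hinv hk), rfl⟩, ?_⟩
    rw [hu, map_smul, hmulapp hl (hinv hk), hcancel hk, huv, ← hv]

end IsPolarSlice

end PolarSlice

/-! ### Local smooth extensions of the right action. -/

section LocalExtension

open Filter Topology Set

variable {E E' : Type*} [NormedAddCommGroup E] [NormedSpace ℝ E] [FiniteDimensional ℝ E]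
  [NormedAddCommGroup E'] [NormedSpace ℝ E'] [FiniteDimensional ℝ E']
  {M : Type*} [MetricSpace M] [ChartedSpace E M] [IsManifold 𝓘(ℝ, E) ∞ M]
  [RiemannianBundle (fun x : M => TangentSpace 𝓘(ℝ, E) x)]
  [hr : IsContMDiffRiemannianBundle 𝓘(ℝ, E) ∞ E (fun x : M => TangentSpace 𝓘(ℝ, E) x)]
  [hM : IsRiemannianManifold 𝓘(ℝ, E) M]
  {G : Type*} [Group G] [TopologicalSpace G] [ChartedSpace E' G] [LieGroup 𝓘(ℝ, E') ∞ G]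
  [CompactSpace G]
  [MulAction G M] [hsm : ContMDiffSMul 𝓘(ℝ, E') 𝓘(ℝ, E) ∞ G M]
  {f : M → ℝ} {β : ℝ → M} {β' : ℝ → E} {c : ℝ}

namespace IsNormalLift

/-- The right action `(g • β t) · k = (g * k) • β t` extends smoothly to a neighborhood of the
endpoint `β 0`. -/
lemma exists_extension_zero (h : IsNormalLift E E' G f β β' c)
    (hn : ∀ k l : G, k • β 0 = β 0 → l • β 1 = β 1 → (k * l * k⁻¹) • β 1 = β 1) {k₀ : G}
    (hk₀ : k₀ • β 0 = β 0) :
    ∃ F : M × G → M, ∀ᶠ q in 𝓝 (β 0, k₀),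
      ContMDiffAt (𝓘(ℝ, E).prod 𝓘(ℝ, E')) 𝓘(ℝ, E) ∞ F q ∧
      ∀ (g : G) (t : ℝ), t ∈ Icc (0 : ℝ) 2 → q.1 = g • β t → q.2 • β 0 = β 0 →
        F q = (g * q.2) • β t := by
  obtain ⟨n, W, σ, a, inv, ρ, ν, δ, P⟩ := h.exists_isPolarSlice
  have : Nontrivial (EuclideanSpace ℝ (Fin n)) := ⟨⟨ν, 0, P.ne_zero⟩⟩
  obtain ⟨T, hT⟩ := (P.isSimplyTransitive h hn).exists_linear_extension P.ne_zero
  let T' := LinearMap.toContinuousLinearMap T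
  obtain ⟨b, hb⟩ := P.exists_smooth_orbit h
  -- On the slice, (t ρ(l)ν)·k = t ρ(l)ρ(k)ν = T(t ρ(l)ν)(ρ(k)ν). This is linear in the slice
  -- coordinate, hence smooth through the singular orbit.
  let S : M × G → EuclideanSpace ℝ (Fin n) := fun q => T' (inv q.1).2 (b q.2)
  have hS : ∀ q : M × G, SmoothAt E (W × EuclideanSpace ℝ (Fin n)) inv q.1 →
      SmoothAt E' (EuclideanSpace ℝ (Fin n)) b q.2 →
      ContMDiffAt (𝓘(ℝ, E).prod 𝓘(ℝ, E')) 𝓘(ℝ, EuclideanSpace ℝ (Fin n)) ∞ S q := by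
    intro q h1 h2
    have h3 : ContMDiffAt (𝓘(ℝ, E).prod 𝓘(ℝ, E')) 𝓘(ℝ, W × EuclideanSpace ℝ (Fin n)) ∞
        (fun q : M × G => inv q.1) q := ContMDiffAt.comp q h1 contMDiffAt_fst
    have h4 : ContMDiffAt (𝓘(ℝ, E).prod 𝓘(ℝ, E')) 𝓘(ℝ, EuclideanSpace ℝ (Fin n)) ∞
        (fun q : M × G => b q.2) q := ContMDiffAt.comp q h2 contMDiffAt_snd
    have h5 : SmoothAt (W × EuclideanSpace ℝ (Fin n)) _ (fun z => T' z.2) (inv q.1) :=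
      SmoothAt.iff_contDiffAt.2 (T'.contDiff.contDiffAt.comp _ contDiffAt_snd)
    exact (ContMDiffAt.comp (g := fun z : W × EuclideanSpace ℝ (Fin n) => T' z.2)
      (f := fun q : M × G => inv q.1) q h5 h3).clm_apply h4
  have hinv1 : Tendsto (fun q : M × G => (inv q.1).1) (𝓝 (β 0, k₀)) (𝓝 0) :=
    (continuous_fst.tendsto (0 : W × EuclideanSpace ℝ (Fin n))).comp
      (P.chart.tendsto_inv.comp continuousAt_fst)
  have hS0 : Tendsto S (𝓝 (β 0, k₀)) (𝓝 0) := by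
    have h1 := (hS (β 0, k₀) P.chart.inv_smooth.self_of_nhds
      (hb k₀ hk₀).1.self_of_nhds).continuousAt
    have h2 : S (β 0, k₀) = 0 := by simp [S, P.chart.inv_self]
    rwa [ContinuousAt, h2] at h1
  have hfst : Tendsto (fun q : M × G => q.1) (𝓝 (β 0, k₀)) (𝓝 (β 0)) := continuousAt_fst
  have hsnd : Tendsto (fun q : M × G => q.2) (𝓝 (β 0, k₀)) (𝓝 k₀) := continuousAt_snd
  refine ⟨fun q => a (inv q.1).1 • σ (S q), ?_⟩
  filter_upwards [hfst.eventually P.chart.inv_smooth, hsnd.eventually (hb k₀ hk₀).1,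
    hinv1.eventually P.chart.a_smooth, hS0.eventually P.chart.slice_smooth,
    hfst.eventually (P.eventually_exists_mul h)] with q h1 h2 h3 h4 h5
  constructor
  · have h6 : ContMDiffAt (𝓘(ℝ, E).prod 𝓘(ℝ, E')) 𝓘(ℝ, W × EuclideanSpace ℝ (Fin n)) ∞
        (fun q : M × G => inv q.1) q := ContMDiffAt.comp q h1 contMDiffAt_fst
    have h7 : SmoothAt (W × EuclideanSpace ℝ (Fin n)) E' (fun z => a z.1) (inv q.1) :=
      h3.comp_of_eq (SmoothAt.iff_contDiffAt.2 contDiffAt_fst) rfl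
    exact ContMDiffAt.smul (ContMDiffAt.comp (g := fun z : W × EuclideanSpace ℝ (Fin n) => a z.1)
      (f := fun q : M × G => inv q.1) q h7 h6) (ContMDiffAt.comp q h4 (hS q h1 h2))
  · intro g t ht hq hk
    obtain ⟨htδ, k, hk', hg, hn⟩ := h5 g t ht hq
    have h6 : S q = t • ρ (k * q.2) ν := by
      change T (inv q.1).2 (b q.2) = _
      rw [hn, _root_.map_smul, hT _ ⟨k, hk', rfl⟩, (hb _ hk).2, P.rho_mul k q.2 hk' hk]
      rfl
    have h7 : (k * q.2) • β 0 = β 0 := by rw [mul_smul, hk, hk']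
    simp only [h6]
    rw [P.slice_eq t ⟨ht.1, htδ⟩ _ h7, smul_smul, ← mul_assoc, ← hg]

/-- The right action extends smoothly to a neighborhood of each interior point of the normal
geodesic. -/
lemma exists_extension_of_mem_Ioo (h : IsNormalLift E E' G f β β' c)
    (hn : ∀ k l : G, k • β 0 = β 0 → l • β 1 = β 1 → (k * l * k⁻¹) • β 1 = β 1) (k₀ : G)
    {t₀ : ℝ} (ht₀ : t₀ ∈ Ioo (0 : ℝ) 2) :
    ∃ F : M × G → M, ∀ᶠ q in 𝓝 (β t₀, k₀),
      ContMDiffAt (𝓘(ℝ, E).prod 𝓘(ℝ, E')) 𝓘(ℝ, E) ∞ F q ∧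
      ∀ (g : G) (t : ℝ), t ∈ Icc (0 : ℝ) 2 → q.1 = g • β t → q.2 • β 0 = β 0 →
        F q = (g * q.2) • β t := by
  obtain ⟨W, a, inv, hs, hf⟩ := h.exists_isSliceChart_of_mem_Ioo ht₀
  have hfst : Tendsto (fun q : M × G => q.1) (𝓝 (β t₀, k₀)) (𝓝 (β t₀)) := continuousAt_fst
  have hinv1 : Tendsto (fun q : M × G => (inv q.1).1) (𝓝 (β t₀, k₀)) (𝓝 0) :=
    (continuous_fst.tendsto (0 : W × ℝ)).comp (hs.tendsto_inv.comp hfst)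
  have hft : Tendsto f (𝓝 (β t₀)) (𝓝 t₀) := by
    have := h.continuous.tendsto (β t₀)
    rwa [h.lift _ (Ioo_subset_Icc_self ht₀)] at this
  refine ⟨fun q => a (inv q.1).1 • (q.2 • β (t₀ + (inv q.1).2)), ?_⟩
  filter_upwards [hfst.eventually hs.inv_smooth, hinv1.eventually hs.a_smooth,
    hfst.eventually hs.right_inv, hfst.eventually hf,
    (hft.comp hfst).eventually (Ioo_mem_nhds ht₀.1 ht₀.2)] with q h1 h2 h3 h4 h5
  constructor
  · have h6 : ContMDiffAt (𝓘(ℝ, E).prod 𝓘(ℝ, E')) 𝓘(ℝ, W × ℝ) ∞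
        (fun q : M × G => inv q.1) q := ContMDiffAt.comp q h1 contMDiffAt_fst
    have h7 : SmoothAt (W × ℝ) E' (fun z => a z.1) (inv q.1) :=
      h2.comp_of_eq (SmoothAt.iff_contDiffAt.2 contDiffAt_fst) rfl
    have h8 : SmoothAt (W × ℝ) E (fun z => β (t₀ + z.2)) (inv q.1) :=
      (h.smooth _).comp_of_eq (SmoothAt.iff_contDiffAt.2 (contDiffAt_const.add contDiffAt_snd)) rfl
    exact ContMDiffAt.smul
      (ContMDiffAt.comp (g := fun z : W × ℝ => a z.1) (f := fun q : M × G => inv q.1) q h7 h6)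
      (ContMDiffAt.smul contMDiffAt_snd (ContMDiffAt.comp (g := fun z : W × ℝ => β (t₀ + z.2))
        (f := fun q : M × G => inv q.1) q h8 h6))
  · intro g t ht hq hk
    have hft : f q.1 = t := by rw [hq, h.map_smul, h.lift t ht]
    rw [Function.comp_apply, hft] at h5
    rw [hft] at h4
    rw [← h4, hq] at h3
    set w := (inv q.1).1 with hw
    rw [← hq, ← hw] at h3
    -- The chart represents the point by a(w) instead of g. The two differ by an element of H, which
    -- normality allows to pass across the right factor.
    have h6 : (g⁻¹ * a w) • β t = β t := by rw [mul_smul, h3, hq, inv_smul_smul]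
    have hone : (1 : ℝ) ∈ Ioo (0 : ℝ) 2 := ⟨one_pos, one_lt_two⟩
    have hkinv : q.2⁻¹ • β 0 = β 0 := by rw [inv_smul_eq_iff, hk]
    have h7 := hn q.2⁻¹ _ hkinv (h.smul_eq_of_smul_eq h5 hone h6)
    have h8 := h.smul_eq_of_smul_eq hone h5 h7
    change a w • (q.2 • β (t₀ + (inv q.1).2)) = _
    rw [← h4]
    have h9 : (g * q.2) • ((q.2⁻¹ * (g⁻¹ * a w) * q.2⁻¹⁻¹) • β t) = (g * q.2) • β t := by rw [h8]
    rw [← h9, smul_smul, smul_smul]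
    congr 1
    group

/-- The right action of the isotropy group of `β 0` extends smoothly to a neighborhood of each point
that does not lie over the other endpoint. -/
theorem exists_extension (h : IsNormalLift E E' G f β β' c)
    (hn : ∀ k l : G, k • β 0 = β 0 → l • β 1 = β 1 → (k * l * k⁻¹) • β 1 = β 1) {k₀ : G}
    (hk₀ : k₀ • β 0 = β 0) {x₀ : M} (hx₀ : f x₀ < 2) :
    ∃ F : M × G → M, ∀ᶠ q in 𝓝 (x₀, k₀),
      ContMDiffAt (𝓘(ℝ, E).prod 𝓘(ℝ, E')) 𝓘(ℝ, E) ∞ F q ∧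
      ∀ (g : G) (t : ℝ), t ∈ Icc (0 : ℝ) 2 → q.1 = g • β t → q.2 • β 0 = β 0 →
        F q = (g * q.2) • β t := by
  have : ContinuousSMul G M := ContMDiffSMul.continuousSMul (I := 𝓘(ℝ, E')) (I' := 𝓘(ℝ, E)) ∞
  have hmem := h.mem_Icc x₀
  obtain ⟨g₀, hg₀⟩ := h.exists_smul (β (f x₀)) x₀ (h.lift _ hmem)
  have hβ : ∃ F : M × G → M, ∀ᶠ q in 𝓝 (β (f x₀), k₀),
      ContMDiffAt (𝓘(ℝ, E).prod 𝓘(ℝ, E')) 𝓘(ℝ, E) ∞ F q ∧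
      ∀ (g : G) (t : ℝ), t ∈ Icc (0 : ℝ) 2 → q.1 = g • β t → q.2 • β 0 = β 0 →
        F q = (g * q.2) • β t := by
    rcases hmem.1.eq_or_lt with h0 | h0
    · rw [← h0]
      exact h.exists_extension_zero hn hk₀
    · exact h.exists_extension_of_mem_Ioo hn k₀ ⟨h0, hx₀⟩
  obtain ⟨F, hF⟩ := hβ
  -- The right action commutes with the left action of G, so an extension near a point of the
  -- geodesic can be translated.
  refine ⟨fun q => g₀ • F (g₀⁻¹ • q.1, q.2), ?_⟩
  have hc : Tendsto (fun q : M × G => (g₀⁻¹ • q.1, q.2)) (𝓝 (x₀, k₀)) (𝓝 (β (f x₀), k₀)) := by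
    have h1 : Continuous fun q : M × G => (g₀⁻¹ • q.1, q.2) := by fun_prop
    have h2 := h1.tendsto (x₀, k₀)
    rwa [inv_smul_eq_iff.2 hg₀.symm] at h2
  filter_upwards [hc.eventually hF] with q ⟨h1, h2⟩
  constructor
  · have h3 : ContMDiffAt (𝓘(ℝ, E).prod 𝓘(ℝ, E')) (𝓘(ℝ, E).prod 𝓘(ℝ, E')) ∞
        (fun q : M × G => (g₀⁻¹ • q.1, q.2)) q :=
      (ContMDiffAt.smul (I := 𝓘(ℝ, E')) (contMDiffAt_const (c := g₀⁻¹)) contMDiffAt_fst).prodMk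
        contMDiffAt_snd
    exact ContMDiffAt.smul (I := 𝓘(ℝ, E')) (contMDiffAt_const (c := g₀))
      (ContMDiffAt.comp q h1 h3)
  · intro g t ht hq hk
    rw [h2 (g₀⁻¹ * g) t ht (by rw [hq, smul_smul]) hk, smul_smul]
    congr 1
    group

end IsNormalLift

end LocalExtension

/-! ### The global right action and the theorem. -/

section RightAction

open Filter Topology Set

variable {E E' : Type*} [NormedAddCommGroup E] [NormedSpace ℝ E] [FiniteDimensional ℝ E]
  [NormedAddCommGroup E'] [NormedSpace ℝ E'] [FiniteDimensional ℝ E']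
  {M : Type*} [MetricSpace M] [ChartedSpace E M] [IsManifold 𝓘(ℝ, E) ∞ M]
  [RiemannianBundle (fun x : M => TangentSpace 𝓘(ℝ, E) x)]
  [hr : IsContMDiffRiemannianBundle 𝓘(ℝ, E) ∞ E (fun x : M => TangentSpace 𝓘(ℝ, E) x)]
  [hM : IsRiemannianManifold 𝓘(ℝ, E) M]
  {G : Type*} [Group G] [TopologicalSpace G] [ChartedSpace E' G] [LieGroup 𝓘(ℝ, E') ∞ G]
  [CompactSpace G]
  [MulAction G M]

section Action

variable [hsm : ContMDiffSMul 𝓘(ℝ, E') 𝓘(ℝ, E) ∞ G M]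
  {f : M → ℝ} {β : ℝ → M} {β' : ℝ → E} {c : ℝ}

/-- The right action of `K / H` on the part of `M` lying over `[0, 1]`. -/
lemma IsNormalLift.exists_rightAction (h : IsNormalLift E E' G f β β' c) {H K : Subgroup G}
    (hK : ∀ k, k ∈ K ↔ k • β 0 = β 0) (hH : ∀ l, l ∈ H ↔ l • β 1 = β 1)
    (hn : ∀ k ∈ K, ∀ l ∈ H, k * l * k⁻¹ ∈ H) [(H.subgroupOf K).Normal]
    {D : Set M} (hD : ∀ x, x ∈ D ↔ f x ≤ 1) :
    ∃ _ : MulAction (↥K ⧸ H.subgroupOf K)ᵐᵒᵖ D, ∀ (x : D) (g : G) (t : ℝ) (k : K),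
      t ∈ Icc (0 : ℝ) 2 → (x : M) = g • β t →
        ((MulOpposite.op (k : ↥K ⧸ H.subgroupOf K) • x : D) : M) = (g * (k : G)) • β t := by
  have hone : (1 : ℝ) ∈ Ioo (0 : ℝ) 2 := ⟨one_pos, one_lt_two⟩
  -- At t = 0 the factors from K fix `β 0`. For t > 0, g and k are each determined up to right
  -- multiplication by H, and normality moves the ambiguity of g past k'.
  have hwd : ∀ (t : ℝ) (g g' : G) (k k' : K), t ∈ Icc (0 : ℝ) 1 → g • β t = g' • β t →
      (k : ↥K ⧸ H.subgroupOf K) = k' → (g * k) • β t = (g' * k') • β t := by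
    intro t g g' k k' ht hg hk
    rcases ht.1.eq_or_lt with rfl | h0
    · rw [mul_smul, mul_smul, (hK k).1 k.2, (hK k').1 k'.2, hg]
    · have htI : t ∈ Ioo (0 : ℝ) 2 := ⟨h0, by linarith [ht.2]⟩
      have hl : ((k : G)⁻¹ * k') ∈ H := Subgroup.mem_subgroupOf.1 (QuotientGroup.eq.1 hk)
      have h1 : ((k : G)⁻¹ * k') • β t = β t := h.smul_eq_of_smul_eq hone htI ((hH _).1 hl)
      have h2 : (g'⁻¹ * g) ∈ H := (hH _).2 (h.smul_eq_of_smul_eq htI hone (by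
        rw [mul_smul, hg, inv_smul_smul]))
      have h3 := hn _ (K.inv_mem k'.2) _ h2
      have h4 := h.smul_eq_of_smul_eq hone htI ((hH _).1 h3)
      have h5 : (g * k) • β t = (g * k) • (((k : G)⁻¹ * k') • β t) := by rw [h1]
      rw [h5]
      have h6 : (g' * k') • β t = (g' * k') • (((k' : G)⁻¹ * (g'⁻¹ * g) * (k' : G)⁻¹⁻¹) • β t) := by
        rw [h4]
      rw [h6, smul_smul, smul_smul]
      congr 1
      group
  have hlift : ∀ x : D, ∃ g : G, g • β (f x) = x := fun x =>
    h.exists_smul _ _ (h.lift _ (h.mem_Icc x))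
  choose γ hγ using hlift
  have hfD : ∀ (x : D) (g : G), g • β (f x) ∈ D := by
    intro x g
    rw [hD, h.map_smul, h.lift _ (h.mem_Icc _)]
    exact (hD x).1 x.2
  let act : (↥K ⧸ H.subgroupOf K)ᵐᵒᵖ → D → D := fun q x =>
    ⟨(γ x * ((Quotient.out q.unop : K) : G)) • β (f x), hfD x _⟩
  have hact : ∀ (x : D) (g : G) (t : ℝ) (k : K), t ∈ Icc (0 : ℝ) 2 → (x : M) = g • β t →
      ((act (MulOpposite.op (k : ↥K ⧸ H.subgroupOf K)) x : D) : M) = (g * (k : G)) • β t := by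
    intro x g t k ht hx
    have hft : f x = t := by rw [hx, h.map_smul, h.lift t ht]
    have hγx := hγ x
    simp only [act]
    rw [hft] at hγx ⊢
    refine hwd t _ _ _ _ ⟨ht.1, hft ▸ (hD x).1 x.2⟩ (hγx.trans hx) ?_
    exact QuotientGroup.out_eq' _
  have hone_smul : ∀ x, act 1 x = x := fun x => by
    apply Subtype.ext
    refine (hact x (γ x) (f x) 1 (h.mem_Icc x) (hγ x).symm).trans ?_
    rw [OneMemClass.coe_one, mul_one, hγ]
  have hmul_smul : ∀ p q x, act (p * q) x = act p (act q x) := fun p q x => by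
    obtain ⟨k, hk⟩ := QuotientGroup.mk_surjective p.unop
    obtain ⟨l, hl⟩ := QuotientGroup.mk_surjective q.unop
    rw [← MulOpposite.op_unop p, ← MulOpposite.op_unop q, ← hk, ← hl]
    apply Subtype.ext
    have h1 := hact x (γ x) (f x) l (h.mem_Icc x) (hγ x).symm
    have h2 := hact (act (MulOpposite.op (l : ↥K ⧸ H.subgroupOf K)) x) _ _ k (h.mem_Icc x) h1
    -- In the opposite group the product p * q is the class of l * k: acting first by q multiplies
    -- by l on the right first.
    have h3 := hact x (γ x) (f x) (l * k) (h.mem_Icc x) (hγ x).symm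
    rw [mul_assoc, ← Subgroup.coe_mul] at h2
    exact h3.trans h2.symm
  exact ⟨{ smul := act, one_smul := hone_smul, mul_smul := hmul_smul }, hact⟩

end Action

/-- The reparametrisation places the chosen endpoint at 0 and `γ 0` at 1, so both values of s are
treated at once. -/
lemma isNormalLift_of_isNormalGeodesic (hGM : IsCohomogeneityOneAction E E' G M)
    (e : MulAction.orbitRel.Quotient G M ≃ₜ Icc (-1 : ℝ) 1) {γ : ℝ → M}
    (hγ : IsNormalGeodesic (E := E) (E' := E') e γ) {s : ℝ} (hs : s = -1 ∨ s = 1) :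
    ∃ (β' : ℝ → E) (c : ℝ), IsNormalLift E E' G (fun x => 1 - s * orbitProj e x)
      (fun t => γ (s * (1 - t))) β' c := by
  have := hGM.smooth
  have : ContinuousSMul G M := ContMDiffSMul.continuousSMul (I := 𝓘(ℝ, E')) (I' := 𝓘(ℝ, E)) ∞
  have hss : s * s = 1 := by rcases hs with rfl | rfl <;> norm_num
  have hs0 : s ≠ 0 := by rintro rfl; simp at hss
  have habs : |s| = 1 := by rcases hs with rfl | rfl <;> simp
  have hIcc : ∀ t ∈ Icc (0 : ℝ) 2, s * (1 - t) ∈ Icc (-1 : ℝ) 1 := by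
    intro t ht
    rw [Set.mem_Icc, ← abs_le, abs_mul, habs, one_mul, abs_le]
    constructor <;> linarith [ht.1, ht.2]
  have hcont : Continuous (orbitProj e) :=
    continuous_subtype_val.comp (e.continuous.comp continuous_quotient_mk')
  obtain ⟨c, hc0, hc⟩ := hγ.geodesic.locally_minimizing
  let D : ℝ → ℝ →L[ℝ] E := fun t => mfderiv 𝓘(ℝ, ℝ) 𝓘(ℝ, E) γ t
  have hγD : ∀ t, HasD γ (D t) t := fun t =>
    ((hγ.geodesic.smooth t).mdifferentiableAt (by simp)).hasMFDerivAt
  have haff : ContDiff ℝ ∞ fun t : ℝ => s * (1 - t) := by fun_prop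
  have haff' : ∀ t : ℝ, HasDerivAt (fun t : ℝ => s * (1 - t)) (-s) t := fun t => by
    simpa using ((hasDerivAt_id t).const_sub 1).const_mul s
  refine ⟨fun t => -s • D (s * (1 - t)) 1, c, ?_⟩
  constructor
  · fun_prop
  · intro g x
    have : orbitProj e (g • x) = orbitProj e x := by
      refine congrArg (fun y => (e y : ℝ)) (Quotient.sound ?_)
      exact ⟨g, rfl⟩
    rw [this]
  · intro x y hxy
    have h1 : orbitProj e x = orbitProj e y := mul_left_cancel₀ hs0 (by linarith)
    obtain ⟨g, hg⟩ := Quotient.exact (e.injective (Subtype.ext h1))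
    exact ⟨g⁻¹, inv_smul_eq_iff.2 hg.symm⟩
  · intro x
    have h1 := (e (Quotient.mk (MulAction.orbitRel G M) x)).2
    have h2 : |s * orbitProj e x| ≤ 1 := by
      rw [abs_mul, habs, one_mul, abs_le]
      exact h1
    rw [abs_le] at h2
    constructor <;> linarith [h2.1, h2.2]
  · intro U hU
    have h1 : IsOpen (e '' (Quotient.mk (MulAction.orbitRel G M) '' U)) :=
      e.isOpenMap _ (isOpenMap_quotient_mk'_mul U hU)
    obtain ⟨V, hV, hVe⟩ := isOpen_induced_iff.1 h1
    refine ⟨(fun t => s * (1 - t)) ⁻¹' V, hV.preimage haff.continuous, ?_⟩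
    ext t
    constructor
    · rintro ⟨x, hx, rfl⟩
      have h2 : e (Quotient.mk (MulAction.orbitRel G M) x) ∈ Subtype.val ⁻¹' V :=
        hVe.ge ⟨_, ⟨x, hx, rfl⟩, rfl⟩
      have h3 : orbitProj e x ∈ V := h2
      have h4 := (e (Quotient.mk (MulAction.orbitRel G M) x)).2
      have h5 : |s * orbitProj e x| ≤ 1 := by
        rw [abs_mul, habs, one_mul, abs_le]
        exact h4
      rw [abs_le] at h5
      refine ⟨?_, by constructor <;> linarith [h5.1, h5.2]⟩
      change s * (1 - (1 - s * orbitProj e x)) ∈ V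
      rwa [sub_sub_cancel, ← mul_assoc, hss, one_mul]
    · rintro ⟨ht1, ht2⟩
      obtain ⟨_, ⟨x, hx, rfl⟩, hex⟩ := hVe.le
        (show (⟨s * (1 - t), hIcc t ht2⟩ : Icc (-1 : ℝ) 1) ∈ Subtype.val ⁻¹' V from ht1)
      refine ⟨x, hx, ?_⟩
      have h2 : orbitProj e x = s * (1 - t) := congrArg Subtype.val hex
      simp only [h2, ← mul_assoc, hss]
      ring
  · intro t ht
    simp only [hγ.lift _ (hIcc t ht), ← mul_assoc, hss]
    ring
  · intro t
    exact SmoothAt.comp_of_eq (E := ℝ) (E' := ℝ) (g := γ) (f := fun t : ℝ => s * (1 - t))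
      (hγ.geodesic.smooth _) (SmoothAt.iff_contDiffAt.2 haff.contDiffAt) rfl
  · intro t
    have h1 := (hγD (s * (1 - t))).comp_of_eq
      (HasD.iff_hasFDerivAt.2 (haff' t).hasFDerivAt) rfl
    convert h1 using 1
    refine ContinuousLinearMap.ext_ring ?_
    change (1 : ℝ) • (-s • D (s * (1 - t)) 1) =
      D (s * (1 - t)) ((1 : ℝ) • (-s))
    rw [one_smul, one_smul, ← map_smul, smul_eq_mul, mul_one]
  · intro t w hw
    rw [riem_smul_left]
    exact mul_eq_zero_of_right _ (hγ.perpendicular (s * (1 - t)) w hw)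
  · exact hGM.isometric
  -- Zero speed would make γ constant near 0, against π(γ t) = t.
  · obtain ⟨ε, hε, h1⟩ := hc 0
    have hδ : 0 < min ε 1 / 2 := by positivity
    have hδ1 : min ε 1 / 2 ≤ 1 := by linarith [min_le_right ε 1]
    have hδ2 : min ε 1 / 2 < ε := by linarith [min_le_left ε 1]
    have h2 := h1 0 ⟨by linarith, by linarith⟩ (min ε 1 / 2) ⟨by linarith, by linarith⟩
    refine hc0.lt_of_ne ?_
    rintro rfl
    rw [zero_mul, dist_eq_zero] at h2
    have h3 := congrArg (orbitProj e) h2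
    rw [hγ.lift _ ⟨by norm_num, by norm_num⟩, hγ.lift _ ⟨by linarith, hδ1⟩] at h3
    exact hδ.ne h3
  · intro t₀
    obtain ⟨ε, hε, h1⟩ := hc (s * (1 - t₀))
    filter_upwards [haff.continuous.continuousAt.eventually
      (Ioo_mem_nhds (sub_lt_self _ hε) (lt_add_of_pos_right _ hε))] with t ht
    rw [h1 _ ⟨sub_lt_self _ hε, lt_add_of_pos_right _ hε⟩ _ ht]
    congr 1
    rw [← mul_sub, abs_mul, habs, one_mul, sub_sub_sub_cancel_left, abs_sub_comm]

end RightAction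

theorem lemma2p6
    {E E' : Type*} [NormedAddCommGroup E] [NormedSpace ℝ E] [FiniteDimensional ℝ E]
    [NormedAddCommGroup E'] [NormedSpace ℝ E'] [FiniteDimensional ℝ E']
    -- a connected Riemannian manifold `M`
    {M : Type*} [MetricSpace M] [ChartedSpace E M] [IsManifold 𝓘(ℝ, E) ∞ M]
    [RiemannianBundle (fun x : M => TangentSpace 𝓘(ℝ, E) x)]
    [IsContMDiffRiemannianBundle 𝓘(ℝ, E) ∞ E (fun x : M => TangentSpace 𝓘(ℝ, E) x)]
    [IsRiemannianManifold 𝓘(ℝ, E) M] [ConnectedSpace M]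
    -- a compact Lie group `G`
    {G : Type*} [Group G] [TopologicalSpace G] [ChartedSpace E' G] [LieGroup 𝓘(ℝ, E') ∞ G]
    [T2Space G] [CompactSpace G]
    -- a cohomogeneity one action with orbit space `[-1, 1]` and a fixed normal geodesic
    [MulAction G M] (hGM : IsCohomogeneityOneAction E E' G M)
    (e : MulAction.orbitRel.Quotient G M ≃ₜ Set.Icc (-1 : ℝ) 1)
    (γ : ℝ → M) (hγ : IsNormalGeodesic (E := E) (E' := E') e γ)
    -- one of the two endpoints of the orbit space
    (s : ℝ) (hs : s = -1 ∨ s = 1)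
    -- the principal isotropy group `H`, the isotropy group `K` at `γ s`, and the orbit `S`
    (H K : Subgroup G) (hH : H = MulAction.stabilizer G (γ 0))
    (hK : K = MulAction.stabilizer G (γ s))
    (S : Set M) (hS : S = MulAction.orbit G (γ s))
    -- `S` is a singular orbit
    (hsing : orbitDim (E := E) (E' := E') G (γ s) < orbitDim (E := E) (E' := E') G (γ 0))
    -- `H` is a normal subgroup of `K`
    (hHK : H ≤ K) [hnormal : (H.subgroupOf K).Normal] :
    -- a right action of `K / H` on `D(S)`
    ∃ _ : MulAction (↥K ⧸ H.subgroupOf K)ᵐᵒᵖ ↥(tubularNhd e s),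
      -- it is smooth, as a map `D(S) × K → M`, where `K ⊆ G`
      IsSmoothOnSubset (𝓘(ℝ, E).prod 𝓘(ℝ, E')) (E₂ := E) (tubularNhd e s ×ˢ (K : Set G))
        (fun p => ((MulOpposite.op ((⟨p.1.2, p.2.2⟩ : K) : ↥K ⧸ H.subgroupOf K) •
          (⟨p.1.1, p.2.1⟩ : ↥(tubularNhd e s)) : ↥(tubularNhd e s)) : M)) ∧
      -- it fixes every point of `S`
      (∀ x : ↥(tubularNhd e s), (x : M) ∈ S → ∀ q : (↥K ⧸ H.subgroupOf K)ᵐᵒᵖ, q • x = x) ∧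
      -- its other orbits are exactly the fibers of `G / H → G / K` in the principal orbits in `D(S)`
      {O : Set M | ∃ x : ↥(tubularNhd e s), (x : M) ∉ S ∧
          O = Subtype.val '' MulAction.orbit (↥K ⧸ H.subgroupOf K)ᵐᵒᵖ x} =
        {O : Set M | ∃ t ∈ Set.Ioo (-1 : ℝ) 1, 0 ≤ s * t ∧
          ∃ g : G, O = homogeneousFiber hHK (γ t) g} ∧
      -- it extends the right actions `(g H) · (k H) = g k H` on the principal orbits
      (∀ t ∈ Set.Ioo (-1 : ℝ) 1, ∀ (g : G) (k : K) (hx : g • γ t ∈ tubularNhd e s),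
        ((MulOpposite.op (k : ↥K ⧸ H.subgroupOf K) •
          (⟨g • γ t, hx⟩ : ↥(tubularNhd e s)) : ↥(tubularNhd e s)) : M) = (g * (k : G)) • γ t) := by
  have := hGM.smooth
  obtain ⟨β', c, h⟩ := isNormalLift_of_isNormalGeodesic hGM e hγ hs
  have hss : s * s = 1 := by rcases hs with rfl | rfl <;> norm_num
  have hsmem : s ∈ Set.Icc (-1 : ℝ) 1 := by rcases hs with rfl | rfl <;> norm_num
  have hγβ : ∀ t, γ t = γ (s * (1 - (1 - s * t))) := fun t => by
    rw [sub_sub_cancel, ← mul_assoc, hss, one_mul]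
  have hst : ∀ t ∈ Set.Icc (-1 : ℝ) 1, 1 - s * t ∈ Set.Icc (0 : ℝ) 2 := by
    intro t ht
    rcases hs with rfl | rfl <;> constructor <;> linarith [ht.1, ht.2]
  have hK' : ∀ k, k ∈ K ↔ k • γ (s * (1 - 0)) = γ (s * (1 - 0)) := by
    intro k
    rw [hK, MulAction.mem_stabilizer_iff, sub_zero, mul_one]
  have hH' : ∀ l, l ∈ H ↔ l • γ (s * (1 - 1)) = γ (s * (1 - 1)) := by
    intro l
    rw [hH, MulAction.mem_stabilizer_iff, sub_self, mul_zero]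
  have hn : ∀ k ∈ K, ∀ l ∈ H, k * l * k⁻¹ ∈ H := fun k hk l hl =>
    Subgroup.mem_subgroupOf.1 (hnormal.conj_mem ⟨l, hHK hl⟩ (Subgroup.mem_subgroupOf.2 hl) ⟨k, hk⟩)
  have hD : ∀ x, x ∈ tubularNhd e s ↔ 1 - s * orbitProj e x ≤ 1 := fun x => by
    rw [tubularNhd, Set.mem_ofPred_eq]
    constructor <;> intro hx <;> linarith
  obtain ⟨inst, hact⟩ := h.exists_rightAction hK' hH' hn hD
  have hactγ : ∀ (x : ↥(tubularNhd e s)) (g : G) (k : K), ∀ t ∈ Set.Icc (-1 : ℝ) 1,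
      (x : M) = g • γ t → ((MulOpposite.op (k : ↥K ⧸ H.subgroupOf K) • x : ↥(tubularNhd e s)) : M) =
        (g * (k : G)) • γ t := by
    intro x g k t ht hx
    rw [hγβ t] at hx ⊢
    exact hact x g _ k (hst t ht) hx
  have horbit : ∀ (x : ↥(tubularNhd e s)) (g : G), ∀ t ∈ Set.Icc (-1 : ℝ) 1, (x : M) = g • γ t →
      Subtype.val '' MulAction.orbit (↥K ⧸ H.subgroupOf K)ᵐᵒᵖ x = homogeneousFiber hHK (γ t) g := by
    intro x g t ht hx
    ext y
    constructor
    · rintro ⟨_, ⟨q, rfl⟩, rfl⟩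
      obtain ⟨k, hk⟩ := QuotientGroup.mk_surjective q.unop
      refine ⟨g * k, ?_, ?_⟩
      · rw [Set.mem_preimage, Subgroup.quotientMapOfLE_apply_mk, Set.mem_singleton_iff]
        exact QuotientGroup.mk_mul_of_mem g k.2
      · rw [← hactγ x g k t ht hx, hk, MulOpposite.op_unop]
    · rintro ⟨a, ha, rfl⟩
      rw [Set.mem_preimage, Subgroup.quotientMapOfLE_apply_mk, Set.mem_singleton_iff, eq_comm,
        QuotientGroup.eq] at ha
      refine ⟨_, ⟨MulOpposite.op ((⟨g⁻¹ * a, ha⟩ : K) : ↥K ⧸ H.subgroupOf K), rfl⟩, ?_⟩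
      refine (hactγ x g ⟨g⁻¹ * a, ha⟩ t ht hx).trans ?_
      rw [mul_inv_cancel_left]
  have hSf : ∀ x, x ∈ S → 1 - s * orbitProj e x = 0 := by
    intro x hx
    rw [hS] at hx
    obtain ⟨g, rfl⟩ := hx
    have h1 := h.map_smul g (γ s)
    simp only [hγ.lift s hsmem, hss, sub_self] at h1
    exact h1
  refine ⟨inst, ?_, ?_, ?_, ?_⟩
  · rintro ⟨⟨x₀, k₀⟩, hx₀, hk₀⟩
    obtain ⟨F, hF⟩ := h.exists_extension (fun k l hk hl =>
      (hH' _).1 (hn k ((hK' k).2 hk) l ((hH' l).2 hl))) ((hK' k₀).1 hk₀)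
      (((hD x₀).1 hx₀).trans_lt one_lt_two)
    obtain ⟨U, hUF, hU, hmem⟩ := eventually_nhds_iff.1 hF
    refine ⟨U, F, hU, hmem, fun q hq => (hUF q hq).1.contMDiffWithinAt, ?_⟩
    rintro ⟨⟨x, k⟩, hx, hk⟩ hxk
    obtain ⟨g, hg⟩ := h.exists_smul _ x (h.lift _ (h.mem_Icc x))
    have h1 := (hUF (x, k) hxk).2 g _ (h.mem_Icc x) hg.symm ((hK' k).1 hk)
    exact h1.trans (hact ⟨x, hx⟩ g _ ⟨k, hk⟩ (h.mem_Icc x) hg.symm).symm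
  · intro x hx q
    obtain ⟨k, hk⟩ := QuotientGroup.mk_surjective q.unop
    rw [hS] at hx
    obtain ⟨g, hg⟩ := hx
    apply Subtype.ext
    rw [← MulOpposite.op_unop q, ← hk, hactγ x g k s hsmem hg.symm, mul_smul]
    have h1 : (k : G) • γ s = γ s := by
      have := (hK' k).1 k.2
      rwa [sub_zero, mul_one] at this
    rw [h1]
    exact hg
  · ext O
    constructor
    · rintro ⟨x, hxS, rfl⟩
      obtain ⟨g, hg⟩ := h.exists_smul _ (x : M) (h.lift _ (h.mem_Icc x))
      rw [← hγβ] at hg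
      have hmem : orbitProj e (x : M) ∈ Set.Icc (-1 : ℝ) 1 :=
        (e (Quotient.mk (MulAction.orbitRel G M) (x : M))).2
      have hx : 0 ≤ s * orbitProj e (x : M) := x.2
      have hne : orbitProj e (x : M) ≠ s := by
        intro h1
        apply hxS
        rw [h1] at hg
        rw [hS]
        exact ⟨g, hg⟩
      refine ⟨orbitProj e (x : M), ⟨hmem.1.lt_of_ne ?_, hmem.2.lt_of_ne ?_⟩, hx, g,
        horbit x g _ hmem hg.symm⟩
      -- Of the two endpoints, one is s itself, excluded because x is not in S; the other violates 0
      -- ≤ s π(x).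
      · intro h1
        rcases hs with rfl | rfl
        · exact hne h1.symm
        · rw [← h1] at hx; norm_num at hx
      · intro h1
        rcases hs with rfl | rfl
        · rw [h1] at hx; norm_num at hx
        · exact hne h1
    · rintro ⟨t, ht, hst0, g, rfl⟩
      have htI := Set.Ioo_subset_Icc_self ht
      have hproj : 1 - s * orbitProj e (g • γ t) = 1 - s * t := by
        have h1 := h.map_smul g (γ t)
        rwa [hγ.lift t htI] at h1
      have hx : g • γ t ∈ tubularNhd e s := by
        rw [hD, hproj]; linarith
      refine ⟨⟨g • γ t, hx⟩, fun hxS => ?_, (horbit _ g t htI rfl).symm⟩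
      have h1 := hSf _ hxS
      rw [hproj] at h1
      rcases hs with rfl | rfl <;> linarith [ht.1, ht.2]
  · intro t ht g k hx
    exact hactγ _ g k t (Set.Ioo_subset_Icc_self ht) rfl
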